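/- For $f\in L^2(\mathbb R)$ put $\widehat f(\xi)=\int_{\mathbb R}e^{-ix\xi}f(x)\,dx$ (Plancherel transform) and, for $(t,x)\in\mathbb R^2$, \[ [\widetilde E_5]f(t,x)=\frac1{2\pi}\int_{\mathbb R}|\xi+\xi^3|^{1/6}e^{ix\xi+it(\xi^3+\xi^5)}\widehat f(\xi)\,d\xi,\qquad [e^{it\Delta}]f(x)=\frac1{2\pi}\int_{\mathbb R}e^{ix\xi-it\xi^2}\widehat f(\xi)\,d\xi, \] where each integral over $\mathbb R$ is the limit in $L^6_{t,x}=L^6(\mathbb R^2)$ of the integrals over $\{|\xi|\le R\}$ as $R\to\infty$. Let $g_1,g_2\in L^2(\mathbb R)$ and, for $N\in\mathbb R$, let $\widetilde g_N(x)=e^{ixN}g_1(x)+e^{-ixN}g_2(x)$. Then $[\widetilde E_5]\widetilde g_N$ (for every $N$), $[e^{it\Delta}]g_1$ and $[e^{it\Delta}]g_2$ are well defined elements of $L^6_{t,x}$, the limit $\lim_{N\to\infty}\|[\widetilde E_5]\widetilde g_N\|_{L^6_{t,x}}$ exists and is finite, and \[ \lim_{N\to\infty}\big\|[\widetilde E_5]\widetilde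 g_N\big\|_{L^6_{t,x}}\le 4^{-1/6}\Big(\big\|[e^{it\Delta}]g_1\big\|_{L^6_{t,x}}^2+\big\|[e^{it\Delta}]g_2\big\|_{L^6_{t,x}}^2\Big)^{1/2}. \] Equality holds if and only if $\big|[e^{it\Delta}]g_1(x)\big|=\big|[e^{-it\Delta}]g_2(x)\big|$ for almost every $(t,x)\in\mathbb R^2$. -/

import Mathlib

open MeasureTheory Filter Topology
open scoped FourierTransform ENNReal

noncomputable section

/-- The space `L²(ℝ)` of complex-valued functions. -/
abbrev L2R : Type := Lp ℂ 2 (volume : Measure ℝ)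

/-- The `L²` Fourier transform in the normalization `f̂(ξ) = ∫ e^{-ixξ} f(x) dx`
(Mathlib's Plancherel transform is `∫ e^{-2πixξ} f(x) dx`, whence the rescaling). -/
def fourierHat (f : L2R) (ξ : ℝ) : ℂ :=
  (𝓕 f : L2R) (ξ / (2 * Real.pi))

/-- The absolutely convergent integral
`(1/2π) ∫_{|ξ| ≤ R} m(ξ) e^{ixξ + itφ(ξ)} f̂(ξ) dξ` at the point `p = (t, x)`. -/
def truncExtension (m φ : ℝ → ℝ) (f : L2R) (R : ℝ) (p : ℝ × ℝ) : ℂ :=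
  (1 / (2 * Real.pi) : ℂ) * ∫ ξ in Set.Icc (-R) R,
    (m ξ : ℂ) * Complex.exp (Complex.I * ((p.2 * ξ + p.1 * φ ξ : ℝ) : ℂ)) * fourierHat f ξ

/-- `u(t, x) = (1/2π) ∫_ℝ m(ξ) e^{ixξ + itφ(ξ)} f̂(ξ) dξ`, where the integral over `ℝ` is the limit
in `L⁶(ℝ²)` of the integrals over `|ξ| ≤ R` as `R → ∞`. Such a `u` is unique up to null sets. -/
def IsExtension (m φ : ℝ → ℝ) (f : L2R) (u : ℝ × ℝ → ℂ) : Prop :=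
  MemLp u 6 volume ∧
    Tendsto (fun R : ℝ => eLpNorm (fun p => truncExtension m φ f R p - u p) 6 volume)
      atTop (𝓝 0)

open scoped Classical in
/-- The extension operator with weight `m` and phase `φ`, as a function of `p = (t, x)`. -/
def extension (m φ : ℝ → ℝ) (f : L2R) : ℝ × ℝ → ℂ :=
  if h : ∃ u, IsExtension m φ f u then h.choose else 0

/-- The weight `1` of the Schrödinger propagator. -/
def schrodingerWeight (_ : ℝ) : ℝ := 1

/-- The phase of `e^{itΔ}`, the propagator of `i v_t + Δ v = 0`: `Δ` has symbol `-ξ²`. -/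
def schrodingerPhase (ξ : ℝ) : ℝ := -ξ ^ 2

/-- `(t, x) ↦ e^{itΔ} f (x)`. -/
def schrodinger (f : L2R) : ℝ × ℝ → ℂ :=
  extension schrodingerWeight schrodingerPhase f

/-- The weight `|ξ + ξ³|^{1/6}`. -/
def weight35 (ξ : ℝ) : ℝ := |ξ + ξ ^ 3| ^ (1 / 6 : ℝ)

/-- The phase `ξ³ + ξ⁵`. -/
def phase35 (ξ : ℝ) : ℝ := ξ ^ 3 + ξ ^ 5

/-- `Ẽ₅ f (t, x) = (1/2π) ∫ |ξ + ξ³|^{1/6} e^{ixξ + it(ξ³ + ξ⁵)} f̂(ξ) dξ`. -/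
def extension35 (f : L2R) : ℝ × ℝ → ℂ :=
  extension weight35 phase35 f

/-- The `L⁶` norm over `(t, x) ∈ ℝ²`. -/
def normL6 (u : ℝ × ℝ → ℂ) : ℝ := (eLpNorm u 6 volume).toReal

theorem memLp_modulate (N : ℝ) (g : L2R) :
    MemLp (fun x : ℝ => Complex.exp (Complex.I * ((x * N : ℝ) : ℂ)) * g x) 2 volume := by
  refine (Lp.memLp g).of_le ?_ (Eventually.of_forall fun x => ?_)
  · exact (Continuous.aestronglyMeasurable (by fun_prop)).mul (Lp.aestronglyMeasurable g)
  · rw [norm_mul, mul_comm Complex.I, Complex.norm_exp_ofReal_mul_I, one_mul]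

/-- `x ↦ e^{ixN} g(x)` as an element of `L²(ℝ)`. -/
def modulate (N : ℝ) (g : L2R) : L2R := (memLp_modulate N g).toLp _

/-- `g̃_N(x) = e^{ixN} g₁(x) + e^{-ixN} g₂(x)`. -/
def twoProfile (g₁ g₂ : L2R) (N : ℝ) : L2R := modulate N g₁ + modulate (-N) g₂

end

open scoped SchwartzMap ContDiff

noncomputable section

/-! The transform of the datum sits near the frequencies `N` and `-N`. Write `φ(ξ) = ξ³ + ξ⁵` and
expand it around `N`. The constant term gives a carrier wave, the linear term a translation with
velocity `φ'(N)`, and the quadratic term has coefficient `φ''(N)/2 ~ 10 N³`. The change of variables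
`t = -s/(10N³)`, `x = y + φ'(N) s/(10N³)` therefore turns the piece at `N` into `e^{iθ}` times an
oscillatory integral whose phase tends to `-η²`, the Schrödinger one. Since `φ` is odd, `φ'` is even
and `φ''` is odd: the same change of variables serves the piece at `-N`, which becomes `e^{-iθ}`
times a backward Schrödinger wave. The weight is asymptotic to `√N` and the Jacobian contributes
`10^{1/6} √N` to the `L⁶` norm, so `10^{1/6}` times the norm of the extension has the same limit as
the norm of `e^{iθ} A + e^{-iθ} B`, with `A = e^{isΔ}g₁` and `B = e^{-isΔ}g₂`
(`tendsto_eLpNorm_rescale_sub_wavePair`).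

Expanding `|e^{iθ} A + e^{-iθ} B|⁶` leaves `|A|⁶ + 9|A|⁴|B|² + 9|A|²|B|⁴ + |B|⁶` plus terms that
oscillate with phases `2θ`, `4θ`, `6θ`, which vanish in the limit by the Riemann–Lebesgue lemma.
With `X = ‖A‖²` and `Y = ‖B‖²`, Hölder bounds the integral by `X³ + 9X²Y + 9XY² + Y³`, and this
equals `(5/2)(X+Y)³ - (3/2)(X+Y)(X-Y)²`. Equality forces `X = Y`, and then the pointwise identity
`10(a⁶+b⁶) - meanSix a b = 9(a²+b²)(a²-b²)²` forces `|A| = |B|` almost everywhere.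

Two analytic facts support this. The `L² → L⁶` bound (`lintegral_oscIntegral_pow_six_le`) gives a
meaning to the extensions and reduces the asymptotics to smooth compactly supported profiles. It
comes from writing the cube as an integral over `ℝ³` in polar coordinates around the diagonal and
applying Plancherel in `x` and in `t` for each fixed angle. For such profiles, van der Corput's
decay `|s|^{-1/2}`, uniform in `N`, makes dominated convergence in time possible
(`tendsto_eLpNorm_oscIntegral_sub`). -/

/-! ### Norms as integrals, the Plancherel transform and modulation. -/

theorem eLpNorm_natCast_pow {α : Type*} [MeasurableSpace α] {μ : Measure α} (f : α → ℂ) (n : ℕ)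
    (hn : n ≠ 0) : eLpNorm f (n : ℝ≥0∞) μ ^ n = ∫⁻ x, ‖f x‖ₑ ^ n ∂μ := by
  have h := eLpNorm_nnreal_pow_eq_lintegral (f := f) (μ := μ) (p := (n : NNReal))
    (by simpa using hn)
  simpa [ENNReal.rpow_natCast] using h

theorem eLpNorm_two_sq {α : Type*} [MeasurableSpace α] {μ : Measure α} (f : α → ℂ) :
    eLpNorm f 2 μ ^ 2 = ∫⁻ x, ‖f x‖ₑ ^ 2 ∂μ :=
  eLpNorm_natCast_pow f 2 two_ne_zero

theorem eLpNorm_six_pow {α : Type*} [MeasurableSpace α] {μ : Measure α} (f : α → ℂ) :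
    eLpNorm f 6 μ ^ 6 = ∫⁻ x, ‖f x‖ₑ ^ 6 ∂μ :=
  eLpNorm_natCast_pow f 6 (by norm_num)

theorem lintegral_comp_mul_left_real {c : ℝ} (hc : c ≠ 0) (f : ℝ → ℝ≥0∞) :
    ∫⁻ x, f (c * x) = ENNReal.ofReal |c⁻¹| * ∫⁻ x, f x := by
  have h := lintegral_map_equiv (μ := (volume : Measure ℝ)) f (MeasurableEquiv.mulLeft₀ c hc)
  rw [MeasurableEquiv.coe_mulLeft₀, Real.map_volume_mul_left hc, lintegral_smul_measure] at h
  simpa using h.symm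

/-- The `L²` Fourier transform is its own transpose. -/
theorem integral_schwartz_smul_fourier_L2 (f : L2R) (ψ : 𝓢(ℝ, ℂ)) :
    ∫ x, ψ x • (𝓕 f : L2R) x = ∫ x, (𝓕 ψ) x • f x := by
  have h := congrArg (fun T => T ψ) (Lp.fourier_toTemperedDistribution_eq f)
  simp only [TemperedDistribution.fourier_apply, Lp.toTemperedDistribution_apply] at h
  exact h.symm

theorem ae_eq_of_integral_schwartz_smul_eq {f g : ℝ → ℂ} (hf : LocallyIntegrable f)
    (hg : LocallyIntegrable g) (h : ∀ ψ : 𝓢(ℝ, ℂ), ∫ x, ψ x • f x = ∫ x, ψ x • g x) :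
    f =ᵐ[volume] g := by
  refine ae_eq_of_integral_contDiff_smul_eq hf hg fun χ hχ hχs => ?_
  have hs : HasCompactSupport (fun x => ((χ x : ℝ) : ℂ)) := hχs.comp_left Complex.ofReal_zero
  have hd : ContDiff ℝ (⊤ : ℕ∞) (fun x => ((χ x : ℝ) : ℂ)) := Complex.ofRealCLM.contDiff.comp hχ
  have := h (hs.toSchwartzMap hd)
  simpa using this

/-- On `L¹ ∩ L²` the `L²` Fourier transform is given by the Fourier integral. -/
theorem fourier_toLp_ae_eq {h : ℝ → ℂ} (h1 : Integrable h) (h2 : MemLp h 2) :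
    ((𝓕 (h2.toLp h) : L2R) : ℝ → ℂ) =ᵐ[volume] 𝓕 h := by
  refine ae_eq_of_integral_schwartz_smul_eq
    ((Lp.memLp (𝓕 (h2.toLp h) : L2R)).locallyIntegrable (by norm_num))
    (VectorFourier.fourierIntegral_continuous Real.continuous_fourierChar continuous_inner
      h1).locallyIntegrable fun ψ => ?_
  rw [integral_schwartz_smul_fourier_L2]
  have e1 : ∫ x, (𝓕 ψ) x • (h2.toLp h) x = ∫ x, (𝓕 ψ) x • h x :=
    integral_congr_ae (h2.coeFn_toLp.mono fun x hx => by simp only [hx])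
  rw [e1, SchwartzMap.fourier_coe]
  simpa using! VectorFourier.integral_fourierIntegral_smul_eq_flip (L := innerₗ ℝ)
    (μ := volume) (ν := volume) Real.continuous_fourierChar continuous_inner ψ.integrable h1

/-- Stated for integrable functions only: outside `L²` the right side is infinite, so later uses
need not check square integrability. -/
theorem eLpNorm_fourier_le {h : ℝ → ℂ} (h1 : Integrable h) :
    eLpNorm (𝓕 h) 2 volume ≤ eLpNorm h 2 volume := by
  by_cases h2 : MemLp h 2
  · rw [← eLpNorm_congr_ae (fourier_toLp_ae_eq h1 h2), ← Lp.enorm_def]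
    have : ‖(𝓕 (h2.toLp h) : L2R)‖ = ‖h2.toLp h‖ := Lp.norm_fourier_eq _
    rw [← ofReal_norm, this, ofReal_norm, Lp.enorm_toLp]
  · have : eLpNorm h 2 volume = ⊤ := by
      by_contra hne
      exact h2 ⟨h1.1, lt_top_iff_ne_top.2 hne⟩
    simp [this]

/-- Plancherel's inequality for `x ↦ ∫ a(ξ) e^{ixξ} dξ`. -/
theorem lintegral_enorm_sq_fourier_le {a : ℝ → ℂ} (ha : Integrable a) :
    ∫⁻ x : ℝ, ‖∫ ξ, a ξ * Complex.exp (Complex.I * ((x * ξ : ℝ) : ℂ))‖ₑ ^ 2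
      ≤ ENNReal.ofReal (2 * Real.pi) * ∫⁻ ξ, ‖a ξ‖ₑ ^ 2 := by
  have key : ∀ x : ℝ, ∫ ξ, a ξ * Complex.exp (Complex.I * ((x * ξ : ℝ) : ℂ))
      = 𝓕 a (-(2 * Real.pi)⁻¹ * x) := fun x => by
    rw [Real.fourier_real_eq_integral_exp_smul]
    refine integral_congr_ae (Eventually.of_forall fun ξ => ?_)
    simp only [smul_eq_mul]
    rw [mul_comm]
    congr 2
    have := Real.pi_ne_zero
    push_cast
    have h : (Real.pi : ℂ) ≠ 0 := by exact_mod_cast this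
    field_simp
  simp_rw [key]
  have hpi : (0 : ℝ) < 2 * Real.pi := by positivity
  rw [lintegral_comp_mul_left_real (c := -(2 * Real.pi)⁻¹) (by simp)
    (fun w => ‖𝓕 a w‖ₑ ^ 2), inv_neg, inv_inv, abs_neg, abs_of_pos hpi]
  rw [← eLpNorm_two_sq, ← eLpNorm_two_sq]
  gcongr
  exact eLpNorm_fourier_le ha

/-- Tested against Schwartz functions, the modulation moves onto `𝓕 ψ`, where it is the transform of
a translate of `ψ`; moving the transform back leaves a translate of `𝓕 g`. -/
theorem fourier_modulate_ae_eq (N : ℝ) (g : L2R) :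
    ((𝓕 (modulate N g) : L2R) : ℝ → ℂ) =ᵐ[volume]
      fun ξ => (𝓕 g : L2R) (ξ - N / (2 * Real.pi)) := by
  have hm : MemLp (fun ξ => (𝓕 g : L2R) (ξ - N / (2 * Real.pi))) 2 volume :=
    (Lp.memLp (𝓕 g : L2R)).comp_measurePreserving
      (measurePreserving_sub_right volume (N / (2 * Real.pi)))
  refine ae_eq_of_integral_schwartz_smul_eq
    ((Lp.memLp (𝓕 (modulate N g) : L2R)).locallyIntegrable (by norm_num))
    (hm.locallyIntegrable (by norm_num)) fun ψ => ?_
  rw [integral_schwartz_smul_fourier_L2]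
  have e1 : ∀ᵐ x, (𝓕 ψ) x • (modulate N g) x
      = (𝓕 (ψ.compSubConstCLM ℂ (-(N / (2 * Real.pi))))) x • g x := by
    filter_upwards [(memLp_modulate N g).coeFn_toLp] with x hx
    have h1 : (𝓕 (ψ.compSubConstCLM ℂ (-(N / (2 * Real.pi))))) x
        = Complex.exp (Complex.I * ((x * N : ℝ) : ℂ)) * (𝓕 ψ) x := by
      rw [SchwartzMap.fourier_coe, SchwartzMap.fourier_coe]
      have h2 : (⇑(ψ.compSubConstCLM ℂ (-(N / (2 * Real.pi))))) =
          ψ ∘ fun v => v + N / (2 * Real.pi) := by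
        ext v; simp
      have h3 := congrFun (VectorFourier.fourierIntegral_comp_add_right 𝐞 volume (innerₗ ℝ) ψ
        (N / (2 * Real.pi))) x
      rw [h2]
      refine h3.trans ?_
      rw [Circle.smul_def, Real.fourierChar_apply, smul_eq_mul]
      congr 2
      have h : (Real.pi : ℂ) ≠ 0 := by exact_mod_cast Real.pi_ne_zero
      simp
      field_simp
    have h4 : (modulate N g) x = Complex.exp (Complex.I * ((x * N : ℝ) : ℂ)) * g x := hx
    rw [h4, h1, smul_eq_mul, smul_eq_mul]
    ring
  rw [integral_congr_ae e1, ← integral_schwartz_smul_fourier_L2]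
  rw [← integral_sub_right_eq_self _ (N / (2 * Real.pi))]
  simp

/-- Lets almost everywhere identities for `𝓕` pass through the rescaling in `fourierHat`. -/
theorem quasiMeasurePreserving_div_two_pi :
    Measure.QuasiMeasurePreserving (fun ξ : ℝ => ξ / (2 * Real.pi)) volume volume := by
  refine ⟨by fun_prop, ?_⟩
  have hc : (2 * Real.pi)⁻¹ ≠ 0 := by positivity
  have := Real.map_volume_mul_right hc
  simp only [div_eq_mul_inv]
  rw [this]
  exact Measure.smul_absolutelyContinuous

theorem measurable_fourierHat (f : L2R) : Measurable (fourierHat f) :=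
  (Lp.stronglyMeasurable (𝓕 f : L2R)).measurable.comp (measurable_id.div_const _)

theorem memLp_fourierHat (f : L2R) : MemLp (fourierHat f) 2 volume := by
  refine ⟨(measurable_fourierHat f).aestronglyMeasurable, ?_⟩
  have h : eLpNorm (fourierHat f) 2 volume ^ 2 < ⊤ := by
    rw [eLpNorm_two_sq]
    have := lintegral_comp_mul_left_real (c := (2 * Real.pi)⁻¹) (by positivity)
      (fun w => ‖(𝓕 f : L2R) w‖ₑ ^ 2)
    simp only [fourierHat, div_eq_inv_mul]
    rw [this, ← eLpNorm_two_sq]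
    exact ENNReal.mul_lt_top ENNReal.ofReal_lt_top (ENNReal.pow_lt_top (Lp.memLp (𝓕 f : L2R)).2)
  simpa using h

theorem fourierHat_modulate_ae_eq (N : ℝ) (g : L2R) :
    fourierHat (modulate N g) =ᵐ[volume] fun ξ => fourierHat g (ξ - N) := by
  filter_upwards [quasiMeasurePreserving_div_two_pi.ae (fourier_modulate_ae_eq N g)] with ξ hξ
  simp only [fourierHat, hξ, sub_div]

theorem fourierHat_add_ae_eq (f g : L2R) :
    fourierHat (f + g) =ᵐ[volume] fun ξ => fourierHat f ξ + fourierHat g ξ := by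
  have h : ((𝓕 (f + g) : L2R) : ℝ → ℂ) =ᵐ[volume] (𝓕 f : L2R) + (𝓕 g : L2R) := by
    rw [FourierTransform.fourier_add]
    exact Lp.coeFn_add _ _
  filter_upwards [quasiMeasurePreserving_div_two_pi.ae h] with ξ hξ
  simpa [fourierHat] using hξ

theorem fourierHat_twoProfile_ae_eq (g₁ g₂ : L2R) (N : ℝ) :
    fourierHat (twoProfile g₁ g₂ N) =ᵐ[volume]
      fun ξ => fourierHat g₁ (ξ - N) + fourierHat g₂ (ξ + N) := by
  filter_upwards [fourierHat_add_ae_eq (modulate N g₁) (modulate (-N) g₂),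
    fourierHat_modulate_ae_eq N g₁, fourierHat_modulate_ae_eq (-N) g₂] with ξ h1 h2 h3
  rw [twoProfile, h1, h2, h3, sub_neg_eq_add]

/-! ### The `L⁶` extension estimate via polar coordinates around the diagonal. -/

/-- The oscillatory integral `(t, x) ↦ ∫ a(ξ) e^{ixξ + itφ(ξ)} dξ`. -/
def oscIntegral (φ : ℝ → ℝ) (a : ℝ → ℂ) (p : ℝ × ℝ) : ℂ :=
  ∫ ξ, a ξ * Complex.exp (Complex.I * ((p.2 * ξ + p.1 * φ ξ : ℝ) : ℂ))

theorem norm_exp_I_mul_ofReal (x : ℝ) : ‖Complex.exp (Complex.I * (x : ℂ))‖ = 1 := by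
  rw [mul_comm, Complex.norm_exp_ofReal_mul_I]

theorem MeasureTheory.Integrable.mul_exp_I {α : Type*} [MeasurableSpace α] {μ : Measure α}
    {f : α → ℂ} (hf : Integrable f μ) {θ : α → ℝ} (hθ : Measurable θ) :
    Integrable (fun x => f x * Complex.exp (Complex.I * ((θ x : ℝ) : ℂ))) μ := by
  have hm : Measurable fun x => Complex.exp (Complex.I * ((θ x : ℝ) : ℂ)) := by fun_prop
  refine hf.mono (hf.1.mul hm.aestronglyMeasurable) (Eventually.of_forall fun x => ?_)
  rw [norm_mul, norm_exp_I_mul_ofReal, mul_one]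

/-- Plancherel's inequality for an oscillatory integral whose phase `t τ(r)` is monotone in `r`. -/
theorem lintegral_enorm_sq_phase_le {J : Set ℝ} (hJ : MeasurableSet J) {τ τ' : ℝ → ℝ}
    (hτ : ∀ r ∈ J, HasDerivAt τ (τ' r) r) (hinj : Set.InjOn τ J) (hne : ∀ r ∈ J, τ' r ≠ 0)
    {h : ℝ → ℂ} (hh : IntegrableOn h J) :
    ∫⁻ t : ℝ, ‖∫ r in J, h r * Complex.exp (Complex.I * ((t * τ r : ℝ) : ℂ))‖ₑ ^ 2
      ≤ ENNReal.ofReal (2 * Real.pi) * ∫⁻ r in J, ‖h r‖ₑ ^ 2 / ENNReal.ofReal |τ' r| := by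
  set ρ : ℝ → ℝ := Function.invFunOn τ J
  have hρ : ∀ r ∈ J, ρ (τ r) = r := fun r hr => hinj.leftInvOn_invFunOn hr
  -- The substitution `w = τ(r)` turns `h dr` into `g dw`, so that ordinary Plancherel applies;
  -- `|g|² dw` pulls back to `|h|²/|τ'| dr`.
  set g : ℝ → ℂ := fun w => h (ρ w) / (|τ' (ρ w)| : ℝ) with hg
  have hder : ∀ r ∈ J, HasDerivWithinAt τ (τ' r) J r := fun r hr => (hτ r hr).hasDerivWithinAt
  have himg : MeasurableSet (τ '' J) := by
    refine hJ.image_of_continuousOn_injOn (fun r hr => (hder r hr).continuousWithinAt) hinj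
  have hgr : ∀ r ∈ J, |τ' r| • g (τ r) = h r := fun r hr => by
    have : ((|τ' r| : ℝ) : ℂ) ≠ 0 := by
      exact_mod_cast abs_ne_zero.2 (hne r hr)
    simp only [hg, hρ r hr, Complex.real_smul]
    field_simp
  have hgint : IntegrableOn g (τ '' J) := by
    rw [integrableOn_image_iff_integrableOn_abs_deriv_smul hJ hder hinj]
    exact hh.congr_fun (fun r hr => (hgr r hr).symm) hJ
  have key : ∀ t : ℝ, ∫ r in J, h r * Complex.exp (Complex.I * ((t * τ r : ℝ) : ℂ))
      = ∫ w, (τ '' J).indicator g w * Complex.exp (Complex.I * ((t * w : ℝ) : ℂ)) := fun t => by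
    have h1 : ∀ w, (τ '' J).indicator g w * Complex.exp (Complex.I * ((t * w : ℝ) : ℂ))
        = (τ '' J).indicator (fun w => g w * Complex.exp (Complex.I * ((t * w : ℝ) : ℂ))) w :=
      fun w => by by_cases hw : w ∈ τ '' J <;> simp [hw]
    simp_rw [h1]
    rw [integral_indicator himg, integral_image_eq_integral_abs_deriv_smul hJ hder hinj]
    refine setIntegral_congr_fun hJ fun r hr => ?_
    rw [← smul_mul_assoc, hgr r hr]
  simp_rw [key]
  refine (lintegral_enorm_sq_fourier_le ((integrable_indicator_iff himg).2 hgint)).trans_eq ?_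
  congr 1
  have h2 : ∀ w, ‖(τ '' J).indicator g w‖ₑ ^ 2 = (τ '' J).indicator (fun w => ‖g w‖ₑ ^ 2) w :=
    fun w => by by_cases hw : w ∈ τ '' J <;> simp [hw]
  simp_rw [h2]
  rw [lintegral_indicator himg, lintegral_image_eq_lintegral_abs_deriv_mul hJ hder hinj]
  refine setLIntegral_congr_fun hJ fun r hr => ?_
  have h3 : 0 < |τ' r| := abs_pos.2 (hne r hr)
  have h4 : ‖h r‖ₑ = ENNReal.ofReal |τ' r| * ‖g (τ r)‖ₑ := by
    rw [← hgr r hr, enorm_smul, Real.enorm_eq_ofReal (abs_nonneg _)]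
  have h5 : ENNReal.ofReal |τ' r| ≠ 0 := by simpa using hne r hr
  rw [h4, ENNReal.eq_div_iff h5 ENNReal.ofReal_ne_top]
  ring

/-- `(c, (p, q)) ↦ (c + p, c + q, c - p - q)`. -/
def barycentricEquiv : (ℝ × ℝ × ℝ) ≃ₗ[ℝ] (ℝ × ℝ × ℝ) where
  toFun z := (z.1 + z.2.1, z.1 + z.2.2, z.1 - z.2.1 - z.2.2)
  invFun w := ((w.1 + w.2.1 + w.2.2) / 3, w.1 - (w.1 + w.2.1 + w.2.2) / 3,
    w.2.1 - (w.1 + w.2.1 + w.2.2) / 3)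
  map_add' z w := by ext <;> (simp; ring)
  map_smul' s z := by ext <;> (simp; try ring)
  left_inv z := by ext <;> (simp; try ring)
  right_inv w := by ext <;> (simp; try ring)

/-- Polar coordinates around the diagonal of `ℝ³`: `(α, c, r) ↦ (c + r e₁, c + r e₂, c + r e₃)` with
`e = (cos α, sin α, -cos α - sin α)`. -/
def diagPolar (z : ℝ × ℝ × ℝ) : ℝ × ℝ × ℝ :=
  (z.2.1 + z.2.2 * Real.cos z.1, z.2.1 + z.2.2 * Real.sin z.1,
    z.2.1 - z.2.2 * Real.cos z.1 - z.2.2 * Real.sin z.1)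

/-- The parameter measure for `diagPolar`. -/
def diagPolarMeasure : Measure (ℝ × ℝ × ℝ) :=
  (volume.restrict (Set.Ioo (-Real.pi) Real.pi)).prod
    ((volume : Measure ℝ).prod (volume.restrict (Set.Ioi 0)))

theorem continuous_diagPolar : Continuous diagPolar := by
  unfold diagPolar; fun_prop

/-- Only the finiteness and positivity of the Jacobian constant matter for the estimate, so the
determinant is not evaluated. -/
theorem lintegral_barycentricEquiv : ∃ κ : ℝ≥0∞, κ ≠ 0 ∧ κ ≠ ⊤ ∧ ∀ f : ℝ × ℝ × ℝ → ℝ≥0∞,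
    Measurable f → ∫⁻ w, f w = κ * ∫⁻ z, f (barycentricEquiv z) := by
  have hdet : LinearMap.det (barycentricEquiv : (ℝ × ℝ × ℝ) →ₗ[ℝ] (ℝ × ℝ × ℝ)) ≠ 0 :=
    (LinearEquiv.isUnit_det' barycentricEquiv).ne_zero
  have : (volume : Measure (ℝ × ℝ)).IsAddHaarMeasure :=
    Measure.prod.instIsAddHaarMeasure (volume : Measure ℝ) (volume : Measure ℝ)
  have : (volume : Measure (ℝ × ℝ × ℝ)).IsAddHaarMeasure :=
    Measure.prod.instIsAddHaarMeasure (volume : Measure ℝ) (volume : Measure (ℝ × ℝ))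
  have hmap := Measure.map_linearMap_addHaar_eq_smul_addHaar
    (volume : Measure (ℝ × ℝ × ℝ)) hdet
  set d := ENNReal.ofReal |(LinearMap.det
    (barycentricEquiv : (ℝ × ℝ × ℝ) →ₗ[ℝ] (ℝ × ℝ × ℝ)))⁻¹| with hd
  have hd0 : d ≠ 0 := by
    rw [hd, Ne, ENNReal.ofReal_eq_zero, not_le]
    exact abs_pos.2 (inv_ne_zero hdet)
  have hdt : d ≠ ⊤ := ENNReal.ofReal_ne_top
  refine ⟨d⁻¹, ENNReal.inv_ne_zero.2 hdt, ENNReal.inv_ne_top.2 hd0, fun f hf => ?_⟩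
  have hc : Measurable (barycentricEquiv : (ℝ × ℝ × ℝ) →ₗ[ℝ] (ℝ × ℝ × ℝ)) :=
    (LinearMap.continuous_of_finiteDimensional _).measurable
  have := lintegral_map (μ := (volume : Measure (ℝ × ℝ × ℝ))) hf hc
  rw [hmap, lintegral_smul_measure, smul_eq_mul] at this
  simp only [LinearEquiv.coe_coe] at this
  rw [← this, ← mul_assoc, ENNReal.inv_mul_cancel hd0 hdt, one_mul]

theorem lintegral_diagPolar : ∃ κ : ℝ≥0∞, κ ≠ 0 ∧ κ ≠ ⊤ ∧ ∀ f : ℝ × ℝ × ℝ → ℝ≥0∞,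
    Measurable f →
      ∫⁻ w, f w = κ * ∫⁻ z, ENNReal.ofReal z.2.2 * f (diagPolar z) ∂diagPolarMeasure := by
  obtain ⟨κ, h0, ht, hκ⟩ := lintegral_barycentricEquiv
  refine ⟨κ, h0, ht, fun f hf => ?_⟩
  rw [hκ f hf]
  congr 1
  have hE : Measurable fun z => f (barycentricEquiv z) := by
    refine hf.comp ?_
    have : Continuous fun z : ℝ × ℝ × ℝ => barycentricEquiv z := by
      change Continuous fun z : ℝ × ℝ × ℝ => (z.1 + z.2.1, z.1 + z.2.2, z.1 - z.2.1 - z.2.2)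
      fun_prop
    exact this.measurable
  have hm : Measurable fun z : ℝ × ℝ × ℝ => ENNReal.ofReal z.2.2 * f (diagPolar z) :=
    (by fun_prop : Measurable fun z : ℝ × ℝ × ℝ => ENNReal.ofReal z.2.2).mul
      (hf.comp continuous_diagPolar.measurable)
  rw [diagPolarMeasure, lintegral_prod _ hm.aemeasurable]
  have e1 : ∀ α : ℝ, ∫⁻ y, ENNReal.ofReal y.2 * f (diagPolar (α, y))
        ∂((volume : Measure ℝ).prod (volume.restrict (Set.Ioi 0)))
      = ∫⁻ c, ∫⁻ r in Set.Ioi 0, ENNReal.ofReal r * f (diagPolar (α, c, r)) := fun α => by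
    exact lintegral_prod _ (hm.comp (measurable_prodMk_left (x := α))).aemeasurable
  simp_rw [e1]
  -- The angle is brought outermost, because the estimate freezes `α` and works in `(c, r)`.
  rw [lintegral_lintegral_swap]
  swap
  · refine Measurable.aemeasurable ?_
    refine Measurable.lintegral_prod_right'
      (f := fun q : (ℝ × ℝ) × ℝ => ENNReal.ofReal q.2 * f (diagPolar (q.1.1, q.1.2, q.2))) ?_
    exact hm.comp (by fun_prop : Measurable fun q : (ℝ × ℝ) × ℝ => (q.1.1, q.1.2, q.2))
  rw [Measure.volume_eq_prod ℝ (ℝ × ℝ), lintegral_prod _ hE.aemeasurable]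
  refine lintegral_congr fun c => ?_
  rw [← lintegral_comp_polarCoord_symm (fun y => f (barycentricEquiv (c, y)))]
  have e2 : (volume : Measure (ℝ × ℝ)).restrict polarCoord.target
      = (volume.restrict (Set.Ioi 0)).prod (volume.restrict (Set.Ioo (-Real.pi) Real.pi)) := by
    rw [Measure.prod_restrict]; rfl
  rw [e2, lintegral_prod_symm]
  · rfl
  · refine Measurable.aemeasurable ?_
    exact hm.comp (by fun_prop : Measurable fun q : ℝ × ℝ => (q.2, c, q.1))

theorem exists_diagPolar_change_of_variables : ∃ κ : ℝ≥0∞, κ ≠ 0 ∧ κ ≠ ⊤ ∧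
    (∀ f : ℝ × ℝ × ℝ → ℝ≥0∞, Measurable f →
      ∫⁻ w, f w = κ * ∫⁻ z, ENNReal.ofReal z.2.2 * f (diagPolar z) ∂diagPolarMeasure) ∧
    (∀ f : ℝ × ℝ × ℝ → ℂ, Measurable f → Integrable f →
      Integrable (fun z => (ENNReal.ofReal z.2.2).toReal • f (diagPolar z)) diagPolarMeasure ∧
      ∫ w, f w = κ.toReal •
        ∫ z, (ENNReal.ofReal z.2.2).toReal • f (diagPolar z) ∂diagPolarMeasure) := by
  obtain ⟨κ, h0, ht, hκ⟩ := lintegral_diagPolar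
  refine ⟨κ, h0, ht, hκ, fun f hf hfi => ?_⟩
  have hw : Measurable fun z : ℝ × ℝ × ℝ => ENNReal.ofReal z.2.2 := by fun_prop
  have hwt : ∀ᵐ z ∂diagPolarMeasure, ENNReal.ofReal z.2.2 < ⊤ :=
    Eventually.of_forall fun z => ENNReal.ofReal_lt_top
  have hdm := continuous_diagPolar.measurable
  -- Tested on indicators, the identity for nonnegative functions becomes an identity of measures,
  -- which then transfers integrability and Bochner integrals.
  have hvol : (volume : Measure (ℝ × ℝ × ℝ)) =
      κ • Measure.map diagPolar (diagPolarMeasure.withDensity fun z => ENNReal.ofReal z.2.2) := by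
    ext s hs
    have h1 := hκ (s.indicator 1) (measurable_one.indicator hs)
    rw [lintegral_indicator_one hs] at h1
    rw [h1, Measure.smul_apply, Measure.map_apply hdm hs, withDensity_apply _ (hdm hs),
      ← lintegral_indicator (hdm hs), smul_eq_mul]
    congr 2
    ext z
    by_cases hz : diagPolar z ∈ s <;> simp [Set.indicator, hz]
  constructor
  · rw [hvol, integrable_smul_measure h0 ht,
      integrable_map_measure hf.aestronglyMeasurable hdm.aemeasurable,
      integrable_withDensity_iff_integrable_smul' hw hwt] at hfi
    exact hfi
  · rw [hvol, integral_smul_measure, integral_map hdm.aemeasurable hf.aestronglyMeasurable,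
      integral_withDensity_eq_integral_toReal_smul hw hwt]

/-- `∑ φ(ξᵢ)` in the coordinates `diagPolar`. -/
def phaseSum (φ : ℝ → ℝ) (z : ℝ × ℝ × ℝ) : ℝ :=
  φ (diagPolar z).1 + φ (diagPolar z).2.1 + φ (diagPolar z).2.2

/-- The radial derivative of `phaseSum`. -/
def phaseSumDeriv (φ' : ℝ → ℝ) (z : ℝ × ℝ × ℝ) : ℝ :=
  Real.cos z.1 * φ' (diagPolar z).1 + Real.sin z.1 * φ' (diagPolar z).2.1
    - (Real.cos z.1 + Real.sin z.1) * φ' (diagPolar z).2.2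

/-- The product of the values of `F` at the three points given by `diagPolar`. -/
def tripleProd {R : Type*} [Mul R] (F : ℝ → R) (z : ℝ × ℝ × ℝ) : R :=
  F (diagPolar z).1 * F (diagPolar z).2.1 * F (diagPolar z).2.2

/-- The three points given by `diagPolar` lie in `S`. -/
def TripleMem (S : Set ℝ) (z : ℝ × ℝ × ℝ) : Prop :=
  (diagPolar z).1 ∈ S ∧ (diagPolar z).2.1 ∈ S ∧ (diagPolar z).2.2 ∈ S

theorem measurable_tripleProd {F : ℝ → ℂ} (hF : Measurable F) : Measurable (tripleProd F) := by
  have := continuous_diagPolar.measurable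
  exact ((hF.comp this.fst).mul (hF.comp this.snd.fst)).mul (hF.comp this.snd.snd)

theorem measurable_phaseSum {φ : ℝ → ℝ} (hφ : Measurable φ) : Measurable (phaseSum φ) := by
  have := continuous_diagPolar.measurable
  exact ((hφ.comp this.fst).add (hφ.comp this.snd.fst)).add (hφ.comp this.snd.snd)

theorem hasDerivAt_phaseSum {φ φ' : ℝ → ℝ} (hφ : ∀ ξ, HasDerivAt φ (φ' ξ) ξ) (α c r : ℝ) :
    HasDerivAt (fun r => phaseSum φ (α, c, r)) (phaseSumDeriv φ' (α, c, r)) r := by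
  have h1 : HasDerivAt (fun r => c + r * Real.cos α) (Real.cos α) r := by
    simpa using ((hasDerivAt_id r).mul_const (Real.cos α)).const_add c
  have h2 : HasDerivAt (fun r => c + r * Real.sin α) (Real.sin α) r := by
    simpa using ((hasDerivAt_id r).mul_const (Real.sin α)).const_add c
  have h3 : HasDerivAt (fun r => c - r * Real.cos α - r * Real.sin α)
      (-Real.cos α - Real.sin α) r := by
    refine HasDerivAt.congr_deriv ((((hasDerivAt_id r).mul_const (Real.cos α)).const_sub c).sub
      ((hasDerivAt_id r).mul_const (Real.sin α))) ?_
    simp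
  have := (((hφ _).comp r h1).add ((hφ _).comp r h2)).add ((hφ _).comp r h3)
  refine this.congr_deriv ?_
  simp only [phaseSumDeriv, diagPolar]
  ring

/-- The three points are affine in `r`. Convexity of the admissible radii is what lets the sign of
the derivative give injectivity of the radial phase. -/
theorem convex_tripleMem {S : Set ℝ} (hS : Convex ℝ S) (α c : ℝ) :
    Convex ℝ {r : ℝ | 0 < r ∧ TripleMem S (α, c, r)} := by
  rintro r ⟨hr, h1, h2, h3⟩ r' ⟨hr', h1', h2', h3'⟩ s s' hs hs' hss
  refine ⟨(convex_Ioi (0 : ℝ)) hr hr' hs hs' hss, ?_, ?_, ?_⟩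
  · convert hS h1 h1' hs hs' hss using 1
    simp only [diagPolar, smul_eq_mul]
    linear_combination -c * hss
  · convert hS h2 h2' hs hs' hss using 1
    simp only [diagPolar, smul_eq_mul]
    linear_combination -c * hss
  · convert hS h3 h3' hs hs' hss using 1
    simp only [diagPolar, smul_eq_mul]
    linear_combination -c * hss

/-- The curvature condition on the weight `m` and the phase `φ` over `S` behind the `L⁶`
extension estimate. -/
def CurvatureBound (m φ' : ℝ → ℝ) (S : Set ℝ) (δ σ : ℝ) : Prop :=
  ∀ α c r : ℝ, 0 < r → TripleMem S (α, c, r) →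
    0 < σ * phaseSumDeriv φ' (α, c, r) ∧
      δ * r * tripleProd m (α, c, r) ^ 2 ≤ σ * phaseSumDeriv φ' (α, c, r)

/-- Plancherel in time with `phaseSum` as the frequency variable. The integrand carries `r` from the
polar Jacobian, so its square over the derivative is at most `r² ∏m² |∏F|² / (δ r ∏m²)`: the weights
cancel and exactly one factor `r`, again the Jacobian, survives. -/
theorem lintegral_radial_le {m φ φ' : ℝ → ℝ} {S : Set ℝ} (hS : Convex ℝ S)
    (hSm : MeasurableSet S) (hφ : ∀ ξ, HasDerivAt φ (φ' ξ) ξ) {δ σ : ℝ} (hδ : 0 < δ)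
    (hσ : |σ| = 1) (hD : CurvatureBound m φ' S δ σ) {F : ℝ → ℂ} (hFS : ∀ ξ ∉ S, F ξ = 0)
    (α c : ℝ)
    (hintg : IntegrableOn (fun r => (ENNReal.ofReal r).toReal •
      tripleProd (fun ξ => (m ξ : ℂ) * F ξ) (α, c, r)) (Set.Ioi 0)) :
    ∫⁻ t : ℝ, ‖∫ r in Set.Ioi 0, ((ENNReal.ofReal r).toReal •
        tripleProd (fun ξ => (m ξ : ℂ) * F ξ) (α, c, r)) *
        Complex.exp (Complex.I * ((t * phaseSum φ (α, c, r) : ℝ) : ℂ))‖ₑ ^ 2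
      ≤ ENNReal.ofReal (2 * Real.pi) * (ENNReal.ofReal δ⁻¹ *
        ∫⁻ r in Set.Ioi 0, ENNReal.ofReal r * ‖tripleProd F (α, c, r)‖ₑ ^ 2) := by
  set J : Set ℝ := {r : ℝ | 0 < r ∧ TripleMem S (α, c, r)} with hJ
  have hJS : J ⊆ Set.Ioi 0 := fun r hr => hr.1
  have hdm := continuous_diagPolar.measurable.comp
    (by fun_prop : Measurable fun r : ℝ => (α, c, r))
  have hJm : MeasurableSet J :=
    measurableSet_Ioi.inter ((hdm.fst hSm).inter ((hdm.snd.fst hSm).inter (hdm.snd.snd hSm)))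
  have hJc : Convex ℝ J := convex_tripleMem hS α c
  have hder := fun r => hasDerivAt_phaseSum hφ α c r
  have hσ0 : σ ≠ 0 := fun h => by simp [h] at hσ
  have hne : ∀ r ∈ J, phaseSumDeriv φ' (α, c, r) ≠ 0 := fun r hr h => by
    have := (hD α c r hr.1 hr.2).1
    simp [h] at this
  have hinj : Set.InjOn (fun r => phaseSum φ (α, c, r)) J := by
    have hmono : StrictMonoOn (fun r => σ * phaseSum φ (α, c, r)) J := by
      refine strictMonoOn_of_deriv_pos hJc
        (fun r _ => ((hder r).const_mul σ).continuousAt.continuousWithinAt) fun r hr => ?_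
      have hr' := interior_subset hr
      rw [((hder r).const_mul σ).deriv]
      exact (hD α c r hr'.1 hr'.2).1
    intro r hr r' hr' h
    exact hmono.injOn hr hr' (by simpa using Or.inl h)
  have hzero : ∀ r ∈ Set.Ioi (0 : ℝ) \ J, tripleProd (fun ξ => (m ξ : ℂ) * F ξ) (α, c, r) = 0 := by
    rintro r ⟨hr, hrJ⟩
    have : ¬ TripleMem S (α, c, r) := fun h => hrJ ⟨hr, h⟩
    simp only [TripleMem, not_and_or] at this
    simp only [tripleProd]
    rcases this with h | h | h <;> simp [hFS _ h]
  have hset : ∀ t : ℝ, ∫ r in Set.Ioi 0, ((ENNReal.ofReal r).toReal •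
        tripleProd (fun ξ => (m ξ : ℂ) * F ξ) (α, c, r)) *
        Complex.exp (Complex.I * ((t * phaseSum φ (α, c, r) : ℝ) : ℂ))
      = ∫ r in J, ((ENNReal.ofReal r).toReal •
        tripleProd (fun ξ => (m ξ : ℂ) * F ξ) (α, c, r)) *
        Complex.exp (Complex.I * ((t * phaseSum φ (α, c, r) : ℝ) : ℂ)) := fun t =>
    setIntegral_eq_of_subset_of_forall_sdiff_eq_zero measurableSet_Ioi hJS fun r hr => by
      simp [hzero r hr]
  simp_rw [hset]
  refine (lintegral_enorm_sq_phase_le hJm (fun r _ => hder r) hinj hne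
    (hintg.mono_set hJS)).trans ?_
  gcongr
  rw [← lintegral_const_mul' _ _ ENNReal.ofReal_ne_top]
  refine (setLIntegral_mono' hJm fun r hr => ?_).trans (lintegral_mono_set hJS)
  obtain ⟨hpos, hle⟩ := hD α c r hr.1 hr.2
  have habs : σ * phaseSumDeriv φ' (α, c, r) ≤ |phaseSumDeriv φ' (α, c, r)| := by
    calc _ ≤ |σ * phaseSumDeriv φ' (α, c, r)| := le_abs_self _
      _ = _ := by rw [abs_mul, hσ, one_mul]
  have hprod : tripleProd (fun ξ => (m ξ : ℂ) * F ξ) (α, c, r)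
      = (tripleProd m (α, c, r) : ℝ) * tripleProd F (α, c, r) := by
    simp only [tripleProd]; push_cast; ring
  have hr0 : 0 < r := hr.1
  rw [ENNReal.toReal_ofReal hr0.le, hprod]
  have hDpos : 0 < |phaseSumDeriv φ' (α, c, r)| := abs_pos.2 (hne r hr)
  rw [← ofReal_norm, ← ofReal_norm, ← ENNReal.ofReal_pow (norm_nonneg _),
    ← ENNReal.ofReal_pow (norm_nonneg _), ← ENNReal.ofReal_div_of_pos hDpos,
    ← ENNReal.ofReal_mul hr0.le, ← ENNReal.ofReal_mul (by positivity)]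
  refine ENNReal.ofReal_le_ofReal ?_
  rw [norm_smul, norm_mul, Complex.norm_real, Real.norm_eq_abs, Real.norm_eq_abs,
    div_le_iff₀ hDpos]
  have h1 := hle.trans habs
  rw [mul_pow, mul_pow, sq_abs, sq_abs]
  set T := ‖tripleProd F (α, c, r)‖
  calc r ^ 2 * (tripleProd m (α, c, r) ^ 2 * T ^ 2)
      = δ⁻¹ * (r * T ^ 2) * (δ * r * tripleProd m (α, c, r) ^ 2) := by
        field_simp
    _ ≤ _ := by gcongr

theorem sq_lintegral_le {α : Type*} [MeasurableSpace α] {μ : Measure α} {f : α → ℝ≥0∞}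
    (hf : AEMeasurable f μ) : (∫⁻ x, f x ∂μ) ^ 2 ≤ μ Set.univ * ∫⁻ x, f x ^ 2 ∂μ := by
  have h := ENNReal.lintegral_mul_le_Lp_mul_Lq μ (p := 2) (q := 2)
    (Real.HolderConjugate.two_two) hf (aemeasurable_const (b := (1 : ℝ≥0∞)))
  simp only [Pi.mul_apply, mul_one, ENNReal.one_rpow, lintegral_const, one_mul] at h
  calc (∫⁻ x, f x ∂μ) ^ 2
      ≤ ((∫⁻ x, f x ^ (2 : ℝ) ∂μ) ^ (1 / 2 : ℝ) * μ Set.univ ^ (1 / 2 : ℝ)) ^ 2 := by gcongr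
    _ = μ Set.univ * ∫⁻ x, f x ^ 2 ∂μ := by
      rw [mul_pow, ← ENNReal.rpow_natCast, ← ENNReal.rpow_natCast, ← ENNReal.rpow_mul,
        ← ENNReal.rpow_mul]
      norm_num
      rw [mul_comm]

theorem oscIntegral_pow_three (φ : ℝ → ℝ) (a : ℝ → ℂ) (p : ℝ × ℝ) :
    oscIntegral φ a p ^ 3 = ∫ w : ℝ × ℝ × ℝ, a w.1 * a w.2.1 * a w.2.2 *
      Complex.exp (Complex.I * ((p.2 * (w.1 + w.2.1 + w.2.2) +
        p.1 * (φ w.1 + φ w.2.1 + φ w.2.2) : ℝ) : ℂ)) := by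
  set e : ℝ → ℂ := fun ξ => a ξ * Complex.exp (Complex.I * ((p.2 * ξ + p.1 * φ ξ : ℝ) : ℂ))
  have h : ∀ w : ℝ × ℝ × ℝ, a w.1 * a w.2.1 * a w.2.2 *
      Complex.exp (Complex.I * ((p.2 * (w.1 + w.2.1 + w.2.2) +
        p.1 * (φ w.1 + φ w.2.1 + φ w.2.2) : ℝ) : ℂ)) = e w.1 * (e w.2.1 * e w.2.2) := fun w => by
    have : Complex.exp (Complex.I * ((p.2 * (w.1 + w.2.1 + w.2.2) +
        p.1 * (φ w.1 + φ w.2.1 + φ w.2.2) : ℝ) : ℂ))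
        = Complex.exp (Complex.I * ((p.2 * w.1 + p.1 * φ w.1 : ℝ) : ℂ)) *
          Complex.exp (Complex.I * ((p.2 * w.2.1 + p.1 * φ w.2.1 : ℝ) : ℂ)) *
          Complex.exp (Complex.I * ((p.2 * w.2.2 + p.1 * φ w.2.2 : ℝ) : ℂ)) := by
      rw [← Complex.exp_add, ← Complex.exp_add]
      congr 1
      push_cast
      ring
    rw [this]
    simp only [e]
    ring
  simp_rw [h]
  rw [Measure.volume_eq_prod, integral_prod_mul e (fun y : ℝ × ℝ => e y.1 * e y.2),
    Measure.volume_eq_prod, integral_prod_mul e e]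
  change (∫ ξ, e ξ) ^ 3 = _
  ring

/-- The radial part of the cube of an oscillatory integral. -/
def radialPart (φ : ℝ → ℝ) (a : ℝ → ℂ) (q : ℝ × ℝ × ℝ) : ℂ :=
  ∫ r in Set.Ioi 0, ((ENNReal.ofReal r).toReal • tripleProd a (q.1, q.2.1, r)) *
    Complex.exp (Complex.I * ((q.2.2 * phaseSum φ (q.1, q.2.1, r) : ℝ) : ℂ))

theorem stronglyMeasurable_radialPart {φ : ℝ → ℝ} (hφ : Measurable φ) {a : ℝ → ℂ}
    (ha : Measurable a) : StronglyMeasurable (radialPart φ a) := by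
  refine StronglyMeasurable.integral_prod_right'
    (f := fun q : (ℝ × ℝ × ℝ) × ℝ => ((ENNReal.ofReal q.2).toReal •
      tripleProd a (q.1.1, q.1.2.1, q.2)) *
      Complex.exp (Complex.I * ((q.1.2.2 * phaseSum φ (q.1.1, q.1.2.1, q.2) : ℝ) : ℂ))) ?_
  have h1 : Measurable fun q : (ℝ × ℝ × ℝ) × ℝ => (q.1.1, q.1.2.1, q.2) := by fun_prop
  have h2 := (measurable_tripleProd ha).comp h1
  have h3 := (measurable_phaseSum hφ).comp h1
  have h4 : Measurable fun q : (ℝ × ℝ × ℝ) × ℝ => (ENNReal.ofReal q.2).toReal := by fun_prop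
  have h5 : Measurable fun q : (ℝ × ℝ × ℝ) × ℝ =>
      Complex.exp (Complex.I * ((q.1.2.2 * phaseSum φ (q.1.1, q.1.2.1, q.2) : ℝ) : ℂ)) := by
    have : Measurable fun q : (ℝ × ℝ × ℝ) × ℝ => q.1.2.2 * phaseSum φ (q.1.1, q.1.2.1, q.2) :=
      (by fun_prop : Measurable fun q : (ℝ × ℝ × ℝ) × ℝ => q.1.2.2).mul h3
    fun_prop
  exact ((h4.smul h2).mul h5).stronglyMeasurable

/-- The part of the cube of an oscillatory integral with a given angle. -/
def angularPart (φ : ℝ → ℝ) (a : ℝ → ℂ) (q : ℝ × ℝ × ℝ) : ℂ :=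
  ∫ c, radialPart φ a (q.1, c, q.2.1) * Complex.exp (Complex.I * ((3 * q.2.2 * c : ℝ) : ℂ))

theorem stronglyMeasurable_angularPart {φ : ℝ → ℝ} (hφ : Measurable φ) {a : ℝ → ℂ}
    (ha : Measurable a) : StronglyMeasurable (angularPart φ a) := by
  refine StronglyMeasurable.integral_prod_right'
    (f := fun q : (ℝ × ℝ × ℝ) × ℝ => radialPart φ a (q.1.1, q.2, q.1.2.1) *
      Complex.exp (Complex.I * ((3 * q.1.2.2 * q.2 : ℝ) : ℂ))) ?_
  have h1 : Measurable fun q : (ℝ × ℝ × ℝ) × ℝ => (q.1.1, q.2, q.1.2.1) := by fun_prop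
  refine ((stronglyMeasurable_radialPart hφ ha).comp_measurable h1).mul ?_
  exact Measurable.stronglyMeasurable (by fun_prop)

theorem integrable_triple {a : ℝ → ℂ} (hai : Integrable a) :
    Integrable fun w : ℝ × ℝ × ℝ => a w.1 * a w.2.1 * a w.2.2 := by
  have := hai.mul_prod (hai.mul_prod hai)
  simpa only [mul_assoc] using! this

theorem sum_diagPolar (z : ℝ × ℝ × ℝ) :
    (diagPolar z).1 + (diagPolar z).2.1 + (diagPolar z).2.2 = 3 * z.2.1 := by
  simp only [diagPolar]; ring

/-- The extension estimate for an amplitude supported where the phase is curved. -/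
theorem lintegral_oscIntegral_pow_six_le {m φ φ' : ℝ → ℝ} {S : Set ℝ} (hS : Convex ℝ S)
    (hSm : MeasurableSet S) (hm : Measurable m) (hφ : ∀ ξ, HasDerivAt φ (φ' ξ) ξ) {δ σ : ℝ}
    (hδ : 0 < δ) (hσ : |σ| = 1) (hD : CurvatureBound m φ' S δ σ) :
    ∃ C : ℝ≥0∞, C ≠ ⊤ ∧ ∀ F : ℝ → ℂ, Measurable F → (∀ ξ ∉ S, F ξ = 0) →
      Integrable (fun ξ => (m ξ : ℂ) * F ξ) →
      ∫⁻ p, ‖oscIntegral φ (fun ξ => (m ξ : ℂ) * F ξ) p‖ₑ ^ 6 ≤ C * (∫⁻ ξ, ‖F ξ‖ₑ ^ 2) ^ 3 := by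
  obtain ⟨κ, hκ0, hκt, hκl, hκi⟩ := exists_diagPolar_change_of_variables
  set ν : Measure ℝ := volume.restrict (Set.Ioo (-Real.pi) Real.pi) with hν
  have hνt : ν Set.univ ≠ ⊤ := by simp [hν]
  have hφm : Measurable φ :=
    (continuous_iff_continuousAt.2 fun ξ => (hφ ξ).continuousAt).measurable
  set P := ENNReal.ofReal (2 * Real.pi) with hP
  set M := ENNReal.ofReal |(3 : ℝ)⁻¹|
  refine ⟨κ ^ 2 * (ν Set.univ * (M * (P * (P * (ENNReal.ofReal δ⁻¹ * κ⁻¹))))), ?_,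
    fun F hF hFS hai => ?_⟩
  · have : κ⁻¹ ≠ ⊤ := ENNReal.inv_ne_top.2 hκ0
    have hPt : P ≠ ⊤ := ENNReal.ofReal_ne_top
    have hMt : M ≠ ⊤ := ENNReal.ofReal_ne_top
    have hδt : ENNReal.ofReal δ⁻¹ ≠ ⊤ := ENNReal.ofReal_ne_top
    exact ENNReal.mul_ne_top (ENNReal.pow_ne_top hκt) (ENNReal.mul_ne_top hνt
      (ENNReal.mul_ne_top hMt (ENNReal.mul_ne_top hPt (ENNReal.mul_ne_top hPt
        (ENNReal.mul_ne_top hδt this)))))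
  set a : ℝ → ℂ := fun ξ => (m ξ : ℂ) * F ξ with ha
  have ham : Measurable a := (Complex.measurable_ofReal.comp hm).mul hF
  have hrad := stronglyMeasurable_radialPart hφm ham
  have hang := stronglyMeasurable_angularPart hφm ham
  have htm : Measurable fun w : ℝ × ℝ × ℝ => a w.1 * a w.2.1 * a w.2.2 := by fun_prop
  have htrip : Integrable (fun z => (ENNReal.ofReal z.2.2).toReal • tripleProd a z)
      diagPolarMeasure := (hκi _ htm (integrable_triple hai)).1
  have hsec : ∀ᵐ α ∂ν, Integrable (fun y : ℝ × ℝ => (ENNReal.ofReal y.2).toReal •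
      tripleProd a (α, y)) ((volume : Measure ℝ).prod (volume.restrict (Set.Ioi 0))) :=
    htrip.prod_right_ae
  -- the cube as an integral over the angle
  have hcube : ∀ p : ℝ × ℝ, oscIntegral φ a p ^ 3 = κ.toReal • ∫ α, angularPart φ a (α, p) ∂ν := by
    intro p
    have hθ : Measurable fun w : ℝ × ℝ × ℝ => p.2 * (w.1 + w.2.1 + w.2.2) +
        p.1 * (φ w.1 + φ w.2.1 + φ w.2.2) := by fun_prop
    obtain ⟨h1, h2⟩ := hκi (fun w => a w.1 * a w.2.1 * a w.2.2 *
      Complex.exp (Complex.I * ((p.2 * (w.1 + w.2.1 + w.2.2) +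
        p.1 * (φ w.1 + φ w.2.1 + φ w.2.2) : ℝ) : ℂ))) (by fun_prop)
      ((integrable_triple hai).mul_exp_I hθ)
    rw [oscIntegral_pow_three, h2]
    congr 1
    rw [diagPolarMeasure, integral_prod _ h1]
    refine integral_congr_ae ?_
    filter_upwards [h1.prod_right_ae] with α hα
    rw [integral_prod _ hα]
    refine integral_congr_ae (Eventually.of_forall fun c => ?_)
    simp only [radialPart]
    rw [← integral_mul_const]
    refine integral_congr_ae (Eventually.of_forall fun r => ?_)
    simp only
    rw [sum_diagPolar]
    have : Complex.exp (Complex.I * ((p.2 * (3 * c) + p.1 * (φ (diagPolar (α, c, r)).1 +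
        φ (diagPolar (α, c, r)).2.1 + φ (diagPolar (α, c, r)).2.2) : ℝ) : ℂ))
        = Complex.exp (Complex.I * ((p.1 * phaseSum φ (α, c, r) : ℝ) : ℂ)) *
          Complex.exp (Complex.I * ((3 * p.2 * c : ℝ) : ℂ)) := by
      rw [← Complex.exp_add]
      congr 1
      simp only [phaseSum]
      push_cast
      ring
    rw [this, tripleProd, smul_mul_assoc, smul_mul_assoc]
    congr 1
    ring
  -- Cauchy–Schwarz in the angle costs only the finite length of its range.
  have hpt : ∀ p : ℝ × ℝ, ‖oscIntegral φ a p‖ₑ ^ 6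
      ≤ κ ^ 2 * (ν Set.univ * ∫⁻ α, ‖angularPart φ a (α, p)‖ₑ ^ 2 ∂ν) := fun p => by
    have hm1 : AEMeasurable (fun α => ‖angularPart φ a (α, p)‖ₑ) ν :=
      (hang.comp_measurable (by fun_prop : Measurable fun α : ℝ => (α, p))).measurable.enorm.aemeasurable
    calc ‖oscIntegral φ a p‖ₑ ^ 6 = ‖oscIntegral φ a p ^ 3‖ₑ ^ 2 := by
          rw [enorm_pow, ← pow_mul]
      _ = (κ * ‖∫ α, angularPart φ a (α, p) ∂ν‖ₑ) ^ 2 := by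
          rw [hcube, enorm_smul, Real.enorm_eq_ofReal ENNReal.toReal_nonneg,
            ENNReal.ofReal_toReal hκt]
      _ ≤ (κ * ∫⁻ α, ‖angularPart φ a (α, p)‖ₑ ∂ν) ^ 2 := by
          gcongr
          exact enorm_integral_le_lintegral_enorm _
      _ ≤ _ := by
          rw [mul_pow]
          gcongr
          exact sq_lintegral_le hm1
  calc ∫⁻ p, ‖oscIntegral φ a p‖ₑ ^ 6
      ≤ ∫⁻ p, κ ^ 2 * (ν Set.univ * ∫⁻ α, ‖angularPart φ a (α, p)‖ₑ ^ 2 ∂ν) :=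
        lintegral_mono hpt
    _ = κ ^ 2 * (ν Set.univ * ∫⁻ p, ∫⁻ α, ‖angularPart φ a (α, p)‖ₑ ^ 2 ∂ν) := by
        rw [lintegral_const_mul' _ _ (ENNReal.pow_ne_top hκt), lintegral_const_mul' _ _ hνt]
    _ = κ ^ 2 * (ν Set.univ * ∫⁻ α, (∫⁻ t, ∫⁻ x, ‖angularPart φ a (α, t, x)‖ₑ ^ 2) ∂ν) := by
        rw [lintegral_lintegral_swap]
        · congr 2
          refine lintegral_congr fun α => ?_
          exact lintegral_prod _ ((hang.comp_measurable
            (by fun_prop : Measurable fun p : ℝ × ℝ => (α, p))).measurable.enorm.pow_const 2).aemeasurable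
        · exact ((hang.comp_measurable
            (by fun_prop : Measurable fun q : (ℝ × ℝ) × ℝ => (q.2, q.1))).measurable.enorm.pow_const
            2).aemeasurable
    -- Plancherel in `x`: the three frequencies sum to `3c`, so the variable dual to `c` is `3x`,
    -- whence the factor `M = 1/3`.
    _ ≤ κ ^ 2 * (ν Set.univ * ∫⁻ α, (∫⁻ t, M * (P * ∫⁻ c, ‖radialPart φ a (α, c, t)‖ₑ ^ 2)) ∂ν) := by
        gcongr κ ^ 2 * (ν Set.univ * ?_)
        refine lintegral_mono_ae ?_
        filter_upwards [hsec] with α hα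
        refine lintegral_mono fun t => ?_
        have hi : Integrable fun c => radialPart φ a (α, c, t) := by
          have h1 : Measurable fun y : ℝ × ℝ => t * phaseSum φ (α, y) :=
            ((measurable_phaseSum hφm).comp measurable_prodMk_left).const_mul t
          exact (hα.mul_exp_I h1).integral_prod_left
        refine le_trans (le_of_eq ?_) (mul_le_mul_right (lintegral_enorm_sq_fourier_le hi) M)
        exact lintegral_comp_mul_left_real (c := 3) (by norm_num) (fun x => ‖∫ c,
          radialPart φ a (α, c, t) * Complex.exp (Complex.I * ((x * c : ℝ) : ℂ))‖ₑ ^ 2)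
    _ = κ ^ 2 * (ν Set.univ * (M * (P *
          ∫⁻ α, (∫⁻ c, ∫⁻ t, ‖radialPart φ a (α, c, t)‖ₑ ^ 2) ∂ν))) := by
        have e : ∀ α, ∫⁻ t, M * (P * ∫⁻ c, ‖radialPart φ a (α, c, t)‖ₑ ^ 2)
            = M * (P * ∫⁻ c, ∫⁻ t, ‖radialPart φ a (α, c, t)‖ₑ ^ 2) := fun α => by
          rw [lintegral_const_mul' _ _ ENNReal.ofReal_ne_top,
            lintegral_const_mul' _ _ ENNReal.ofReal_ne_top, lintegral_lintegral_swap]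
          exact ((hrad.comp_measurable (by fun_prop : Measurable fun q : ℝ × ℝ =>
            (α, q.2, q.1))).measurable.enorm.pow_const 2).aemeasurable
        simp_rw [e]
        rw [lintegral_const_mul' _ _ ENNReal.ofReal_ne_top,
            lintegral_const_mul' _ _ ENNReal.ofReal_ne_top]
    -- Plancherel in `t` for fixed angle and centre.
    _ ≤ κ ^ 2 * (ν Set.univ * (M * (P *
          ∫⁻ α, (∫⁻ c, P * (ENNReal.ofReal δ⁻¹ *
            ∫⁻ r in Set.Ioi 0, ENNReal.ofReal r * ‖tripleProd F (α, c, r)‖ₑ ^ 2)) ∂ν))) := by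
        gcongr κ ^ 2 * (ν Set.univ * (M * (P * ?_)))
        refine lintegral_mono_ae ?_
        filter_upwards [hsec] with α hα
        refine lintegral_mono_ae ?_
        filter_upwards [hα.prod_right_ae] with c hc
        exact lintegral_radial_le hS hSm hφ hδ hσ hD hFS α c hc
    _ = κ ^ 2 * (ν Set.univ * (M * (P * (P * (ENNReal.ofReal δ⁻¹ * κ⁻¹))))) *
          (∫⁻ ξ, ‖F ξ‖ₑ ^ 2) ^ 3 := by
        have hG : Measurable fun w : ℝ × ℝ × ℝ => ‖F w.1 * F w.2.1 * F w.2.2‖ₑ ^ 2 := by fun_prop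
        have h1 := hκl _ hG
        have hz : Measurable fun z : ℝ × ℝ × ℝ => ENNReal.ofReal z.2.2 * ‖tripleProd F z‖ₑ ^ 2 :=
          (by fun_prop : Measurable fun z : ℝ × ℝ × ℝ => ENNReal.ofReal z.2.2).mul
            ((measurable_tripleProd hF).enorm.pow_const 2)
        have h2 : ∫⁻ w : ℝ × ℝ × ℝ, ‖F w.1 * F w.2.1 * F w.2.2‖ₑ ^ 2
            = (∫⁻ ξ, ‖F ξ‖ₑ ^ 2) ^ 3 := by
          have e : ∀ w : ℝ × ℝ × ℝ, ‖F w.1 * F w.2.1 * F w.2.2‖ₑ ^ 2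
              = ‖F w.1‖ₑ ^ 2 * (‖F w.2.1‖ₑ ^ 2 * ‖F w.2.2‖ₑ ^ 2) := fun w => by
            rw [enorm_mul, enorm_mul]; ring
          simp_rw [e]
          have hF2 : AEMeasurable (fun ξ => ‖F ξ‖ₑ ^ 2) volume := (hF.enorm.pow_const 2).aemeasurable
          have hF3 : AEMeasurable (fun y : ℝ × ℝ => ‖F y.1‖ₑ ^ 2 * ‖F y.2‖ₑ ^ 2) volume := by
            exact Measurable.aemeasurable (by fun_prop)
          rw [Measure.volume_eq_prod, lintegral_prod_mul hF2 hF3, Measure.volume_eq_prod,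
            lintegral_prod_mul hF2 hF2]
          ring
        have h3 : ∫⁻ α, (∫⁻ c, ∫⁻ r in Set.Ioi 0,
              ENNReal.ofReal r * ‖tripleProd F (α, c, r)‖ₑ ^ 2) ∂ν
            = ∫⁻ z, ENNReal.ofReal z.2.2 * ‖tripleProd F z‖ₑ ^ 2 ∂diagPolarMeasure := by
          rw [diagPolarMeasure, lintegral_prod _ hz.aemeasurable]
          refine lintegral_congr fun α => ?_
          exact (lintegral_prod _ (hz.comp (measurable_prodMk_left (x := α))).aemeasurable).symm
        have e : ∀ α, ∫⁻ c, P * (ENNReal.ofReal δ⁻¹ *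
              ∫⁻ r in Set.Ioi 0, ENNReal.ofReal r * ‖tripleProd F (α, c, r)‖ₑ ^ 2)
            = P * (ENNReal.ofReal δ⁻¹ * ∫⁻ c,
              ∫⁻ r in Set.Ioi 0, ENNReal.ofReal r * ‖tripleProd F (α, c, r)‖ₑ ^ 2) := fun α => by
          rw [lintegral_const_mul' _ _ ENNReal.ofReal_ne_top,
            lintegral_const_mul' _ _ ENNReal.ofReal_ne_top]
        simp_rw [e]
        rw [lintegral_const_mul' _ _ ENNReal.ofReal_ne_top,
          lintegral_const_mul' _ _ ENNReal.ofReal_ne_top, h3]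
        -- The same change of variables, read backwards, reassembles the product of three `L²`
        -- norms.
        have h4 : ∫⁻ z, ENNReal.ofReal z.2.2 * ‖tripleProd F z‖ₑ ^ 2 ∂diagPolarMeasure
            = κ⁻¹ * (∫⁻ ξ, ‖F ξ‖ₑ ^ 2) ^ 3 := by
          rw [← h2, h1, ← mul_assoc, ENNReal.inv_mul_cancel hκ0 hκt, one_mul]
          rfl
        rw [h4]
        ring

/-! ### Curvature of the Schrödinger phase and of `ξ³ + ξ⁵` on half-lines. -/

theorem curvatureBound_schrodinger :
    CurvatureBound schrodingerWeight (fun ξ => -(2 * ξ)) Set.univ 1 (-1) := by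
  intro α c r hr _
  have h : -1 * phaseSumDeriv (fun ξ => -(2 * ξ)) (α, c, r)
      = 2 * r * (1 + (Real.cos α + Real.sin α) ^ 2) := by
    simp only [phaseSumDeriv, diagPolar]
    linear_combination (2 * r) * (Real.sin_sq_add_cos_sq α)
  rw [h]
  simp only [tripleProd, schrodingerWeight]
  have := mul_nonneg hr.le (sq_nonneg (Real.cos α + Real.sin α))
  constructor <;> nlinarith

theorem hasDerivAt_schrodingerPhase (ξ : ℝ) : HasDerivAt schrodingerPhase (-(2 * ξ)) ξ := by
  have := (hasDerivAt_pow 2 ξ).neg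
  simpa [schrodingerPhase] using! this

theorem hasDerivAt_phase35 (ξ : ℝ) : HasDerivAt phase35 (3 * ξ ^ 2 + 5 * ξ ^ 4) ξ := by
  have := (hasDerivAt_pow 3 ξ).add (hasDerivAt_pow 5 ξ)
  simpa [phase35] using! this

theorem weight35_pow_six (ξ : ℝ) : weight35 ξ ^ 6 = |ξ + ξ ^ 3| := by
  rw [weight35, ← Real.rpow_natCast, ← Real.rpow_mul (abs_nonneg _)]
  norm_num

theorem weight35_nonneg (ξ : ℝ) : 0 ≤ weight35 ξ := by
  unfold weight35; positivity

theorem continuous_weight35 : Continuous weight35 := by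
  unfold weight35
  exact Continuous.rpow_const (by fun_prop) fun _ => Or.inr (by norm_num)

/-- On a half-line the three frequencies have one sign and mean `c`, so with `d = σ c` each `σ ξᵢ`
lies in `(0, 3d]`. The radial derivative is at least `3r(d + d³)`, while the squared product of the
weights is at most `27(d + d³)`; the ratio gives `δ = 1/9`. -/
theorem curvatureBound_weight35 {σ : ℝ} (hσ : σ = 1 ∨ σ = -1) :
    CurvatureBound weight35 (fun ξ => 3 * ξ ^ 2 + 5 * ξ ^ 4) {ξ | 0 < σ * ξ} (1 / 9) σ := by
  rintro α c r hr ⟨h1, h2, h3⟩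
  have hsum := sum_diagPolar (α, c, r)
  set ξ₁ := (diagPolar (α, c, r)).1 with hξ₁
  set ξ₂ := (diagPolar (α, c, r)).2.1 with hξ₂
  set ξ₃ := (diagPolar (α, c, r)).2.2 with hξ₃
  simp only [Set.mem_ofPred_eq] at h1 h2 h3 hsum
  have hσ2 : σ ^ 2 = 1 := by rcases hσ with rfl | rfl <;> norm_num
  have hσa : |σ| = 1 := by rcases hσ with rfl | rfl <;> norm_num
  -- everything is expressed through the positive numbers `σ ξᵢ` and `σ c`
  set d := σ * c with hd
  have hd0 : 0 < d := by
    have : σ * ξ₁ + σ * ξ₂ + σ * ξ₃ = 3 * d := by rw [hd]; linear_combination σ * hsum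
    linarith
  have hsumd : σ * ξ₁ + σ * ξ₂ + σ * ξ₃ = 3 * d := by rw [hd]; linear_combination σ * hsum
  -- The three directions `e` sum to zero, so `φ'(c)` may be subtracted from every `φ'(ξᵢ)`; each
  -- difference has `ξᵢ - c = r e` as a factor.
  have hterm : ∀ e ξ : ℝ, ξ = c + r * e → 0 < σ * ξ →
      3 * r * e ^ 2 * (d + d ^ 3) ≤ σ * (e * ((3 * ξ ^ 2 + 5 * ξ ^ 4) - (3 * c ^ 2 + 5 * c ^ 4))) := by
    intro e ξ hξ hpos
    have hσξ2 : ξ ^ 2 = (σ * ξ) ^ 2 := by rw [mul_pow, hσ2, one_mul]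
    have hσc2 : c ^ 2 = d ^ 2 := by rw [hd, mul_pow, hσ2, one_mul]
    have e1 : σ * (e * ((3 * ξ ^ 2 + 5 * ξ ^ 4) - (3 * c ^ 2 + 5 * c ^ 4)))
        = r * e ^ 2 * ((σ * ξ + d) * (3 + 5 * (ξ ^ 2 + c ^ 2))) := by
      have : ξ - c = r * e := by rw [hξ]; ring
      rw [hd]
      linear_combination σ * e * (ξ + c) * (3 + 5 * (ξ ^ 2 + c ^ 2)) * this
    rw [e1]
    have h4 : 3 * (d + d ^ 3) ≤ (σ * ξ + d) * (3 + 5 * (ξ ^ 2 + c ^ 2)) := by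
      rw [hσξ2, hσc2]
      nlinarith [mul_pos hpos hd0, pow_pos hpos 3, pow_pos hd0 3, mul_pos hpos (pow_pos hd0 2),
        mul_pos hd0 (pow_pos hpos 2)]
    have h5 : 0 ≤ r * e ^ 2 := by positivity
    nlinarith [mul_le_mul_of_nonneg_left h4 h5]
  have t1 := hterm (Real.cos α) ξ₁ (by simp [hξ₁, diagPolar]) h1
  have t2 := hterm (Real.sin α) ξ₂ (by simp [hξ₂, diagPolar]) h2
  have t3 := hterm (-(Real.cos α + Real.sin α)) ξ₃ (by simp only [hξ₃, diagPolar]; ring) h3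
  have hp : 0 < d + d ^ 3 := by positivity
  have hmain : 3 * r * (d + d ^ 3)
      ≤ σ * phaseSumDeriv (fun ξ => 3 * ξ ^ 2 + 5 * ξ ^ 4) (α, c, r) := by
    simp only [phaseSumDeriv, ← hξ₁, ← hξ₂, ← hξ₃]
    -- The squares of the three directions sum to at least `cos² + sin² = 1`.
    have h6 : 3 * r * (d + d ^ 3) ≤ 3 * r * (d + d ^ 3) *
        (Real.cos α ^ 2 + Real.sin α ^ 2 + (-(Real.cos α + Real.sin α)) ^ 2) := by
      have : 0 ≤ 3 * r * (d + d ^ 3) := by positivity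
      rw [Real.cos_sq_add_sin_sq]
      nlinarith [mul_nonneg this (sq_nonneg (-(Real.cos α + Real.sin α)))]
    linarith
  have hpos : 0 < 3 * r * (d + d ^ 3) := by positivity
  refine ⟨hpos.trans_le hmain, le_trans ?_ hmain⟩
  -- At most `3d + 27d³`, since `σ ξ ≤ 3d`.
  have hw : ∀ ξ, 0 < σ * ξ → σ * ξ ≤ 3 * d → weight35 ξ ^ 6 ≤ 27 * (d + d ^ 3) := by
    intro ξ hξ hle
    have : |ξ + ξ ^ 3| = σ * ξ + (σ * ξ) ^ 3 := by
      have e : σ * ξ + (σ * ξ) ^ 3 = σ * (ξ + ξ ^ 3) := by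
        linear_combination σ * ξ ^ 3 * hσ2
      have e' : |ξ + ξ ^ 3| = |σ * ξ + (σ * ξ) ^ 3| := by rw [e, abs_mul, hσa, one_mul]
      rw [e', abs_of_pos (by positivity)]
    rw [weight35_pow_six, this]
    have : (σ * ξ) ^ 3 ≤ (3 * d) ^ 3 := pow_le_pow_left₀ hξ.le hle 3
    nlinarith
  have hT : tripleProd weight35 (α, c, r) ^ 2 ≤ 27 * (d + d ^ 3) := by
    have h7 : (tripleProd weight35 (α, c, r) ^ 2) ^ 3 ≤ (27 * (d + d ^ 3)) ^ 3 := by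
      have e : (tripleProd weight35 (α, c, r) ^ 2) ^ 3
          = weight35 ξ₁ ^ 6 * weight35 ξ₂ ^ 6 * weight35 ξ₃ ^ 6 := by
        simp only [tripleProd, ← hξ₁, ← hξ₂, ← hξ₃]; ring
      rw [e, pow_succ (27 * (d + d ^ 3)), pow_two (27 * (d + d ^ 3))]
      have := weight35_nonneg
      gcongr
      · exact hw ξ₁ h1 (by linarith)
      · exact hw ξ₂ h2 (by linarith)
      · exact hw ξ₃ h3 (by linarith)
    exact le_of_pow_le_pow_left₀ (by norm_num) (by positivity) h7
  nlinarith [mul_le_mul_of_nonneg_left hT hr.le]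

/-! ### The extension bounds and the existence of the `L⁶` limits. -/

/-- The `L² → L⁶` bound for the extension operator with weight `m` and phase `φ`. -/
def HasExtensionBound (m φ : ℝ → ℝ) (C : ℝ≥0∞) : Prop :=
  C ≠ ⊤ ∧ ∀ F : ℝ → ℂ, Measurable F → Integrable (fun ξ => (m ξ : ℂ) * F ξ) →
    eLpNorm (oscIntegral φ fun ξ => (m ξ : ℂ) * F ξ) 6 volume ≤ C * eLpNorm F 2 volume

theorem stronglyMeasurable_oscIntegral {φ : ℝ → ℝ} (hφ : Measurable φ) {a : ℝ → ℂ}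
    (ha : Measurable a) : StronglyMeasurable (oscIntegral φ a) := by
  refine StronglyMeasurable.integral_prod_right' (f := fun q : (ℝ × ℝ) × ℝ => a q.2 *
    Complex.exp (Complex.I * ((q.1.2 * q.2 + q.1.1 * φ q.2 : ℝ) : ℂ))) ?_
  exact Measurable.stronglyMeasurable (by fun_prop)

theorem exists_eLpNorm_oscIntegral_le {m φ φ' : ℝ → ℝ} {S : Set ℝ} (hS : Convex ℝ S)
    (hSm : MeasurableSet S) (hm : Measurable m) (hφ : ∀ ξ, HasDerivAt φ (φ' ξ) ξ) {δ σ : ℝ}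
    (hδ : 0 < δ) (hσ : |σ| = 1) (hD : CurvatureBound m φ' S δ σ) :
    ∃ C : ℝ≥0∞, C ≠ ⊤ ∧ ∀ F : ℝ → ℂ, Measurable F → (∀ ξ ∉ S, F ξ = 0) →
      Integrable (fun ξ => (m ξ : ℂ) * F ξ) →
      eLpNorm (oscIntegral φ fun ξ => (m ξ : ℂ) * F ξ) 6 volume ≤ C * eLpNorm F 2 volume := by
  obtain ⟨C, hC, h⟩ := lintegral_oscIntegral_pow_six_le hS hSm hm hφ hδ hσ hD
  -- `C ≤ (C + 1)⁶` avoids extracting a sixth root.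
  refine ⟨C + 1, by simpa using hC, fun F hF hFS hi => ?_⟩
  have h1 := h F hF hFS hi
  rw [← eLpNorm_six_pow, ← eLpNorm_two_sq, ← pow_mul] at h1
  have h2 : C ≤ (C + 1) ^ 6 :=
    le_self_add.trans (le_self_pow₀ (by simp) (by norm_num))
  refine (ENNReal.pow_le_pow_left_iff (n := 6) (by norm_num)).1 ?_
  rw [mul_pow]
  exact h1.trans (by gcongr)

theorem exists_hasExtensionBound_schrodinger :
    ∃ C, HasExtensionBound schrodingerWeight schrodingerPhase C := by
  obtain ⟨C, hC, h⟩ := exists_eLpNorm_oscIntegral_le convex_univ MeasurableSet.univ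
    (measurable_const : Measurable schrodingerWeight) hasDerivAt_schrodingerPhase one_pos
    (by norm_num) curvatureBound_schrodinger
  exact ⟨C, hC, fun F hF hi => h F hF (by simp) hi⟩

theorem oscIntegral_add {φ : ℝ → ℝ} (hφ : Measurable φ) {a b : ℝ → ℂ} (ha : Integrable a)
    (hb : Integrable b) :
    oscIntegral φ (fun ξ => a ξ + b ξ) = oscIntegral φ a + oscIntegral φ b := by
  ext p
  have hθ : Measurable fun ξ => p.2 * ξ + p.1 * φ ξ := by fun_prop
  simp only [oscIntegral, Pi.add_apply, add_mul]
  exact integral_add (ha.mul_exp_I hθ) (hb.mul_exp_I hθ)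

theorem measurable_phase35 : Measurable phase35 := by
  unfold phase35; fun_prop

theorem exists_hasExtensionBound_weight35 : ∃ C, HasExtensionBound weight35 phase35 C := by
  have hconv : ∀ σ : ℝ, Convex ℝ {ξ : ℝ | 0 < σ * ξ} := fun σ =>
    convex_halfSpace_gt (IsLinearMap.mk (by intros; ring) (by intros; simp; ring)) 0
  have hmeas : ∀ σ : ℝ, MeasurableSet {ξ : ℝ | 0 < σ * ξ} := fun σ =>
    measurableSet_lt measurable_const (by fun_prop)
  have hw := continuous_weight35.measurable
  obtain ⟨C₁, hC₁, h₁⟩ := exists_eLpNorm_oscIntegral_le (hconv 1) (hmeas 1) hw hasDerivAt_phase35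
    (by norm_num) (by norm_num) (curvatureBound_weight35 (Or.inl rfl))
  obtain ⟨C₂, hC₂, h₂⟩ := exists_eLpNorm_oscIntegral_le (hconv (-1)) (hmeas (-1)) hw
    hasDerivAt_phase35 (by norm_num) (by norm_num) (curvatureBound_weight35 (Or.inr rfl))
  refine ⟨C₁ + C₂, by simp [hC₁, hC₂], fun F hF hi => ?_⟩
  -- The curvature changes sign at the origin, so the two half-lines are treated separately; nothing
  -- is lost at `ξ = 0`, where the weight vanishes.
  set F₁ := {ξ : ℝ | 0 < 1 * ξ}.indicator F with hF₁
  set F₂ := {ξ : ℝ | 0 < -1 * ξ}.indicator F with hF₂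
  have hm₁ : Measurable F₁ := hF.indicator (hmeas 1)
  have hm₂ : Measurable F₂ := hF.indicator (hmeas (-1))
  have hi₁ : Integrable fun ξ => (weight35 ξ : ℂ) * F₁ ξ := by
    refine (hi.indicator (hmeas 1)).congr (Eventually.of_forall fun ξ => ?_)
    simp only [hF₁, Set.indicator]; split_ifs <;> simp
  have hi₂ : Integrable fun ξ => (weight35 ξ : ℂ) * F₂ ξ := by
    refine (hi.indicator (hmeas (-1))).congr (Eventually.of_forall fun ξ => ?_)
    simp only [hF₂, Set.indicator]; split_ifs <;> simp
  have hsplit : (fun ξ => (weight35 ξ : ℂ) * F ξ)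
      = fun ξ => (weight35 ξ : ℂ) * F₁ ξ + (weight35 ξ : ℂ) * F₂ ξ := by
    ext ξ
    rcases lt_trichotomy ξ 0 with h | rfl | h
    · simp [hF₁, hF₂, h, not_lt.2 h.le]
    · simp [weight35]
    · simp [hF₁, hF₂, h, not_lt.2 h.le]
  have hwc : Measurable fun ξ => (weight35 ξ : ℂ) := Complex.measurable_ofReal.comp hw
  rw [hsplit, oscIntegral_add measurable_phase35 hi₁ hi₂]
  refine (eLpNorm_add_le
    (stronglyMeasurable_oscIntegral measurable_phase35 (hwc.mul hm₁)).aestronglyMeasurable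
    (stronglyMeasurable_oscIntegral measurable_phase35 (hwc.mul hm₂)).aestronglyMeasurable
    (by norm_num)).trans ?_
  rw [add_mul]
  gcongr
  · refine (h₁ F₁ hm₁ (fun ξ hξ => Set.indicator_of_notMem hξ _) hi₁).trans ?_
    gcongr
    exact eLpNorm_indicator_le _
  · refine (h₂ F₂ hm₂ (fun ξ hξ => Set.indicator_of_notMem hξ _) hi₂).trans ?_
    gcongr
    exact eLpNorm_indicator_le _

theorem tendsto_eLpNorm_sub_indicator_Icc {f : ℝ → ℂ} (hf : MemLp f 2 volume) :
    Tendsto (fun R : ℝ => eLpNorm (fun ξ => (Set.Icc (-R) R).indicator f ξ - f ξ) 2 volume)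
      atTop (𝓝 0) := by
  have hlim : Tendsto (fun R : ℝ => ∫⁻ ξ, ‖(Set.Icc (-R) R).indicator f ξ - f ξ‖ₑ ^ 2)
      atTop (𝓝 (∫⁻ _ : ℝ, 0)) := by
    refine tendsto_lintegral_filter_of_dominated_convergence' (fun ξ => ‖f ξ‖ₑ ^ 2)
      (Eventually.of_forall fun R => ?_) (Eventually.of_forall fun R => ?_) ?_ ?_
    · exact ((hf.1.indicator measurableSet_Icc).sub hf.1).enorm.pow_const 2
    · refine Eventually.of_forall fun ξ => ?_
      by_cases h : ξ ∈ Set.Icc (-R) R <;> simp [h]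
    · rw [← eLpNorm_two_sq]
      exact ENNReal.pow_ne_top hf.2.ne
    · refine Eventually.of_forall fun ξ => tendsto_const_nhds.congr' ?_
      filter_upwards [eventually_ge_atTop |ξ|] with R hR
      have : ξ ∈ Set.Icc (-R) R := abs_le.1 hR
      simp [this]
  rw [lintegral_zero] at hlim
  have h2 := (ENNReal.continuous_rpow_const (y := 1 / 2)).continuousAt.tendsto.comp hlim
  simp only [Function.comp_def, ← eLpNorm_two_sq] at h2
  refine (h2.congr fun R => ?_).trans (by simp)
  rw [← ENNReal.rpow_natCast, ← ENNReal.rpow_mul]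
  norm_num

theorem integrable_mul_indicator_Icc {m : ℝ → ℝ} (hm : Continuous m) {f : ℝ → ℂ}
    (hf : MemLp f 2 volume) (R : ℝ) :
    Integrable fun ξ => (m ξ : ℂ) * (Set.Icc (-R) R).indicator f ξ := by
  have h1 : IntegrableOn f (Set.Icc (-R) R) :=
    hf.locallyIntegrable (by norm_num) |>.integrableOn_isCompact isCompact_Icc
  have h2 : IntegrableOn (fun ξ => (m ξ : ℂ) * f ξ) (Set.Icc (-R) R) :=
    h1.continuousOn_mul (by fun_prop) isCompact_Icc
  refine ((integrable_indicator_iff measurableSet_Icc).2 h2).congr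
    (Eventually.of_forall fun ξ => ?_)
  by_cases h : ξ ∈ Set.Icc (-R) R <;> simp [h]

theorem truncExtension_eq (m φ : ℝ → ℝ) (f : L2R) (R : ℝ) (p : ℝ × ℝ) :
    truncExtension m φ f R p = (1 / (2 * Real.pi) : ℂ) *
      oscIntegral φ (fun ξ => (m ξ : ℂ) * (Set.Icc (-R) R).indicator (fourierHat f) ξ) p := by
  unfold truncExtension oscIntegral
  rw [← integral_indicator measurableSet_Icc]
  congr 2
  ext ξ
  by_cases h : ξ ∈ Set.Icc (-R) R
  · simp only [Set.indicator_of_mem h]; ring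
  · simp [Set.indicator_of_notMem h]

theorem oscIntegral_sub {φ : ℝ → ℝ} (hφ : Measurable φ) {a b : ℝ → ℂ} (ha : Integrable a)
    (hb : Integrable b) (p : ℝ × ℝ) :
    oscIntegral φ (fun ξ => a ξ - b ξ) p = oscIntegral φ a p - oscIntegral φ b p := by
  have hθ : Measurable fun ξ => p.2 * ξ + p.1 * φ ξ := by fun_prop
  simp only [oscIntegral, sub_mul]
  exact integral_sub (ha.mul_exp_I hθ) (hb.mul_exp_I hθ)

theorem enorm_one_div_two_pi_le : ‖(1 / (2 * Real.pi) : ℂ)‖ₑ ≤ 1 := by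
  have h : ‖(1 / (2 * Real.pi) : ℂ)‖ ≤ 1 := by
    have := Real.pi_gt_three
    rw [norm_div, norm_mul, norm_one, Complex.norm_real, Real.norm_of_nonneg Real.pi_pos.le,
      Complex.norm_ofNat, div_le_one (by linarith)]
    linarith
  rw [← ofReal_norm]
  exact ENNReal.ofReal_le_one.2 h

theorem HasExtensionBound.eLpNorm_sub_le {m φ : ℝ → ℝ} {C : ℝ≥0∞} (hC : HasExtensionBound m φ C)
    (hφ : Measurable φ) {F G : ℝ → ℂ} (hF : Measurable F) (hG : Measurable G)
    (hFi : Integrable fun ξ => (m ξ : ℂ) * F ξ) (hGi : Integrable fun ξ => (m ξ : ℂ) * G ξ) :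
    eLpNorm (fun p => (1 / (2 * Real.pi) : ℂ) * oscIntegral φ (fun ξ => (m ξ : ℂ) * F ξ) p
      - (1 / (2 * Real.pi) : ℂ) * oscIntegral φ (fun ξ => (m ξ : ℂ) * G ξ) p) 6 volume
      ≤ C * eLpNorm (fun ξ => F ξ - G ξ) 2 volume := by
  have h1 : (fun p => (1 / (2 * Real.pi) : ℂ) * oscIntegral φ (fun ξ => (m ξ : ℂ) * F ξ) p
      - (1 / (2 * Real.pi) : ℂ) * oscIntegral φ (fun ξ => (m ξ : ℂ) * G ξ) p)
      = (1 / (2 * Real.pi) : ℂ) • oscIntegral φ (fun ξ => (m ξ : ℂ) * (F ξ - G ξ)) := by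
    ext p
    simp only [mul_sub, Pi.smul_apply, smul_eq_mul]
    rw [oscIntegral_sub hφ hFi hGi, mul_sub]
  have hi : Integrable fun ξ => (m ξ : ℂ) * (F ξ - G ξ) := by
    simpa only [mul_sub] using! hFi.sub hGi
  rw [h1, eLpNorm_const_smul]
  calc _ ≤ 1 * eLpNorm (oscIntegral φ fun ξ => (m ξ : ℂ) * (F ξ - G ξ)) 6 volume := by
        gcongr
        exact enorm_one_div_two_pi_le
    _ ≤ _ := by
        rw [one_mul]
        exact hC.2 _ (hF.sub hG) hi

section

variable {m φ : ℝ → ℝ} {C : ℝ≥0∞}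

theorem aestronglyMeasurable_truncExtension (hm : Measurable m) (hφ : Measurable φ) (f : L2R)
    (R : ℝ) : AEStronglyMeasurable (truncExtension m φ f R) volume := by
  have : truncExtension m φ f R = fun p => _ := funext fun p => truncExtension_eq m φ f R p
  rw [this]
  refine StronglyMeasurable.aestronglyMeasurable ?_
  refine stronglyMeasurable_const.mul (stronglyMeasurable_oscIntegral hφ ?_)
  exact (Complex.measurable_ofReal.comp hm).mul
    ((measurable_fourierHat f).indicator measurableSet_Icc)

theorem eLpNorm_truncExtension_sub_le (hC : HasExtensionBound m φ C) (hm : Continuous m)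
    (hφ : Measurable φ) (f : L2R) (R R' : ℝ) :
    eLpNorm (fun p => truncExtension m φ f R p - truncExtension m φ f R' p) 6 volume
      ≤ C * eLpNorm (fun ξ => (Set.Icc (-R) R).indicator (fourierHat f) ξ
        - (Set.Icc (-R') R').indicator (fourierHat f) ξ) 2 volume := by
  simp_rw [truncExtension_eq]
  exact hC.eLpNorm_sub_le hφ ((measurable_fourierHat f).indicator measurableSet_Icc)
    ((measurable_fourierHat f).indicator measurableSet_Icc)
    (integrable_mul_indicator_Icc hm (memLp_fourierHat f) R)
    (integrable_mul_indicator_Icc hm (memLp_fourierHat f) R')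

theorem memLp_truncExtension (hC : HasExtensionBound m φ C) (hm : Continuous m)
    (hφ : Measurable φ) (f : L2R) (R : ℝ) : MemLp (truncExtension m φ f R) 6 volume := by
  refine ⟨aestronglyMeasurable_truncExtension hm.measurable hφ f R, ?_⟩
  -- For `R = -1` the interval is empty; comparing with this zero truncation turns the difference
  -- estimate into a bound.
  have h0 : ∀ p, truncExtension m φ f (-1) p = 0 := fun p => by
    simp [truncExtension]
  have h := eLpNorm_truncExtension_sub_le hC hm hφ f R (-1)
  simp only [h0, sub_zero] at h
  refine h.trans_lt (ENNReal.mul_lt_top hC.1.lt_top ?_)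
  have := ((memLp_fourierHat f).indicator (s := Set.Icc (-R) R) measurableSet_Icc).sub
    ((memLp_fourierHat f).indicator (s := Set.Icc (- -1) (-1)) measurableSet_Icc)
  exact this.2

/-- Truncations of `fourierHat f` are Cauchy in `L²`; the extension bound makes the truncated
integrals Cauchy in `L⁶`, which is complete. -/
theorem exists_isExtension (hC : HasExtensionBound m φ C) (hm : Continuous m)
    (hφ : Measurable φ) (f : L2R) : ∃ u, IsExtension m φ f u := by
  have : Fact ((1 : ℝ≥0∞) ≤ 6) := ⟨by norm_num⟩
  have hmem := memLp_truncExtension hC hm hφ f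
  have hI : ∀ R : ℝ, MemLp ((Set.Icc (-R) R).indicator (fourierHat f)) 2 volume := fun R =>
    (memLp_fourierHat f).indicator measurableSet_Icc
  set U : ℝ → Lp ℂ 6 (volume : Measure (ℝ × ℝ)) := fun R => (hmem R).toLp _ with hU
  set V : ℝ → L2R := fun R => (hI R).toLp _ with hV
  have hVc : CauchySeq V := by
    refine Tendsto.cauchySeq (x := (memLp_fourierHat f).toLp _) ?_
    rw [Lp.tendsto_Lp_iff_tendsto_eLpNorm'']
    exact tendsto_eLpNorm_sub_indicator_Icc (memLp_fourierHat f)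
  have hdist : ∀ R R', edist (U R) (U R') ≤ C * edist (V R) (V R') := fun R R' => by
    rw [hU, hV, Lp.edist_toLp_toLp, Lp.edist_toLp_toLp]
    exact eLpNorm_truncExtension_sub_le hC hm hφ f R R'
  have hUc : CauchySeq U := by
    rw [EMetric.cauchySeq_iff] at hVc ⊢
    intro ε hε
    obtain ⟨N, hN⟩ := hVc (ε / (C + 1)) (ENNReal.div_pos hε.ne' (by simpa using hC.1))
    refine ⟨N, fun R hR R' hR' => (hdist R R').trans_lt ?_⟩
    have h1 := hN R hR R' hR'
    calc C * edist (V R) (V R') ≤ (C + 1) * edist (V R) (V R') := by gcongr; exact le_self_add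
      _ < ε := by
        rw [mul_comm]
        exact (ENNReal.lt_div_iff_mul_lt (by simp) (by simp [hC.1])).1 h1
  obtain ⟨u, hu⟩ := cauchySeq_tendsto_of_complete hUc
  refine ⟨u, Lp.memLp u, ?_⟩
  rw [Lp.tendsto_Lp_iff_tendsto_eLpNorm'] at hu
  refine hu.congr fun R => eLpNorm_congr_ae ?_
  filter_upwards [(hmem R).coeFn_toLp] with p hp
  simp only [Pi.sub_apply, hU, hp]

theorem isExtension_extension (hC : HasExtensionBound m φ C) (hm : Continuous m)
    (hφ : Measurable φ) (f : L2R) : IsExtension m φ f (extension m φ f) := by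
  have h := exists_isExtension hC hm hφ f
  rw [extension, dif_pos h]
  exact h.choose_spec

/-- The density tool: the bound for differences of oscillatory integrals survives the limit `R → ∞`,
so the extension may be compared with the integral of any convenient amplitude `F`. -/
theorem IsExtension.eLpNorm_sub_oscIntegral_le {f : L2R} {u : ℝ × ℝ → ℂ}
    (hu : IsExtension m φ f u) (hC : HasExtensionBound m φ C) (hm : Continuous m)
    (hφ : Measurable φ) {F : ℝ → ℂ} (hF : Measurable F)
    (hFi : Integrable fun ξ => (m ξ : ℂ) * F ξ) :
    eLpNorm (fun p => u p - (1 / (2 * Real.pi) : ℂ) *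
        oscIntegral φ (fun ξ => (m ξ : ℂ) * F ξ) p) 6 volume
      ≤ C * eLpNorm (fun ξ => fourierHat f ξ - F ξ) 2 volume := by
  have hosc : AEStronglyMeasurable (fun p => (1 / (2 * Real.pi) : ℂ) *
      oscIntegral φ (fun ξ => (m ξ : ℂ) * F ξ) p) volume :=
    (stronglyMeasurable_const.mul (stronglyMeasurable_oscIntegral hφ
      ((Complex.measurable_ofReal.comp hm.measurable).mul hF))).aestronglyMeasurable
  have hlim : Tendsto (fun R : ℝ =>
      eLpNorm (fun p => truncExtension m φ f R p - u p) 6 volume +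
      C * (eLpNorm (fun ξ => (Set.Icc (-R) R).indicator (fourierHat f) ξ - fourierHat f ξ) 2 volume
        + eLpNorm (fun ξ => fourierHat f ξ - F ξ) 2 volume)) atTop
      (𝓝 (0 + C * (0 + eLpNorm (fun ξ => fourierHat f ξ - F ξ) 2 volume))) :=
    hu.2.add (ENNReal.Tendsto.const_mul
      ((tendsto_eLpNorm_sub_indicator_Icc (memLp_fourierHat f)).add tendsto_const_nhds)
      (Or.inr hC.1))
  rw [zero_add, zero_add] at hlim
  refine ge_of_tendsto' hlim fun R => ?_
  have hT := aestronglyMeasurable_truncExtension hm.measurable hφ f R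
  have hfm := measurable_fourierHat f
  have hIm : Measurable ((Set.Icc (-R) R).indicator (fourierHat f)) :=
    hfm.indicator measurableSet_Icc
  calc eLpNorm (fun p => u p - (1 / (2 * Real.pi) : ℂ) *
        oscIntegral φ (fun ξ => (m ξ : ℂ) * F ξ) p) 6 volume
      ≤ eLpNorm (fun p => u p - truncExtension m φ f R p) 6 volume
        + eLpNorm (fun p => truncExtension m φ f R p - (1 / (2 * Real.pi) : ℂ) *
          oscIntegral φ (fun ξ => (m ξ : ℂ) * F ξ) p) 6 volume := by
        refine le_trans (le_of_eq ?_) (eLpNorm_add_le (hu.1.1.sub hT) (hT.sub hosc) (by norm_num))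
        congr 1
        ext p
        simp
    _ ≤ _ := by
        gcongr
        · rw [← eLpNorm_neg]
          refine le_of_eq ?_
          congr 1
          ext p
          simp
        · simp_rw [truncExtension_eq]
          refine (hC.eLpNorm_sub_le hφ hIm hF
            (integrable_mul_indicator_Icc hm (memLp_fourierHat f) R) hFi).trans ?_
          gcongr
          refine le_trans (le_of_eq ?_) (eLpNorm_add_le (hIm.sub hfm).aestronglyMeasurable
            (hfm.sub hF).aestronglyMeasurable (by norm_num))
          congr 1
          ext ξ
          simp

end

/-! ### Van der Corput estimates. -/

theorem continuous_exp_I_mul {Ψ : ℝ → ℝ} (h : Continuous Ψ) :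
    Continuous fun η => Complex.exp (Complex.I * (Ψ η : ℂ)) := by fun_prop

/-- The first derivative test of van der Corput. -/
theorem norm_integral_exp_le_of_deriv {Ψ Ψ' Ψ'' : ℝ → ℝ} (h1 : ∀ η, HasDerivAt Ψ (Ψ' η) η)
    (h2 : ∀ η, HasDerivAt Ψ' (Ψ'' η) η) (h3 : Continuous Ψ'') {a b μ : ℝ} (hab : a ≤ b)
    (hμ : 0 < μ) (hΨ' : ∀ η ∈ Set.Icc a b, μ ≤ Ψ' η) (hΨ'' : ∀ η ∈ Set.Icc a b, 0 ≤ Ψ'' η) :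
    ‖∫ η in a..b, Complex.exp (Complex.I * (Ψ η : ℂ))‖ ≤ 3 / μ := by
  have hc1 : Continuous Ψ := continuous_iff_continuousAt.2 fun η => (h1 η).continuousAt
  have hc2 : Continuous Ψ' := continuous_iff_continuousAt.2 fun η => (h2 η).continuousAt
  have hpos : ∀ η ∈ Set.Icc a b, 0 < Ψ' η := fun η hη => hμ.trans_le (hΨ' η hη)
  have hu : ∀ η ∈ Set.uIcc a b, HasDerivAt (fun η => (Ψ' η)⁻¹) (-Ψ'' η / Ψ' η ^ 2) η :=
    fun η hη => (h2 η).inv (hpos η (by rwa [Set.uIcc_of_le hab] at hη)).ne'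
  have hv : ∀ η ∈ Set.uIcc a b, HasDerivAt
      (fun η => -Complex.I * Complex.exp (Complex.I * (Ψ η : ℂ)))
      ((Ψ' η : ℂ) * Complex.exp (Complex.I * (Ψ η : ℂ))) η := fun η _ => by
    have := (((h1 η).ofReal_comp.const_mul Complex.I).cexp).const_mul (-Complex.I)
    refine this.congr_deriv ?_
    linear_combination (-(Ψ' η : ℂ) * Complex.exp (Complex.I * (Ψ η : ℂ))) * Complex.I_mul_I
  have hu'c : ContinuousOn (fun η => -Ψ'' η / Ψ' η ^ 2) (Set.uIcc a b) := by
    refine ContinuousOn.div (by fun_prop) (by fun_prop) fun η hη => ?_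
    exact pow_ne_zero 2 (hpos η (by rwa [Set.uIcc_of_le hab] at hη)).ne'
  have hu'i : IntervalIntegrable (fun η => -Ψ'' η / Ψ' η ^ 2) volume a b :=
    hu'c.intervalIntegrable
  have hexp := continuous_exp_I_mul hc1
  have hparts := intervalIntegral.integral_mul_deriv_eq_deriv_mul
    (fun η hη => (hu η hη).ofReal_comp) hv
    (ContinuousOn.intervalIntegrable (by
      exact Complex.continuous_ofReal.comp_continuousOn hu'c))
    (Continuous.intervalIntegrable (by fun_prop) a b)
  have hcongr : ∫ η in a..b, Complex.exp (Complex.I * (Ψ η : ℂ))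
      = ∫ η in a..b, (((Ψ' η)⁻¹ : ℝ) : ℂ) * ((Ψ' η : ℂ) * Complex.exp (Complex.I * (Ψ η : ℂ))) := by
    refine intervalIntegral.integral_congr fun η hη => ?_
    have : (Ψ' η : ℂ) ≠ 0 := by
      exact_mod_cast (hpos η (by rwa [Set.uIcc_of_le hab] at hη)).ne'
    push_cast
    field_simp
  have hinv : ∀ η ∈ Set.Icc a b, (Ψ' η)⁻¹ ≤ 1 / μ := fun η hη => by
    rw [← one_div]
    exact one_div_le_one_div_of_le hμ (hΨ' η hη)
  have hinv0 : ∀ η ∈ Set.Icc a b, 0 ≤ (Ψ' η)⁻¹ := fun η hη => inv_nonneg.2 (hpos η hη).le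
  have hnorm : ∀ η ∈ Set.Icc a b, ‖(((Ψ' η)⁻¹ : ℝ) : ℂ) *
      (-Complex.I * Complex.exp (Complex.I * (Ψ η : ℂ)))‖ = (Ψ' η)⁻¹ := fun η hη => by
    rw [norm_mul, norm_mul, norm_exp_I_mul_ofReal, norm_neg, Complex.norm_I, Complex.norm_real,
      Real.norm_of_nonneg (hinv0 η hη)]
    ring
  have ha : a ∈ Set.Icc a b := ⟨le_rfl, hab⟩
  have hb : b ∈ Set.Icc a b := ⟨hab, le_rfl⟩
  -- Since `Ψ'' ≥ 0`, `1/Ψ'` is monotone, and the integral of its absolute derivative telescopes.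
  -- With the two boundary terms this makes three contributions of at most `1/μ`.
  have hintg : ‖∫ η in a..b, ((-Ψ'' η / Ψ' η ^ 2 : ℝ) : ℂ) *
      (-Complex.I * Complex.exp (Complex.I * (Ψ η : ℂ)))‖ ≤ 1 / μ := by
    calc _ ≤ ∫ η in a..b, -(-Ψ'' η / Ψ' η ^ 2) := by
          refine intervalIntegral.norm_integral_le_of_norm_le hab
            (Eventually.of_forall fun η hη => ?_) hu'i.neg
          rw [norm_mul, norm_mul, norm_exp_I_mul_ofReal, norm_neg, Complex.norm_I,
            Complex.norm_real, Real.norm_eq_abs, mul_one, mul_one, abs_of_nonpos]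
          rw [neg_div, neg_nonpos]
          exact div_nonneg (hΨ'' η (Set.Ioc_subset_Icc_self hη)) (sq_nonneg _)
      _ = -((Ψ' b)⁻¹ - (Ψ' a)⁻¹) := by
          rw [intervalIntegral.integral_neg, intervalIntegral.integral_eq_sub_of_hasDerivAt hu hu'i]
      _ ≤ 1 / μ := by linarith [hinv a ha, hinv0 b hb]
  rw [hcongr, hparts]
  calc _ ≤ (Ψ' b)⁻¹ + (Ψ' a)⁻¹ + 1 / μ := by
        refine (norm_sub_le _ _).trans (add_le_add ((norm_sub_le _ _).trans ?_) hintg)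
        rw [hnorm a ha, hnorm b hb]
    _ ≤ 1 / μ + 1 / μ + 1 / μ := by gcongr; exacts [hinv b hb, hinv a ha]
    _ = 3 / μ := by ring

theorem norm_integral_exp_le_length {Ψ : ℝ → ℝ} {a b : ℝ} (hab : a ≤ b) :
    ‖∫ η in a..b, Complex.exp (Complex.I * (Ψ η : ℂ))‖ ≤ b - a := by
  have := intervalIntegral.norm_integral_le_of_norm_le_const (a := a) (b := b) (C := 1)
    (f := fun η => Complex.exp (Complex.I * (Ψ η : ℂ)))
    (fun η _ => (norm_exp_I_mul_ofReal _).le)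
  rwa [one_mul, abs_of_nonneg (by linarith)] at this

/-- The piece of length `δ` next to `a` is bounded trivially; beyond it `Ψ' ≥ l δ` and the first
derivative test applies. -/
theorem norm_integral_exp_le_of_deriv_nonneg {Ψ Ψ' Ψ'' : ℝ → ℝ}
    (h1 : ∀ η, HasDerivAt Ψ (Ψ' η) η) (h2 : ∀ η, HasDerivAt Ψ' (Ψ'' η) η) (h3 : Continuous Ψ'')
    {a b l δ : ℝ} (hab : a ≤ b) (hl : 0 < l) (hδ : 0 < δ) (ha : 0 ≤ Ψ' a)
    (hΨ'' : ∀ η ∈ Set.Icc a b, l ≤ Ψ'' η) :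
    ‖∫ η in a..b, Complex.exp (Complex.I * (Ψ η : ℂ))‖ ≤ δ + 3 / (l * δ) := by
  have hc1 : Continuous Ψ := continuous_iff_continuousAt.2 fun η => (h1 η).continuousAt
  have hpos : 0 ≤ 3 / (l * δ) := by positivity
  rcases le_total b (a + δ) with hbδ | hbδ
  · exact (norm_integral_exp_le_length hab).trans (by linarith)
  have hgrow : ∀ η ∈ Set.Icc (a + δ) b, l * δ ≤ Ψ' η := fun η hη => by
    have haη : a ≤ η := by linarith [hη.1]
    have hsub : ∀ x ∈ interior (Set.Icc a b), l ≤ deriv Ψ' x := fun x hx => by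
      rw [(h2 x).deriv]
      exact hΨ'' x (interior_subset hx)
    have := (convex_Icc a b).mul_sub_le_image_sub_of_le_deriv
      (fun x _ => (h2 x).continuousAt.continuousWithinAt)
      (fun x _ => (h2 x).differentiableAt.differentiableWithinAt) hsub a ⟨le_rfl, hab⟩ η
      ⟨haη, hη.2⟩ haη
    nlinarith [hη.1]
  have hexp := continuous_exp_I_mul hc1
  rw [← intervalIntegral.integral_add_adjacent_intervals (hexp.intervalIntegrable a (a + δ))
    (hexp.intervalIntegrable (a + δ) b)]
  refine (norm_add_le _ _).trans (add_le_add ?_ ?_)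
  · exact (norm_integral_exp_le_length (by linarith)).trans (by linarith)
  · exact norm_integral_exp_le_of_deriv h1 h2 h3 hbδ (by positivity) hgrow fun η hη =>
      hl.le.trans (hΨ'' η ⟨by linarith [hη.1], hη.2⟩)

/-- The second derivative test of van der Corput. -/
theorem norm_integral_exp_le_of_deriv2 {Ψ Ψ' Ψ'' : ℝ → ℝ} (h1 : ∀ η, HasDerivAt Ψ (Ψ' η) η)
    (h2 : ∀ η, HasDerivAt Ψ' (Ψ'' η) η) (h3 : Continuous Ψ'') {a b l δ : ℝ} (hab : a ≤ b)
    (hl : 0 < l) (hδ : 0 < δ) (hΨ'' : ∀ η ∈ Set.Icc a b, l ≤ Ψ'' η) :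
    ‖∫ η in a..b, Complex.exp (Complex.I * (Ψ η : ℂ))‖ ≤ 2 * (δ + 3 / (l * δ)) := by
  have hc1 : Continuous Ψ := continuous_iff_continuousAt.2 fun η => (h1 η).continuousAt
  have hc2 : Continuous Ψ' := continuous_iff_continuousAt.2 fun η => (h2 η).continuousAt
  have hpos : 0 ≤ δ + 3 / (l * δ) := by positivity
  have hright : ∀ c ∈ Set.Icc a b, 0 ≤ Ψ' c →
      ‖∫ η in c..b, Complex.exp (Complex.I * (Ψ η : ℂ))‖ ≤ δ + 3 / (l * δ) := fun c hc h =>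
    norm_integral_exp_le_of_deriv_nonneg h1 h2 h3 hc.2 hl hδ h fun η hη =>
      hΨ'' η ⟨hc.1.trans hη.1, hη.2⟩
  -- The reflection `η ↦ -η` preserves the sign of `Ψ''` and flips that of `Ψ'`.
  have hleft : ∀ c ∈ Set.Icc a b, Ψ' c ≤ 0 →
      ‖∫ η in a..c, Complex.exp (Complex.I * (Ψ η : ℂ))‖ ≤ δ + 3 / (l * δ) := fun c hc h => by
    have g1 : ∀ η, HasDerivAt (fun η => Ψ (-η)) (-Ψ' (-η)) η := fun η => by
      simpa using! (h1 (-η)).comp η (hasDerivAt_neg η)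
    have g2 : ∀ η, HasDerivAt (fun η => -Ψ' (-η)) (Ψ'' (-η)) η := fun η => by
      simpa using! ((h2 (-η)).comp η (hasDerivAt_neg η)).neg
    have := norm_integral_exp_le_of_deriv_nonneg (a := -c) (b := -a) g1 g2
      (h3.comp continuous_neg) (by linarith [hc.1]) hl hδ (by simpa using h) fun η hη =>
        hΨ'' (-η) ⟨by linarith [hη.2], by linarith [hη.1, hc.2]⟩
    rwa [intervalIntegral.integral_comp_neg (fun η => Complex.exp (Complex.I * (Ψ η : ℂ))),
      neg_neg, neg_neg] at this
  rcases le_total 0 (Ψ' a) with ha | ha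
  · exact (hright a ⟨le_rfl, hab⟩ ha).trans (by linarith)
  rcases le_total (Ψ' b) 0 with hb | hb
  · exact (hleft b ⟨hab, le_rfl⟩ hb).trans (by linarith)
  obtain ⟨c, hc, hc0⟩ := intermediate_value_Icc hab hc2.continuousOn ⟨ha, hb⟩
  have hexp := continuous_exp_I_mul hc1
  rw [← intervalIntegral.integral_add_adjacent_intervals (hexp.intervalIntegrable a c)
    (hexp.intervalIntegrable c b)]
  refine (norm_add_le _ _).trans ?_
  linarith [hleft c hc hc0.le, hright c hc hc0.ge]

/-- A negative second derivative is reduced to a positive one by complex conjugation. -/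
theorem norm_integral_exp_le_of_abs_deriv2 {Ψ Ψ' Ψ'' : ℝ → ℝ} (h1 : ∀ η, HasDerivAt Ψ (Ψ' η) η)
    (h2 : ∀ η, HasDerivAt Ψ' (Ψ'' η) η) (h3 : Continuous Ψ'') {a b l δ σ : ℝ}
    (hσ : σ = 1 ∨ σ = -1) (hab : a ≤ b) (hl : 0 < l) (hδ : 0 < δ)
    (hΨ'' : ∀ η ∈ Set.Icc a b, l ≤ σ * Ψ'' η) :
    ‖∫ η in a..b, Complex.exp (Complex.I * (Ψ η : ℂ))‖ ≤ 2 * (δ + 3 / (l * δ)) := by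
  rcases hσ with rfl | rfl
  · exact norm_integral_exp_le_of_deriv2 h1 h2 h3 hab hl hδ (by simpa using hΨ'')
  · have := norm_integral_exp_le_of_deriv2 (fun η => (h1 η).neg) (fun η => (h2 η).neg) h3.neg
      hab hl hδ (by simpa using hΨ'')
    refine le_trans (le_of_eq ?_) this
    rw [← RCLike.norm_conj, intervalIntegral.integral_of_le hab,
      intervalIntegral.integral_of_le hab, ← integral_conj]
    congr 2
    ext η
    rw [← Complex.exp_conj]
    simp

/-- The second derivative test with an amplitude. -/
theorem norm_integral_mul_exp_le_of_deriv2 {Ψ Ψ' Ψ'' : ℝ → ℝ} (h1 : ∀ η, HasDerivAt Ψ (Ψ' η) η)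
    (h2 : ∀ η, HasDerivAt Ψ' (Ψ'' η) η) (h3 : Continuous Ψ'') {K l δ σ : ℝ}
    (hσ : σ = 1 ∨ σ = -1) (hK : 0 ≤ K) (hl : 0 < l) (hδ : 0 < δ)
    (hΨ'' : ∀ η ∈ Set.Icc (-K) K, l ≤ σ * Ψ'' η) {F : ℝ → ℂ}
    (hF : ContDiff ℝ 1 F) (hFK : ∀ η, K ≤ |η| → F η = 0) :
    ‖∫ η, F η * Complex.exp (Complex.I * (Ψ η : ℂ))‖
      ≤ 2 * (δ + 3 / (l * δ)) * ∫ η in (-K)..K, ‖deriv F η‖ := by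
  have hc1 : Continuous Ψ := continuous_iff_continuousAt.2 fun η => (h1 η).continuousAt
  have hexp := continuous_exp_I_mul hc1
  have hF' : Continuous (deriv F) := hF.continuous_deriv le_rfl
  have hKK : -K ≤ K := by linarith
  have e1 : ∫ η, F η * Complex.exp (Complex.I * (Ψ η : ℂ))
      = ∫ η in (-K)..K, F η * Complex.exp (Complex.I * (Ψ η : ℂ)) := by
    rw [intervalIntegral.integral_of_le hKK]
    refine (setIntegral_eq_integral_of_forall_compl_eq_zero fun η hη => ?_).symm
    rw [hFK η, zero_mul]
    by_contra hlt
    rw [not_le, abs_lt] at hlt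
    exact hη ⟨hlt.1, hlt.2.le⟩
  -- Integration by parts against this primitive: boundary terms vanish with `F`, and the second
  -- derivative test bounds `v` uniformly.
  set v : ℝ → ℂ := fun η => ∫ x in (-K)..η, Complex.exp (Complex.I * (Ψ x : ℂ)) with hv
  have hv' : ∀ η, HasDerivAt v (Complex.exp (Complex.I * (Ψ η : ℂ))) η := fun η =>
    intervalIntegral.integral_hasDerivAt_right (hexp.intervalIntegrable _ _)
      (hexp.stronglyMeasurableAtFilter _ _) hexp.continuousAt
  have hparts := intervalIntegral.integral_mul_deriv_eq_deriv_mul (a := -K) (b := K)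
    (fun η _ => (hF.differentiable one_ne_zero η).hasDerivAt) (fun η _ => hv' η)
    (hF'.intervalIntegrable _ _) (hexp.intervalIntegrable _ _)
  rw [e1, hparts, hFK K (le_abs_self K), hFK (-K) (by rw [abs_neg]; exact le_abs_self K)]
  simp only [zero_mul, sub_self, zero_sub, norm_neg]
  rw [← intervalIntegral.integral_const_mul]
  refine intervalIntegral.norm_integral_le_of_norm_le hKK (Eventually.of_forall fun η hη => ?_)
    ((hF'.norm.const_mul _).intervalIntegrable _ _)
  rw [norm_mul, mul_comm]
  gcongr
  exact norm_integral_exp_le_of_abs_deriv2 h1 h2 h3 hσ hη.1.le hl hδ fun x hx =>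
    hΨ'' x ⟨hx.1, hx.2.trans hη.2⟩

/-! ### Convergence in `L⁶` under convergence of the phase. -/

/-- `ψ` is twice continuously differentiable with `σ ψ'' ≥ l` on `[-K, K]`. -/
structure CurvedPhase (ψ : ℝ → ℝ) (K l σ : ℝ) : Prop where
  exists_deriv : ∃ ψ' ψ'' : ℝ → ℝ, (∀ η, HasDerivAt ψ (ψ' η) η) ∧ (∀ η, HasDerivAt ψ' (ψ'' η) η) ∧
    Continuous ψ'' ∧ ∀ η ∈ Set.Icc (-K) K, l ≤ σ * ψ'' η

theorem CurvedPhase.continuous {ψ : ℝ → ℝ} {K l σ : ℝ} (h : CurvedPhase ψ K l σ) :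
    Continuous ψ := by
  obtain ⟨ψ', ψ'', h1, -⟩ := h.exists_deriv
  exact continuous_iff_continuousAt.2 fun η => (h1 η).continuousAt

/-- The decay `|s|^{-1/2}` in a form without division. Fourth powers are used because `‖·‖⁶ = ‖·‖⁴
‖·‖²`, the square being left to Plancherel. -/
theorem CurvedPhase.sq_mul_norm_oscIntegral_le {ψ : ℝ → ℝ} {K l σ : ℝ} (h : CurvedPhase ψ K l σ)
    (hσ : σ = 1 ∨ σ = -1) (hK : 0 ≤ K) (hl : 0 < l) {F : ℝ → ℂ} (hF : ContDiff ℝ 1 F)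
    (hFK : ∀ η, K ≤ |η| → F η = 0) (p : ℝ × ℝ) :
    p.1 ^ 2 * ‖oscIntegral ψ F p‖ ^ 4 ≤ (8 * ∫ η in (-K)..K, ‖deriv F η‖) ^ 4 / l ^ 2 := by
  obtain ⟨ψ', ψ'', h1, h2, h3, h4⟩ := h.exists_deriv
  obtain ⟨s, y⟩ := p
  have hV : 0 ≤ ∫ η in (-K)..K, ‖deriv F η‖ :=
    intervalIntegral.integral_nonneg (by linarith) fun η _ => norm_nonneg _
  simp only
  rcases eq_or_ne s 0 with rfl | hs
  · simp only [ne_eq, OfNat.ofNat_ne_zero, not_false_eq_true, zero_pow, zero_mul]; positivity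
  have hσ2 : σ ^ 2 = 1 := by rcases hσ with rfl | rfl <;> norm_num
  have hsa : 0 < |s| := abs_pos.2 hs
  -- `ρ` is the sign of the second derivative of the full phase `yη + sψ(η)`, which depends on the
  -- sign of `s`.
  obtain ⟨ρ, hρ, hρs⟩ : ∃ ρ : ℝ, (ρ = 1 ∨ ρ = -1) ∧ ρ * s = σ * |s| := by
    rcases abs_choice s with h | h <;> rw [h]
    · exact ⟨σ, hσ, rfl⟩
    · refine ⟨-σ, ?_, by ring⟩
      rcases hσ with rfl | rfl <;> simp
  have hL : 0 < |s| * l := by positivity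
  -- This choice balances the two terms of the test: both become multiples of `(|s| l)^{-1/2}`, with
  -- total factor `2(1 + 3) = 8`.
  set δ := 1 / Real.sqrt (|s| * l) with hδ
  have hsq : 0 < Real.sqrt (|s| * l) := Real.sqrt_pos.2 hL
  have g1 : ∀ η, HasDerivAt (fun η => y * η + s * ψ η) (y + s * ψ' η) η := fun η => by
    simpa using! ((hasDerivAt_id η).const_mul y).add ((h1 η).const_mul s)
  have g2 : ∀ η, HasDerivAt (fun η => y + s * ψ' η) (s * ψ'' η) η := fun η =>
    ((h2 η).const_mul s).const_add y
  have hb := norm_integral_mul_exp_le_of_deriv2 g1 g2 (h3.const_mul s) hρ hK hL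
    (δ := δ) (by positivity) (fun η hη => by
      rw [← mul_assoc, hρs, mul_right_comm, mul_comm _ |s|]
      exact mul_le_mul_of_nonneg_left (h4 η hη) hsa.le) hF hFK
  have hconst : 2 * (δ + 3 / (|s| * l * δ)) = 8 / Real.sqrt (|s| * l) := by
    rw [hδ]
    nth_rewrite 2 [← Real.mul_self_sqrt hL.le]
    field_simp
    norm_num
  rw [hconst] at hb
  have hb4 : ‖oscIntegral ψ F (s, y)‖ ^ 4
      ≤ (8 / Real.sqrt (|s| * l) * ∫ η in (-K)..K, ‖deriv F η‖) ^ 4 :=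
    pow_le_pow_left₀ (norm_nonneg _) hb 4
  have hs4 : Real.sqrt (|s| * l) ^ 4 = s ^ 2 * l ^ 2 := by
    have : Real.sqrt (|s| * l) ^ 4 = (Real.sqrt (|s| * l) ^ 2) ^ 2 := by ring
    rw [this, Real.sq_sqrt hL.le, mul_pow, sq_abs]
  calc s ^ 2 * ‖oscIntegral ψ F (s, y)‖ ^ 4
      ≤ s ^ 2 * (8 / Real.sqrt (|s| * l) * ∫ η in (-K)..K, ‖deriv F η‖) ^ 4 := by gcongr
    _ = _ := by
      rw [mul_pow, div_pow, hs4]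
      field_simp

theorem norm_oscIntegral_le (φ : ℝ → ℝ) (a : ℝ → ℂ) (p : ℝ × ℝ) :
    ‖oscIntegral φ a p‖ ≤ ∫ ξ, ‖a ξ‖ := by
  refine (norm_integral_le_integral_norm _).trans (le_of_eq ?_)
  congr 1
  ext ξ
  rw [norm_mul, norm_exp_I_mul_ofReal, mul_one]

theorem oscIntegral_phase_sub {φ ψ : ℝ → ℝ} (hφ : Measurable φ) (hψ : Measurable ψ) {a : ℝ → ℂ}
    (ha : Integrable a) (s y : ℝ) :
    oscIntegral φ a (s, y) - oscIntegral ψ a (s, y) = ∫ ξ, (a ξ *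
      (Complex.exp (Complex.I * ((s * φ ξ : ℝ) : ℂ)) - Complex.exp (Complex.I * ((s * ψ ξ : ℝ) : ℂ))))
      * Complex.exp (Complex.I * ((y * ξ : ℝ) : ℂ)) := by
  have h1 : Measurable fun ξ => y * ξ + s * φ ξ := by fun_prop
  have h2 : Measurable fun ξ => y * ξ + s * ψ ξ := by fun_prop
  simp only [oscIntegral]
  rw [← integral_sub (ha.mul_exp_I h1) (ha.mul_exp_I h2)]
  congr 1
  ext ξ
  have e : ∀ u v : ℝ, Complex.exp (Complex.I * ((u + v : ℝ) : ℂ))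
      = Complex.exp (Complex.I * (u : ℂ)) * Complex.exp (Complex.I * (v : ℂ)) := fun u v => by
    rw [← Complex.exp_add]; push_cast; ring_nf
  rw [e, e]
  ring

/-- Continuity of oscillatory integrals in the phase, in `L⁶`. -/
theorem tendsto_eLpNorm_oscIntegral_sub {ψ : ℝ → ℝ → ℝ} {ψ₀ : ℝ → ℝ} {K l σ : ℝ}
    (hσ : σ = 1 ∨ σ = -1) (hK : 0 ≤ K) (hl : 0 < l)
    (hψ : ∀ᶠ N in atTop, CurvedPhase (ψ N) K l σ) (hψ₀ : CurvedPhase ψ₀ K l σ)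
    (hlim : ∀ η, Tendsto (fun N => ψ N η) atTop (𝓝 (ψ₀ η))) {F : ℝ → ℂ} (hF : ContDiff ℝ 1 F)
    (hFK : ∀ η, K ≤ |η| → F η = 0) :
    Tendsto (fun N => eLpNorm (fun p => oscIntegral (ψ N) F p - oscIntegral ψ₀ F p) 6 volume)
      atTop (𝓝 0) := by
  have hFsupp : HasCompactSupport F := HasCompactSupport.intro (isCompact_Icc (a := -K) (b := K))
    fun η hη => hFK η (by
      by_contra hlt
      rw [not_le, abs_lt] at hlt
      exact hη ⟨hlt.1.le, hlt.2.le⟩)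
  have hFi : Integrable F := hF.continuous.integrable_of_hasCompactSupport hFsupp
  have hF2 : MemLp F 2 volume := hF.continuous.memLp_of_hasCompactSupport hFsupp
  set A₁ := ∫ ξ, ‖F ξ‖ with hA₁
  set A₂ := (8 * ∫ η in (-K)..K, ‖deriv F η‖) ^ 4 / l ^ 2 with hA₂
  set c := 16 * (A₁ ^ 4 + A₂) with hc
  have hA₁0 : 0 ≤ A₁ := integral_nonneg fun _ => norm_nonneg _
  have hA₂0 : 0 ≤ A₂ := by
    rw [hA₂]
    exact div_nonneg (by positivity) (by positivity)
  set P := ENNReal.ofReal (2 * Real.pi) with hP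
  set E : ℝ → ℝ → ℝ → ℂ := fun N s ξ => F ξ * (Complex.exp (Complex.I * ((s * ψ N ξ : ℝ) : ℂ))
    - Complex.exp (Complex.I * ((s * ψ₀ ξ : ℝ) : ℂ))) with hE
  have hψ₀m := hψ₀.continuous.measurable
  have hEle : ∀ N s ξ, ‖E N s ξ‖ ≤ 2 * ‖F ξ‖ := fun N s ξ => by
    rw [hE, norm_mul, mul_comm]
    gcongr
    refine (norm_sub_le _ _).trans ?_
    rw [norm_exp_I_mul_ofReal, norm_exp_I_mul_ofReal]
    norm_num
  have hEle2 : ∀ N s ξ, ‖E N s ξ‖ₑ ^ 2 ≤ 4 * ‖F ξ‖ₑ ^ 2 := fun N s ξ => by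
    have h1 : ‖E N s ξ‖ₑ ≤ 2 * ‖F ξ‖ₑ := by
      rw [← ofReal_norm, ← ofReal_norm]
      refine (ENNReal.ofReal_le_ofReal (hEle N s ξ)).trans_eq ?_
      rw [ENNReal.ofReal_mul (by norm_num)]
      norm_num
    calc _ ≤ (2 * ‖F ξ‖ₑ) ^ 2 := by gcongr
      _ = _ := by rw [mul_pow]; norm_num
  have hFtop : ∫⁻ ξ, 4 * ‖F ξ‖ₑ ^ 2 ≠ ⊤ := by
    rw [lintegral_const_mul' _ _ (by norm_num), ← eLpNorm_two_sq]
    exact ENNReal.mul_ne_top (by norm_num) (ENNReal.pow_ne_top hF2.2.ne)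
  -- the bound on each time slice
  have hslice : ∀ᶠ N in atTop, ∀ s : ℝ,
      ∫⁻ y, ‖oscIntegral (ψ N) F (s, y) - oscIntegral ψ₀ F (s, y)‖ₑ ^ 6
        ≤ ENNReal.ofReal (c * (1 + s ^ 2)⁻¹) * (P * ∫⁻ ξ, ‖E N s ξ‖ₑ ^ 2) := by
    filter_upwards [hψ] with N hN s
    have hNm := hN.continuous.measurable
    -- Four of the six powers are absorbed by `c/(1 + s²)`, from the trivial bound and the decay;
    -- `16` is `8` from the fourth power of a difference, times two integrals.
    have hpt : ∀ y, ‖oscIntegral (ψ N) F (s, y) - oscIntegral ψ₀ F (s, y)‖ₑ ^ 6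
        ≤ ENNReal.ofReal (c * (1 + s ^ 2)⁻¹) *
          ‖oscIntegral (ψ N) F (s, y) - oscIntegral ψ₀ F (s, y)‖ₑ ^ 2 := fun y => by
      set a := oscIntegral (ψ N) F (s, y) with ha
      set b := oscIntegral ψ₀ F (s, y) with hb
      have ha1 : ‖a‖ ^ 4 ≤ A₁ ^ 4 :=
        pow_le_pow_left₀ (norm_nonneg _) (norm_oscIntegral_le _ _ _) 4
      have hb1 : ‖b‖ ^ 4 ≤ A₁ ^ 4 :=
        pow_le_pow_left₀ (norm_nonneg _) (norm_oscIntegral_le _ _ _) 4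
      have ha2 : s ^ 2 * ‖a‖ ^ 4 ≤ A₂ := hN.sq_mul_norm_oscIntegral_le hσ hK hl hF hFK (s, y)
      have hb2 : s ^ 2 * ‖b‖ ^ 4 ≤ A₂ := hψ₀.sq_mul_norm_oscIntegral_le hσ hK hl hF hFK (s, y)
      have hab : ‖a - b‖ ^ 4 ≤ 8 * (‖a‖ ^ 4 + ‖b‖ ^ 4) := by
        refine (pow_le_pow_left₀ (norm_nonneg _) (norm_sub_le a b) 4).trans ?_
        have := add_pow_le (norm_nonneg a) (norm_nonneg b) 4
        norm_num at this
        exact this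
      have h4 : ‖a - b‖ ^ 4 ≤ c * (1 + s ^ 2)⁻¹ := by
        rw [← div_eq_mul_inv, le_div_iff₀ (by positivity)]
        have := mul_le_mul_of_nonneg_right hab (by positivity : (0 : ℝ) ≤ 1 + s ^ 2)
        rw [hc]
        linarith
      have h6 : ‖a - b‖ₑ ^ 6 = ENNReal.ofReal (‖a - b‖ ^ 4) * ‖a - b‖ₑ ^ 2 := by
        rw [ENNReal.ofReal_pow (norm_nonneg _), ofReal_norm, ← pow_add]
      rw [h6]
      gcongr
    refine (lintegral_mono hpt).trans ?_
    rw [lintegral_const_mul' _ _ ENNReal.ofReal_ne_top]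
    gcongr
    simp_rw [oscIntegral_phase_sub hNm hψ₀m hFi]
    refine lintegral_enorm_sq_fourier_le ?_
    refine (hFi.norm.const_mul 2).mono' ?_ (Eventually.of_forall fun ξ => hEle N s ξ)
    have := hF.continuous.measurable
    exact Measurable.aestronglyMeasurable (by fun_prop)
  have hsm : ∀ᶠ N in atTop,
      StronglyMeasurable fun p => oscIntegral (ψ N) F p - oscIntegral ψ₀ F p := by
    filter_upwards [hψ] with N hN
    exact (stronglyMeasurable_oscIntegral hN.continuous.measurable hF.continuous.measurable).sub
      (stronglyMeasurable_oscIntegral hψ₀m hF.continuous.measurable)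
  -- Dominated convergence in `s` with majorant a multiple of `1/(1 + s²)`; on each slice Plancherel
  -- reduces the claim to dominated convergence in frequency.
  have hmain : Tendsto (fun N => ∫⁻ s, ∫⁻ y,
      ‖oscIntegral (ψ N) F (s, y) - oscIntegral ψ₀ F (s, y)‖ₑ ^ 6) atTop (𝓝 (∫⁻ _ : ℝ, 0)) := by
    refine tendsto_lintegral_filter_of_dominated_convergence
      (fun s => ENNReal.ofReal (c * (1 + s ^ 2)⁻¹) * (P * ∫⁻ ξ, 4 * ‖F ξ‖ₑ ^ 2)) ?_ ?_ ?_ ?_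
    · filter_upwards [hsm] with N hN
      exact (hN.measurable.enorm.pow_const 6).lintegral_prod_right'
    · filter_upwards [hslice] with N hN
      refine Eventually.of_forall fun s => (hN s).trans ?_
      gcongr
      exact hEle2 N s _
    · rw [lintegral_mul_const' _ _ (ENNReal.mul_ne_top ENNReal.ofReal_ne_top hFtop)]
      refine ENNReal.mul_ne_top ?_ (ENNReal.mul_ne_top ENNReal.ofReal_ne_top hFtop)
      have := (integrable_inv_one_add_sq.const_mul c).lintegral_lt_top
      exact this.ne
    · refine Eventually.of_forall fun s => ?_
      have hE0 : Tendsto (fun N => ∫⁻ ξ, ‖E N s ξ‖ₑ ^ 2) atTop (𝓝 (∫⁻ _ : ℝ, 0)) := by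
        refine tendsto_lintegral_filter_of_dominated_convergence (fun ξ => 4 * ‖F ξ‖ₑ ^ 2) ?_
          (Eventually.of_forall fun N => Eventually.of_forall fun ξ => hEle2 N s ξ) hFtop ?_
        · filter_upwards [hψ] with N hN
          have := hN.continuous.measurable
          have := hF.continuous.measurable
          fun_prop
        · refine Eventually.of_forall fun ξ => ?_
          have h1 : Tendsto (fun N => E N s ξ) atTop (𝓝 (F ξ *
              (Complex.exp (Complex.I * ((s * ψ₀ ξ : ℝ) : ℂ))
              - Complex.exp (Complex.I * ((s * ψ₀ ξ : ℝ) : ℂ))))) := by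
            have hcont : Continuous fun x : ℝ => F ξ * (Complex.exp (Complex.I * ((s * x : ℝ) : ℂ))
              - Complex.exp (Complex.I * ((s * ψ₀ ξ : ℝ) : ℂ))) := by fun_prop
            exact (hcont.tendsto (ψ₀ ξ)).comp (hlim ξ)
          rw [sub_self, mul_zero] at h1
          have h2 := ENNReal.Tendsto.pow (n := 2) h1.enorm
          simpa using h2
      rw [lintegral_zero] at hE0
      have hub : Tendsto (fun N => ENNReal.ofReal (c * (1 + s ^ 2)⁻¹) *
          (P * ∫⁻ ξ, ‖E N s ξ‖ₑ ^ 2)) atTop (𝓝 0) := by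
        have := ENNReal.Tendsto.const_mul (a := ENNReal.ofReal (c * (1 + s ^ 2)⁻¹))
          (ENNReal.Tendsto.const_mul (a := P) hE0 (Or.inr ENNReal.ofReal_ne_top))
          (Or.inr ENNReal.ofReal_ne_top)
        simpa using this
      exact tendsto_of_tendsto_of_tendsto_of_le_of_le' tendsto_const_nhds hub
        (Eventually.of_forall fun _ => zero_le) (hslice.mono fun N hN => hN s)
  rw [lintegral_zero] at hmain
  have h6 := (ENNReal.continuous_rpow_const (y := 1 / 6)).continuousAt.tendsto.comp hmain
  rw [ENNReal.zero_rpow_of_pos (by norm_num)] at h6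
  refine h6.congr' ?_
  filter_upwards [hsm] with N hN
  have e := eLpNorm_six_pow (μ := (volume : Measure (ℝ × ℝ)))
    (fun p => oscIntegral (ψ N) F p - oscIntegral ψ₀ F p)
  rw [Measure.volume_eq_prod, lintegral_prod _ (hN.measurable.enorm.pow_const 6).aemeasurable] at e
  simp only [Function.comp_apply]
  rw [← e, ← ENNReal.rpow_natCast, ← ENNReal.rpow_mul, ← Measure.volume_eq_prod]
  norm_num

/-! ### The Galilean boost and the rescaled phase. -/

/-- The Galilean change of variables `(s, y) ↦ (t, x)` adapted to the frequencies `±N`. -/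
def boostMap (N : ℝ) (p : ℝ × ℝ) : ℝ × ℝ :=
  (-(10 * N ^ 3)⁻¹ * p.1, p.2 + (3 * N ^ 2 + 5 * N ^ 4) * (10 * N ^ 3)⁻¹ * p.1)

/-- The phase of the carrier wave in the coordinates of `boostMap`. -/
def carrierPhase (N : ℝ) (p : ℝ × ℝ) : ℝ := N * p.2 + (1 + 2 * N ^ 2) / 5 * p.1

/-- The rescaled phase `phase35` around the frequency `N`, without its affine part. -/
def profilePhase (N η : ℝ) : ℝ :=
  -(phase35 (N + η) - phase35 N - (3 * N ^ 2 + 5 * N ^ 4) * η) * (10 * N ^ 3)⁻¹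

theorem measurable_boostMap (N : ℝ) : Measurable (boostMap N) := by
  unfold boostMap; fun_prop

theorem map_boostMap {N : ℝ} (hN : 0 < N) : Measure.map (boostMap N) volume
    = ENNReal.ofReal (10 * N ^ 3) • (volume : Measure (ℝ × ℝ)) := by
  ext A hA
  have hind : Measurable (A.indicator (1 : ℝ × ℝ → ℝ≥0∞)) := measurable_one.indicator hA
  have hb := measurable_boostMap N
  rw [Measure.map_apply hb hA, Measure.smul_apply, smul_eq_mul, ← lintegral_indicator_one hA,
    ← lintegral_indicator_one (hb hA)]
  have e : ∀ p, ((boostMap N) ⁻¹' A).indicator (1 : ℝ × ℝ → ℝ≥0∞) p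
      = A.indicator (1 : ℝ × ℝ → ℝ≥0∞) (boostMap N p) := fun p => rfl
  simp_rw [e]
  rw [Measure.volume_eq_prod, lintegral_prod (fun p => A.indicator (1 : ℝ × ℝ → ℝ≥0∞) (boostMap N p))
      (hind.comp hb).aemeasurable,
    lintegral_prod _ hind.aemeasurable]
  -- The shear disappears by translation invariance in `y`, leaving a dilation in time.
  have e2 : ∀ s : ℝ, ∫⁻ y, A.indicator (1 : ℝ × ℝ → ℝ≥0∞) (boostMap N (s, y))
      = ∫⁻ y, A.indicator (1 : ℝ × ℝ → ℝ≥0∞) (-(10 * N ^ 3)⁻¹ * s, y) := fun s =>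
    lintegral_add_right_eq_self
      (fun y => A.indicator (1 : ℝ × ℝ → ℝ≥0∞) (-(10 * N ^ 3)⁻¹ * s, y))
      ((3 * N ^ 2 + 5 * N ^ 4) * (10 * N ^ 3)⁻¹ * s)
  simp_rw [e2]
  rw [lintegral_comp_mul_left_real (by simp [hN.ne'])
    (fun t => ∫⁻ y, A.indicator (1 : ℝ × ℝ → ℝ≥0∞) (t, y)), inv_neg, inv_inv, abs_neg,
    abs_of_pos (by positivity)]

theorem quasiMeasurePreserving_boostMap {N : ℝ} (hN : 0 < N) :
    Measure.QuasiMeasurePreserving (boostMap N) volume volume :=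
  ⟨measurable_boostMap N, by
    rw [map_boostMap hN]; exact Measure.smul_absolutelyContinuous⟩

theorem eLpNorm_comp_boostMap {N : ℝ} (hN : 0 < N) {f : ℝ × ℝ → ℂ}
    (hf : AEStronglyMeasurable f volume) :
    eLpNorm (f ∘ boostMap N) 6 volume
      = ENNReal.ofReal ((10 * N ^ 3) ^ (1 / 6 : ℝ)) * eLpNorm f 6 volume := by
  have hf' : AEStronglyMeasurable f (Measure.map (boostMap N) volume) := by
    rw [map_boostMap hN]
    exact hf.mono_ac Measure.smul_absolutelyContinuous
  rw [← eLpNorm_map_measure hf' (measurable_boostMap N).aemeasurable, map_boostMap hN,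
    eLpNorm_smul_measure_of_ne_top (by norm_num), smul_eq_mul,
    ENNReal.ofReal_rpow_of_pos (by positivity)]
  norm_num

/-- A polynomial in `N⁻¹`, so the limit is evaluation at `N⁻¹ = 0`. -/
theorem profilePhase_eq {N : ℝ} (hN : N ≠ 0) (η : ℝ) : profilePhase N η
    = -((3 / 10 * N⁻¹ ^ 2 + 1) * η ^ 2 + (1 / 10 * N⁻¹ ^ 3 + N⁻¹) * η ^ 3
      + 1 / 2 * N⁻¹ ^ 2 * η ^ 4 + 1 / 10 * N⁻¹ ^ 3 * η ^ 5) := by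
  simp only [profilePhase, phase35]
  field_simp
  ring

theorem tendsto_profilePhase (η : ℝ) :
    Tendsto (fun N => profilePhase N η) atTop (𝓝 (-η ^ 2)) := by
  have h : Continuous fun z : ℝ => -((3 / 10 * z ^ 2 + 1) * η ^ 2 + (1 / 10 * z ^ 3 + z) * η ^ 3
      + 1 / 2 * z ^ 2 * η ^ 4 + 1 / 10 * z ^ 3 * η ^ 5) := by fun_prop
  have h1 := (h.tendsto 0).comp tendsto_inv_atTop_zero
  have h2 : Tendsto (fun N => profilePhase N η) atTop (𝓝 _) :=
    h1.congr' (by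
      filter_upwards [eventually_ne_atTop 0] with N hN
      exact (profilePhase_eq hN η).symm)
  simpa using h2

theorem hasDerivAt_profilePhase (N η : ℝ) : HasDerivAt (profilePhase N)
    (-(3 * (N + η) ^ 2 + 5 * (N + η) ^ 4 - (3 * N ^ 2 + 5 * N ^ 4)) * (10 * N ^ 3)⁻¹) η := by
  have h1 : HasDerivAt (fun η => phase35 (N + η)) (3 * (N + η) ^ 2 + 5 * (N + η) ^ 4) η :=
    (hasDerivAt_phase35 (N + η)).comp_const_add N η
  have h2 : HasDerivAt (fun η => (3 * N ^ 2 + 5 * N ^ 4) * η) (3 * N ^ 2 + 5 * N ^ 4) η := by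
    simpa using (hasDerivAt_id η).const_mul (3 * N ^ 2 + 5 * N ^ 4)
  exact (((h1.sub_const _).sub h2).neg).mul_const _

theorem hasDerivAt_deriv_profilePhase (N η : ℝ) : HasDerivAt (fun η =>
      -(3 * (N + η) ^ 2 + 5 * (N + η) ^ 4 - (3 * N ^ 2 + 5 * N ^ 4)) * (10 * N ^ 3)⁻¹)
    (-(6 * (N + η) + 20 * (N + η) ^ 3) * (10 * N ^ 3)⁻¹) η := by
  have h0 : HasDerivAt (fun η => N + η) 1 η := (hasDerivAt_id η).const_add N
  have h1 := (((((h0.pow 2).const_mul 3).add ((h0.pow 4).const_mul 5)).sub_const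
    (3 * N ^ 2 + 5 * N ^ 4)).neg).mul_const (10 * N ^ 3)⁻¹
  refine h1.congr_deriv ?_
  push_cast
  ring

/-- For `|η| ≤ K ≤ N/2` one has `N + η ≥ N/2`, and `20 (N/2)³ / (10 N³) = 1/4`. The bound does not
depend on `N`, which makes the decay uniform. -/
theorem quarter_le_deriv2_profilePhase {N K η : ℝ} (hN : 0 < N) (hNK : 2 * K ≤ N)
    (hη : η ∈ Set.Icc (-K) K) :
    1 / 4 ≤ (6 * (N + η) + 20 * (N + η) ^ 3) * (10 * N ^ 3)⁻¹ := by
  rw [← div_eq_mul_inv, le_div_iff₀ (by positivity)]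
  have h1 : N / 2 ≤ N + η := by linarith [hη.1]
  have h2 : (N / 2) ^ 3 ≤ (N + η) ^ 3 := pow_le_pow_left₀ (by positivity) h1 3
  nlinarith

theorem curvedPhase_profilePhase {N K : ℝ} (hN : 0 < N) (hNK : 2 * K ≤ N) :
    CurvedPhase (profilePhase N) K (1 / 4) (-1) :=
  ⟨_, _, hasDerivAt_profilePhase N, hasDerivAt_deriv_profilePhase N, by fun_prop, fun η hη => by
    have := quarter_le_deriv2_profilePhase hN hNK hη
    linarith⟩

theorem CurvedPhase.reflect {ψ : ℝ → ℝ} {K l : ℝ} (h : CurvedPhase ψ K l (-1)) :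
    CurvedPhase (fun η => -ψ (-η)) K l 1 := by
  obtain ⟨ψ', ψ'', h1, h2, h3, h4⟩ := h.exists_deriv
  refine ⟨fun η => ψ' (-η), fun η => -ψ'' (-η), fun η => ?_, fun η => ?_, ?_, fun η hη => ?_⟩
  · simpa using! ((h1 (-η)).comp η (hasDerivAt_neg η)).neg
  · simpa using! (h2 (-η)).comp η (hasDerivAt_neg η)
  · exact (h3.comp continuous_neg).neg
  · have := h4 (-η) ⟨by linarith [hη.2], by linarith [hη.1]⟩
    linarith

theorem curvedPhase_schrodinger (K : ℝ) : CurvedPhase schrodingerPhase K (1 / 4) (-1) :=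
  ⟨fun ξ => -(2 * ξ), fun _ => -2, hasDerivAt_schrodingerPhase, fun η => by
    simpa using! ((hasDerivAt_id η).const_mul (2 : ℝ)).neg, continuous_const, fun η _ => by
    norm_num⟩

theorem oscIntegral_shift (φ : ℝ → ℝ) (F : ℝ → ℂ) (M : ℝ) (p : ℝ × ℝ) :
    oscIntegral φ (fun ξ => F (ξ - M)) p
      = ∫ η, F η * Complex.exp (Complex.I * ((p.2 * (η + M) + p.1 * φ (η + M) : ℝ) : ℂ)) := by
  rw [oscIntegral, ← integral_add_right_eq_self _ M]
  simp

theorem oscIntegral_phase35_boost {N : ℝ} (hN : 0 < N) (F : ℝ → ℂ) (p : ℝ × ℝ) :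
    oscIntegral phase35 (fun ξ => F (ξ - N)) (boostMap N p)
      = Complex.exp (Complex.I * (carrierPhase N p : ℂ)) * oscIntegral (profilePhase N) F p := by
  rw [oscIntegral_shift, oscIntegral, ← integral_const_mul]
  congr 1
  ext η
  rw [mul_left_comm, ← Complex.exp_add, ← mul_add, ← Complex.ofReal_add]
  congr 4
  simp only [boostMap, carrierPhase, profilePhase, phase35]
  field_simp
  ring

/-- Because `phase35` is odd, the same boost straightens the frequency `-N`, with opposite carrier
and reflected, negated profile phase. -/
theorem oscIntegral_phase35_boost_neg {N : ℝ} (hN : 0 < N) (F : ℝ → ℂ) (p : ℝ × ℝ) :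
    oscIntegral phase35 (fun ξ => F (ξ + N)) (boostMap N p)
      = Complex.exp (Complex.I * ((-carrierPhase N p : ℝ) : ℂ)) *
        oscIntegral (fun η => -profilePhase N (-η)) F p := by
  have h := oscIntegral_shift phase35 F (-N) (boostMap N p)
  simp only [sub_neg_eq_add] at h
  rw [h, oscIntegral, ← integral_const_mul]
  congr 1
  ext η
  rw [mul_left_comm, ← Complex.exp_add, ← mul_add, ← Complex.ofReal_add]
  congr 4
  simp only [boostMap, carrierPhase, profilePhase, phase35]
  field_simp
  ring

theorem oscIntegral_reflect (φ : ℝ → ℝ) (F : ℝ → ℂ) (p : ℝ × ℝ) :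
    oscIntegral (fun η => -φ η) F p = oscIntegral φ F (-p.1, p.2) := by
  simp only [oscIntegral]
  congr 1
  ext η
  simp

/-! ### Asymptotics of the weight. -/

/-- `√N / m(N + η)` for the weight `m = weight35`. -/
def weightRatio (N η : ℝ) : ℝ := Real.sqrt N / weight35 (N + η)

theorem sqrt_pow_six {N : ℝ} (hN : 0 ≤ N) : Real.sqrt N ^ 6 = N ^ 3 := by
  have : Real.sqrt N ^ 6 = (Real.sqrt N ^ 2) ^ 3 := by ring
  rw [this, Real.sq_sqrt hN]

theorem weightRatio_nonneg (N η : ℝ) : 0 ≤ weightRatio N η :=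
  div_nonneg (Real.sqrt_nonneg _) (weight35_nonneg _)

/-- `N + η ≥ N/2` gives weight to the sixth at least `N³/8`, so the sixth power of the ratio is at
most `8`. -/
theorem weightRatio_le_two {N η : ℝ} (hN : 0 < N) (hη : -(N / 2) ≤ η) : weightRatio N η ≤ 2 := by
  have h1 : N / 2 ≤ N + η := by linarith
  have h2 : (N / 2) ^ 3 ≤ (N + η) ^ 3 := pow_le_pow_left₀ (by positivity) h1 3
  have h0 : 0 < N + η := by linarith
  have hw6 : weight35 (N + η) ^ 6 = N + η + (N + η) ^ 3 := by
    rw [weight35_pow_six, abs_of_pos (by positivity)]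
  have hpos : 0 < weight35 (N + η) := by
    refine lt_of_le_of_ne (weight35_nonneg _) fun h => ?_
    rw [← h] at hw6
    have : 0 < N + η + (N + η) ^ 3 := by positivity
    simp only [ne_eq, OfNat.ofNat_ne_zero, not_false_eq_true, zero_pow] at hw6
    linarith
  rw [weightRatio, div_le_iff₀ hpos]
  refine le_of_pow_le_pow_left₀ (n := 6) (by norm_num) (by positivity) ?_
  rw [sqrt_pow_six hN.le, mul_pow, hw6]
  nlinarith [pow_pos hN 3]

theorem tendsto_weightRatio (η : ℝ) : Tendsto (fun N => weightRatio N η) atTop (𝓝 1) := by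
  have hc : Continuous fun z : ℝ => |(1 + η * z) * z ^ 2 + (1 + η * z) ^ 3| ^ (1 / 6 : ℝ) :=
    Continuous.rpow_const (by fun_prop) fun _ => Or.inr (by norm_num)
  have h1 := ((hc.tendsto 0).comp tendsto_inv_atTop_zero).inv₀ (by norm_num)
  have h2 : Tendsto (fun N => weightRatio N η) atTop (𝓝 _) := h1.congr' (by
    filter_upwards [eventually_gt_atTop 0] with N hN
    simp only [Function.comp_apply]
    have e : N + η + (N + η) ^ 3 = N ^ 3 * ((1 + η * N⁻¹) * N⁻¹ ^ 2 + (1 + η * N⁻¹) ^ 3) := by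
      field_simp
    have e2 : (N ^ 3) ^ (1 / 6 : ℝ) = Real.sqrt N := by
      rw [← sqrt_pow_six hN.le, ← Real.rpow_natCast, ← Real.rpow_mul (Real.sqrt_nonneg _)]
      norm_num
    have hs : Real.sqrt N ≠ 0 := (Real.sqrt_pos.2 hN).ne'
    rw [weightRatio, weight35, e, abs_mul, Real.mul_rpow (abs_nonneg _) (abs_nonneg _),
      abs_of_pos (by positivity : 0 < N ^ 3), e2]
    field_simp)
  simpa using h2

/-! ### Reduction to two Schrödinger waves with opposite carriers. -/

/-- `e^{iθ} A + e^{-iθ} B` with the carrier phase `θ`. -/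
def wavePair (N : ℝ) (A B : ℝ × ℝ → ℂ) (p : ℝ × ℝ) : ℂ :=
  Complex.exp (Complex.I * (carrierPhase N p : ℂ)) * A p +
    Complex.exp (Complex.I * ((-carrierPhase N p : ℝ) : ℂ)) * B p

theorem continuous_carrierPhase (N : ℝ) : Continuous (carrierPhase N) := by
  unfold carrierPhase; fun_prop

theorem aestronglyMeasurable_exp_mul {θ : ℝ × ℝ → ℝ} (hθ : Continuous θ) {A : ℝ × ℝ → ℂ}
    (hA : AEStronglyMeasurable A volume) :
    AEStronglyMeasurable (fun p => Complex.exp (Complex.I * (θ p : ℂ)) * A p) volume :=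
  (Continuous.aestronglyMeasurable (by fun_prop)).mul hA

theorem eLpNorm_exp_mul (θ : ℝ × ℝ → ℝ) (A : ℝ × ℝ → ℂ) :
    eLpNorm (fun p => Complex.exp (Complex.I * (θ p : ℂ)) * A p) 6 volume
      = eLpNorm A 6 volume :=
  eLpNorm_congr_norm_ae (Eventually.of_forall fun p => by
    rw [norm_mul, norm_exp_I_mul_ofReal, one_mul])

theorem aestronglyMeasurable_wavePair (N : ℝ) {A B : ℝ × ℝ → ℂ}
    (hA : AEStronglyMeasurable A volume) (hB : AEStronglyMeasurable B volume) :
    AEStronglyMeasurable (wavePair N A B) volume :=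
  (aestronglyMeasurable_exp_mul (continuous_carrierPhase N) hA).add
    (aestronglyMeasurable_exp_mul (continuous_carrierPhase N).neg hB)

theorem eLpNorm_wavePair_le (N : ℝ) {A B : ℝ × ℝ → ℂ} (hA : AEStronglyMeasurable A volume)
    (hB : AEStronglyMeasurable B volume) :
    eLpNorm (wavePair N A B) 6 volume ≤ eLpNorm A 6 volume + eLpNorm B 6 volume := by
  refine (eLpNorm_add_le (aestronglyMeasurable_exp_mul (continuous_carrierPhase N) hA)
    (aestronglyMeasurable_exp_mul (continuous_carrierPhase N).neg hB) (by norm_num)).trans ?_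
  exact (congrArg₂ (· + ·) (eLpNorm_exp_mul (carrierPhase N) A)
    (eLpNorm_exp_mul (fun p => -carrierPhase N p) B)).le

theorem measurePreserving_timeReflect :
    MeasurePreserving (fun p : ℝ × ℝ => (-p.1, p.2)) volume volume :=
  (Measure.measurePreserving_neg (volume : Measure ℝ)).prod (MeasurePreserving.id volume)

theorem eLpNorm_timeReflect {u : ℝ × ℝ → ℂ} (hu : AEStronglyMeasurable u volume) :
    eLpNorm (fun p : ℝ × ℝ => u (-p.1, p.2)) 6 volume = eLpNorm u 6 volume :=
  eLpNorm_comp_measurePreserving hu measurePreserving_timeReflect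

theorem tendsto_zero_of_forall_le_add {D : ℝ → ℝ≥0∞} {C : ℝ≥0∞} (hC : C ≠ ⊤)
    (h : ∀ ε : ℝ, 0 < ε → ∃ r : ℝ → ℝ≥0∞, Tendsto r atTop (𝓝 0) ∧
      ∀ᶠ N in atTop, D N ≤ C * ENNReal.ofReal ε + r N) : Tendsto D atTop (𝓝 0) := by
  rw [ENNReal.tendsto_nhds_zero]
  intro ε hε
  rcases eq_or_ne ε ⊤ with rfl | hεt
  · exact Eventually.of_forall fun _ => le_top
  have hε' : 0 < ε.toReal := ENNReal.toReal_pos hε.ne' hεt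
  set δ := ε.toReal / (2 * (C.toReal + 1)) with hδ
  have hδ0 : 0 < δ := by positivity
  obtain ⟨r, hr, hD⟩ := h δ hδ0
  have hr' := (ENNReal.tendsto_nhds_zero.1 hr) (ε / 2) (ENNReal.half_pos hε.ne')
  filter_upwards [hr', hD] with N h1 h2
  refine h2.trans ?_
  calc C * ENNReal.ofReal δ + r N ≤ ε / 2 + ε / 2 := by
        gcongr
        rw [← ENNReal.ofReal_toReal hC, ← ENNReal.ofReal_mul ENNReal.toReal_nonneg,
          ← ENNReal.ofReal_toReal hεt, ← ENNReal.ofReal_ofNat 2,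
          ← ENNReal.ofReal_div_of_pos (by norm_num)]
        refine ENNReal.ofReal_le_ofReal ?_
        rw [hδ, mul_div_assoc', div_le_div_iff₀ (by positivity) (by norm_num)]
        nlinarith [ENNReal.toReal_nonneg (a := C)]
    _ = ε := ENNReal.add_halves ε

theorem tendsto_eLpNorm_mul_one_sub_weightRatio {F : ℝ → ℂ} (hF : Continuous F) {K σ : ℝ}
    (hσ : σ = 1 ∨ σ = -1) (hFK : ∀ η, K ≤ |η| → F η = 0) :
    Tendsto (fun N => eLpNorm (fun η => F η * (1 - (weightRatio N (σ * η) : ℂ))) 2 volume)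
      atTop (𝓝 0) := by
  have hFsupp : HasCompactSupport F := HasCompactSupport.intro (isCompact_Icc (a := -K) (b := K))
    fun η hη => hFK η (by
      by_contra hlt
      rw [not_le, abs_lt] at hlt
      exact hη ⟨hlt.1.le, hlt.2.le⟩)
  have hF2 : MemLp F 2 volume := hF.memLp_of_hasCompactSupport hFsupp
  have hw := continuous_weight35.measurable
  have hm : ∀ N, Measurable fun η => F η * (1 - (weightRatio N (σ * η) : ℂ)) := fun N => by
    have h1 : Measurable fun η => weightRatio N (σ * η) := by
      unfold weightRatio
      exact measurable_const.div (hw.comp (by fun_prop))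
    have := hF.measurable
    fun_prop
  have hlim : Tendsto (fun N => ∫⁻ η, ‖F η * (1 - (weightRatio N (σ * η) : ℂ))‖ₑ ^ 2) atTop
      (𝓝 (∫⁻ _ : ℝ, 0)) := by
    refine tendsto_lintegral_filter_of_dominated_convergence (fun η => ‖F η‖ₑ ^ 2)
      (Eventually.of_forall fun N => (hm N).enorm.pow_const 2) ?_ ?_ ?_
    · filter_upwards [eventually_ge_atTop (2 * |K|), eventually_gt_atTop 0] with N hN hN0
      refine Eventually.of_forall fun η => ?_
      rcases le_total K |η| with h | h
      · simp [hFK η h]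
      · gcongr
        rw [enorm_mul]
        refine mul_le_of_le_one_right' ?_
        have hση : -(N / 2) ≤ σ * η := by
          have h1 : |σ * η| ≤ |K| := by
            rw [abs_mul]
            have : |σ| = 1 := by rcases hσ with rfl | rfl <;> norm_num
            rw [this, one_mul]
            exact h.trans (le_abs_self K)
          linarith [(abs_le.1 h1).1]
        have h2 := weightRatio_le_two hN0 hση
        have h3 := weightRatio_nonneg N (σ * η)
        -- A ratio between `0` and `2` is within `1` of `1`, so `|F|²` dominates.
        have : ‖(1 - (weightRatio N (σ * η) : ℂ))‖ ≤ 1 := by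
          rw [← Complex.ofReal_one, ← Complex.ofReal_sub, Complex.norm_real, Real.norm_eq_abs,
            abs_le]
          constructor <;> linarith
        rw [← ofReal_norm]
        exact ENNReal.ofReal_le_one.2 this
    · rw [← eLpNorm_two_sq]
      exact ENNReal.pow_ne_top hF2.2.ne
    · refine Eventually.of_forall fun η => ?_
      have h1 : Tendsto (fun N => F η * (1 - (weightRatio N (σ * η) : ℂ))) atTop
          (𝓝 (F η * (1 - ((1 : ℝ) : ℂ)))) :=
        tendsto_const_nhds.mul (tendsto_const_nhds.sub
          ((Complex.continuous_ofReal.tendsto 1).comp (tendsto_weightRatio (σ * η))))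
      rw [Complex.ofReal_one, sub_self, mul_zero] at h1
      simpa using ENNReal.Tendsto.pow (n := 2) h1.enorm
  rw [lintegral_zero] at hlim
  have h2 := (ENNReal.continuous_rpow_const (y := 1 / 2)).continuousAt.tendsto.comp hlim
  rw [ENNReal.zero_rpow_of_pos (by norm_num)] at h2
  refine h2.congr fun N => ?_
  simp only [Function.comp_apply]
  rw [← eLpNorm_two_sq, ← ENNReal.rpow_natCast, ← ENNReal.rpow_mul]
  norm_num

theorem weight35_neg (ξ : ℝ) : weight35 (-ξ) = weight35 ξ := by
  have : -ξ + (-ξ) ^ 3 = -(ξ + ξ ^ 3) := by ring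
  rw [weight35, weight35, this, abs_neg]

theorem eLpNorm_comp_add_right_real (f : ℝ → ℂ) (hf : AEStronglyMeasurable f volume) (c : ℝ) :
    eLpNorm (f ∘ fun ξ => ξ + c) 2 volume = eLpNorm f 2 volume :=
  eLpNorm_comp_measurePreserving hf (measurePreserving_add_right volume c)

/-- The amplitude whose weighted extension carries the profiles `F₁`, `F₂` at frequencies `±N`. -/
def profileAmplitude (F₁ F₂ : ℝ → ℂ) (N ξ : ℝ) : ℂ :=
  (Real.sqrt N / weight35 ξ : ℝ) * (F₁ (ξ - N) + F₂ (ξ + N))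

/-- The weight error is measured in `L²` on the data: translating each profile back to the origin
replaces the factor `√N / weight35` by `weightRatio`, which tends to `1`. At `-N` evenness of the
weight brings in `-η`. -/
theorem eLpNorm_fourierHat_twoProfile_sub_le (g₁ g₂ : L2R) {F₁ F₂ : ℝ → ℂ} (h₁ : Measurable F₁)
    (h₂ : Measurable F₂) (N : ℝ) :
    eLpNorm (fun ξ => fourierHat (twoProfile g₁ g₂ N) ξ - profileAmplitude F₁ F₂ N ξ) 2 volume
      ≤ (eLpNorm (fun η => fourierHat g₁ η - F₁ η) 2 volume
          + eLpNorm (fun η => F₁ η * (1 - (weightRatio N (1 * η) : ℂ))) 2 volume)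
        + (eLpNorm (fun η => fourierHat g₂ η - F₂ η) 2 volume
          + eLpNorm (fun η => F₂ η * (1 - (weightRatio N (-1 * η) : ℂ))) 2 volume) := by
  have hw : ∀ σ : ℝ, Measurable fun η => (weightRatio N (σ * η) : ℂ) := fun σ => by
    refine Complex.measurable_ofReal.comp ?_
    unfold weightRatio
    exact measurable_const.div (continuous_weight35.measurable.comp (by fun_prop))
  have hg₁ := measurable_fourierHat g₁
  have hg₂ := measurable_fourierHat g₂
  have m₁ : Measurable fun η => fourierHat g₁ η - F₁ η := hg₁.sub h₁
  have m₂ : Measurable fun η => fourierHat g₂ η - F₂ η := hg₂.sub h₂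
  have n₁ : Measurable fun η => F₁ η * (1 - (weightRatio N (1 * η) : ℂ)) :=
    h₁.mul (measurable_const.sub (hw 1))
  have n₂ : Measurable fun η => F₂ η * (1 - (weightRatio N (-1 * η) : ℂ)) :=
    h₂.mul (measurable_const.sub (hw (-1)))
  set G₁ : ℝ → ℂ := fun η => (fourierHat g₁ η - F₁ η) + F₁ η * (1 - (weightRatio N (1 * η) : ℂ))
    with hG₁
  set G₂ : ℝ → ℂ := fun η => (fourierHat g₂ η - F₂ η) + F₂ η * (1 - (weightRatio N (-1 * η) : ℂ))
    with hG₂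
  have k₁ : Measurable G₁ := m₁.add n₁
  have k₂ : Measurable G₂ := m₂.add n₂
  have hae : (fun ξ => fourierHat (twoProfile g₁ g₂ N) ξ - profileAmplitude F₁ F₂ N ξ)
      =ᵐ[volume] (fun ξ => G₁ (ξ + -N)) + fun ξ => G₂ (ξ + N) := by
    filter_upwards [fourierHat_twoProfile_ae_eq g₁ g₂ N] with ξ hξ
    have r₁ : weightRatio N (1 * (ξ - N)) = Real.sqrt N / weight35 ξ := by
      rw [weightRatio]; congr 2; ring
    have r₂ : weightRatio N (-1 * (ξ + N)) = Real.sqrt N / weight35 ξ := by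
      rw [weightRatio, ← weight35_neg ξ]; congr 2; ring
    simp only [hξ, Pi.add_apply, hG₁, hG₂, r₁, r₂, profileAmplitude, ← sub_eq_add_neg]
    ring
  rw [eLpNorm_congr_ae hae]
  refine (eLpNorm_add_le (k₁.comp (by fun_prop)).aestronglyMeasurable
    (k₂.comp (by fun_prop)).aestronglyMeasurable (by norm_num)).trans ?_
  rw [eLpNorm_comp_add_right_real G₁ k₁.aestronglyMeasurable,
    eLpNorm_comp_add_right_real G₂ k₂.aestronglyMeasurable]
  exact add_le_add
    (eLpNorm_add_le m₁.aestronglyMeasurable n₁.aestronglyMeasurable (by norm_num))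
    (eLpNorm_add_le m₂.aestronglyMeasurable n₂.aestronglyMeasurable (by norm_num))

/-- The amplitude divides out the weight exactly, so the oscillatory integrals below are weightless.
At `ξ = 0`, where the division is void, both profiles vanish because `K ≤ N`. -/
theorem weight35_mul_profileAmplitude {F₁ F₂ : ℝ → ℂ} {K N : ℝ} (hN : K ≤ N)
    (h₁ : ∀ η, K ≤ |η| → F₁ η = 0) (h₂ : ∀ η, K ≤ |η| → F₂ η = 0) (ξ : ℝ) :
    (weight35 ξ : ℂ) * profileAmplitude F₁ F₂ N ξ
      = (Real.sqrt N : ℂ) * (F₁ (ξ - N) + F₂ (ξ + N)) := by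
  rcases eq_or_ne ξ 0 with rfl | hξ
  · have hN' : K ≤ |N| := hN.trans (le_abs_self N)
    rw [zero_sub, zero_add, h₁ (-N) (by rwa [abs_neg]), h₂ N hN']
    simp [weight35]
  · have hw : weight35 ξ ≠ 0 := fun h => by
      have h6 := weight35_pow_six ξ
      rw [h] at h6
      have h0 : ξ + ξ ^ 3 = 0 := by
        simpa using h6.symm
      have : ξ * (1 + ξ ^ 2) = 0 := by linear_combination h0
      rcases mul_eq_zero.1 this with h | h
      · exact hξ h
      · nlinarith [sq_nonneg ξ]
    have hwc : (weight35 ξ : ℂ) ≠ 0 := by exact_mod_cast hw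
    rw [profileAmplitude]
    push_cast
    field_simp

theorem continuous_schrodingerWeight : Continuous schrodingerWeight := continuous_const

theorem measurable_schrodingerPhase : Measurable schrodingerPhase := by
  unfold schrodingerPhase; fun_prop

theorem isExtension_schrodinger (g : L2R) :
    IsExtension schrodingerWeight schrodingerPhase g (schrodinger g) := by
  obtain ⟨C, hC⟩ := exists_hasExtensionBound_schrodinger
  exact isExtension_extension hC continuous_schrodingerWeight measurable_schrodingerPhase g

theorem isExtension_extension35 (f : L2R) : IsExtension weight35 phase35 f (extension35 f) := by
  obtain ⟨C, hC⟩ := exists_hasExtensionBound_weight35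
  exact isExtension_extension hC continuous_weight35 measurable_phase35 f

/-- `(t, x) ↦ e^{-itΔ} g (x)`. -/
def schrodingerBackward (g : L2R) (p : ℝ × ℝ) : ℂ := schrodinger g (-p.1, p.2)

theorem memLp_schrodinger (g : L2R) : MemLp (schrodinger g) 6 volume :=
  (isExtension_schrodinger g).1

theorem memLp_schrodingerBackward (g : L2R) : MemLp (schrodingerBackward g) 6 volume :=
  (memLp_schrodinger g).comp_measurePreserving measurePreserving_timeReflect

theorem eLpNorm_schrodinger_sub_le {C : ℝ≥0∞}
    (hC : HasExtensionBound schrodingerWeight schrodingerPhase C) (g : L2R) {F : ℝ → ℂ}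
    (hF : Measurable F) (hFi : Integrable F) :
    eLpNorm (fun p => schrodinger g p - (1 / (2 * Real.pi) : ℂ) *
        oscIntegral schrodingerPhase F p) 6 volume
      ≤ C * eLpNorm (fun ξ => fourierHat g ξ - F ξ) 2 volume := by
  have e : (fun ξ => (schrodingerWeight ξ : ℂ) * F ξ) = F := by
    ext ξ; simp [schrodingerWeight]
  have h := (isExtension_schrodinger g).eLpNorm_sub_oscIntegral_le hC continuous_schrodingerWeight
    measurable_schrodingerPhase hF (by rwa [e])
  rwa [e] at h

theorem schrodingerPhase_reflect :
    (fun η => -schrodingerPhase (-η)) = fun η => -schrodingerPhase η := by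
  ext η; simp [schrodingerPhase]

/-- The Schrödinger phase is even, so the reflected, negated phase is just its negative, which
amounts to reversing time. -/
theorem eLpNorm_schrodingerBackward_sub_le {C : ℝ≥0∞}
    (hC : HasExtensionBound schrodingerWeight schrodingerPhase C) (g : L2R) {F : ℝ → ℂ}
    (hF : Measurable F) (hFi : Integrable F) :
    eLpNorm (fun p => schrodingerBackward g p - (1 / (2 * Real.pi) : ℂ) *
        oscIntegral (fun η => -schrodingerPhase (-η)) F p) 6 volume
      ≤ C * eLpNorm (fun ξ => fourierHat g ξ - F ξ) 2 volume := by
  refine le_trans (le_of_eq ?_) (eLpNorm_schrodinger_sub_le hC g hF hFi)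
  have hm : AEStronglyMeasurable (fun p => schrodinger g p - (1 / (2 * Real.pi) : ℂ) *
        oscIntegral schrodingerPhase F p) volume :=
    (memLp_schrodinger g).1.sub (stronglyMeasurable_const.mul
      (stronglyMeasurable_oscIntegral measurable_schrodingerPhase hF)).aestronglyMeasurable
  rw [← eLpNorm_timeReflect hm]
  congr 1
  ext p
  rw [schrodingerPhase_reflect, oscIntegral_reflect, schrodingerBackward]

theorem exists_contDiff_approx (g : L2R) {ε : ℝ} (hε : 0 < ε) : ∃ F : ℝ → ℂ, ContDiff ℝ 1 F ∧
    (∃ K, ∀ η, K ≤ |η| → F η = 0) ∧ Integrable F ∧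
    eLpNorm (fun ξ => fourierHat g ξ - F ξ) 2 volume ≤ ENNReal.ofReal ε := by
  obtain ⟨F, hFs, hFd, hF⟩ := MemLp.exist_eLpNorm_sub_le (p := 2) (by norm_num) (by norm_num)
    (memLp_fourierHat g) hε
  refine ⟨F, hFd.of_le (by exact_mod_cast le_top), ?_,
    hFd.continuous.integrable_of_hasCompactSupport hFs, hF⟩
  obtain ⟨R, hR⟩ := hFs.isCompact.isBounded.subset_closedBall 0
  refine ⟨R + 1, fun η hη => ?_⟩
  by_contra hne
  have := hR (subset_tsupport F hne)
  rw [Metric.mem_closedBall, dist_zero_right, Real.norm_eq_abs] at this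
  linarith

theorem ten_mul_cube_rpow {N : ℝ} (hN : 0 < N) :
    (10 * N ^ 3) ^ (1 / 6 : ℝ) = (10 : ℝ) ^ (1 / 6 : ℝ) * Real.sqrt N := by
  rw [Real.mul_rpow (by norm_num) (by positivity), ← sqrt_pow_six hN.le, ← Real.rpow_natCast,
    ← Real.rpow_mul (Real.sqrt_nonneg _)]
  norm_num

theorem eLpNorm_rescale {N : ℝ} (hN : 0 < N) {u : ℝ × ℝ → ℂ}
    (hu : AEStronglyMeasurable u volume) :
    eLpNorm (fun p => ((Real.sqrt N)⁻¹ : ℂ) * u (boostMap N p)) 6 volume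
      = ENNReal.ofReal ((10 : ℝ) ^ (1 / 6 : ℝ)) * eLpNorm u 6 volume := by
  have h := eLpNorm_const_smul ((Real.sqrt N)⁻¹ : ℂ) (u ∘ boostMap N) 6 volume
  have hs : 0 < Real.sqrt N := Real.sqrt_pos.2 hN
  rw [eLpNorm_comp_boostMap hN hu, ten_mul_cube_rpow hN] at h
  refine h.trans ?_
  rw [← mul_assoc, ← ofReal_norm, ← ENNReal.ofReal_mul (norm_nonneg _)]
  congr 2
  rw [norm_inv, Complex.norm_real, Real.norm_of_nonneg hs.le]
  field_simp

/-- The rescaled extension of the two-profile datum is asymptotic to a superposition of two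
Schrödinger waves with opposite carriers. -/
theorem tendsto_eLpNorm_rescale_sub_wavePair (g₁ g₂ : L2R) :
    Tendsto (fun N : ℝ => eLpNorm (fun p => ((Real.sqrt N)⁻¹ : ℂ) *
        extension35 (twoProfile g₁ g₂ N) (boostMap N p)
        - wavePair N (schrodinger g₁) (schrodingerBackward g₂) p) 6 volume) atTop (𝓝 0) := by
  obtain ⟨C, hC⟩ := exists_hasExtensionBound_schrodinger
  obtain ⟨C', hC'⟩ := exists_hasExtensionBound_weight35
  set T := ENNReal.ofReal ((10 : ℝ) ^ (1 / 6 : ℝ)) with hT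
  set q : ℂ := 1 / (2 * Real.pi) with hq
  refine tendsto_zero_of_forall_le_add (C := T * C' * 2 + C * 2) ?_ fun ε hε => ?_
  · exact ENNReal.add_ne_top.2 ⟨ENNReal.mul_ne_top (ENNReal.mul_ne_top ENNReal.ofReal_ne_top hC'.1)
      (by norm_num), ENNReal.mul_ne_top hC.1 (by norm_num)⟩
  -- The `ε` in the criterion is the `L²` error of these smooth profiles; everything else tends to
  -- zero with the profiles fixed.
  obtain ⟨F₁, hd₁, ⟨K₁, hK₁⟩, hi₁, hε₁⟩ := exists_contDiff_approx g₁ hε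
  obtain ⟨F₂, hd₂, ⟨K₂, hK₂⟩, hi₂, hε₂⟩ := exists_contDiff_approx g₂ hε
  set K := max (max K₁ K₂) 0 with hK
  have hK0 : 0 ≤ K := le_max_right _ _
  have hF₁ : ∀ η, K ≤ |η| → F₁ η = 0 := fun η h =>
    hK₁ η (((le_max_left _ _).trans (le_max_left _ _)).trans h)
  have hF₂ : ∀ η, K ≤ |η| → F₂ η = 0 := fun η h =>
    hK₂ η (((le_max_right _ _).trans (le_max_left _ _)).trans h)
  have hm₁ := hd₁.continuous.measurable
  have hm₂ := hd₂.continuous.measurable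
  have hcurv : ∀ᶠ N in atTop, CurvedPhase (profilePhase N) K (1 / 4) (-1) := by
    filter_upwards [eventually_gt_atTop 0, eventually_ge_atTop (2 * K)] with N h h'
    exact curvedPhase_profilePhase h h'
  set P : ℝ → ℝ × ℝ → ℂ := fun N => oscIntegral (profilePhase N) F₁
  set Q : ℝ → ℝ × ℝ → ℂ := fun N => oscIntegral (fun η => -profilePhase N (-η)) F₂
  set P₀ : ℝ × ℝ → ℂ := oscIntegral schrodingerPhase F₁
  set Q₀ : ℝ × ℝ → ℂ := oscIntegral (fun η => -schrodingerPhase (-η)) F₂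
  have hP : Tendsto (fun N => eLpNorm (fun p => P N p - P₀ p) 6 volume) atTop (𝓝 0) :=
    tendsto_eLpNorm_oscIntegral_sub (Or.inr rfl) hK0 (by norm_num) hcurv
      (curvedPhase_schrodinger K) tendsto_profilePhase hd₁ hF₁
  have hQ : Tendsto (fun N => eLpNorm (fun p => Q N p - Q₀ p) 6 volume) atTop (𝓝 0) :=
    tendsto_eLpNorm_oscIntegral_sub (ψ := fun N η => -profilePhase N (-η)) (Or.inl rfl) hK0
      (by norm_num) (hcurv.mono fun N h => h.reflect)
      (curvedPhase_schrodinger K).reflect (fun η => (tendsto_profilePhase (-η)).neg) hd₂ hF₂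
  set r₁ : ℝ → ℝ≥0∞ := fun N =>
    eLpNorm (fun η => F₁ η * (1 - (weightRatio N (1 * η) : ℂ))) 2 volume
  set r₂ : ℝ → ℝ≥0∞ := fun N =>
    eLpNorm (fun η => F₂ η * (1 - (weightRatio N (-1 * η) : ℂ))) 2 volume
  have hr₁ : Tendsto r₁ atTop (𝓝 0) :=
    tendsto_eLpNorm_mul_one_sub_weightRatio hd₁.continuous (Or.inl rfl) hF₁
  have hr₂ : Tendsto r₂ atTop (𝓝 0) :=
    tendsto_eLpNorm_mul_one_sub_weightRatio hd₂.continuous (Or.inr rfl) hF₂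
  refine ⟨fun N => T * C' * (r₁ N + r₂ N) + (eLpNorm (fun p => P N p - P₀ p) 6 volume
    + eLpNorm (fun p => Q N p - Q₀ p) 6 volume), ?_, ?_⟩
  · have h1 := ENNReal.Tendsto.const_mul (a := T * C') (hr₁.add hr₂)
      (Or.inr (ENNReal.mul_ne_top ENNReal.ofReal_ne_top hC'.1))
    simpa using h1.add (hP.add hQ)
  filter_upwards [eventually_gt_atTop 0, eventually_ge_atTop K, hcurv] with N hN hNK hcN
  have hN0 : (Real.sqrt N : ℂ) ≠ 0 := by exact_mod_cast (Real.sqrt_pos.2 hN).ne'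
  set u := extension35 (twoProfile g₁ g₂ N) with hu
  have hue := isExtension_extension35 (twoProfile g₁ g₂ N)
  set a : ℝ → ℂ := fun ξ => (weight35 ξ : ℂ) * profileAmplitude F₁ F₂ N ξ with ha
  have ha' : a = fun ξ => (Real.sqrt N : ℂ) * F₁ (ξ - N) + (Real.sqrt N : ℂ) * F₂ (ξ + N) := by
    ext ξ
    rw [ha]
    simp only
    rw [weight35_mul_profileAmplitude hNK hF₁ hF₂, mul_add]
  have hi₁' : Integrable fun ξ => (Real.sqrt N : ℂ) * F₁ (ξ - N) :=
    (hi₁.comp_sub_right N).const_mul _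
  have hi₂' : Integrable fun ξ => (Real.sqrt N : ℂ) * F₂ (ξ + N) :=
    (hi₂.comp_add_right N).const_mul _
  have hai : Integrable a := by
    rw [ha']; exact hi₁'.add hi₂'
  have hpm : Measurable (profileAmplitude F₁ F₂ N) := by
    have h1 : Measurable fun ξ => Real.sqrt N / weight35 ξ :=
      measurable_const.div continuous_weight35.measurable
    unfold profileAmplitude
    fun_prop
  have ham : Measurable a := (Complex.measurable_ofReal.comp continuous_weight35.measurable).mul hpm
  have hosc_smul : ∀ (c : ℂ) (G : ℝ → ℂ) (p : ℝ × ℝ),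
      oscIntegral phase35 (fun ξ => c * G ξ) p = c * oscIntegral phase35 G p := fun c G p => by
    simp only [oscIntegral, mul_assoc]
    rw [integral_const_mul]
  have hoscboost : ∀ p, ((Real.sqrt N)⁻¹ : ℂ) * (q * oscIntegral phase35 a (boostMap N p))
      = q * wavePair N (P N) (Q N) p := fun p => by
    rw [ha', oscIntegral_add measurable_phase35 hi₁' hi₂', Pi.add_apply, hosc_smul, hosc_smul,
      oscIntegral_phase35_boost hN, oscIntegral_phase35_boost_neg hN, wavePair]
    field_simp
    rfl
  have hmP : AEStronglyMeasurable (P N) volume :=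
    (stronglyMeasurable_oscIntegral hcN.continuous.measurable hm₁).aestronglyMeasurable
  have hmQ : AEStronglyMeasurable (Q N) volume :=
    (stronglyMeasurable_oscIntegral hcN.reflect.continuous.measurable hm₂).aestronglyMeasurable
  have hmP₀ : AEStronglyMeasurable P₀ volume :=
    (stronglyMeasurable_oscIntegral measurable_schrodingerPhase hm₁).aestronglyMeasurable
  have hmQ₀ : AEStronglyMeasurable Q₀ volume :=
    (stronglyMeasurable_oscIntegral (curvedPhase_schrodinger K).reflect.continuous.measurable
      hm₂).aestronglyMeasurable
  set X : ℝ × ℝ → ℂ := fun p => u p - q * oscIntegral phase35 a p with hX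
  have hXm : AEStronglyMeasurable X volume := hue.1.1.sub (stronglyMeasurable_const.mul
    (stronglyMeasurable_oscIntegral measurable_phase35 ham)).aestronglyMeasurable
  have hXle : eLpNorm X 6 volume ≤ C' * ((ENNReal.ofReal ε + r₁ N) + (ENNReal.ofReal ε + r₂ N)) := by
    refine (hue.eLpNorm_sub_oscIntegral_le hC' continuous_weight35 measurable_phase35 hpm hai).trans
      ?_
    gcongr
    refine (eLpNorm_fourierHat_twoProfile_sub_le g₁ g₂ hm₁ hm₂ N).trans ?_
    gcongr
  have hv₁ := (eLpNorm_schrodinger_sub_le hC g₁ hm₁ hi₁).trans (mul_le_mul_right hε₁ C)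
  have hv₂ := (eLpNorm_schrodingerBackward_sub_le hC g₂ hm₂ hi₂).trans (mul_le_mul_right hε₂ C)
  set Y₁ : ℝ × ℝ → ℂ := fun p => schrodinger g₁ p - q * P₀ p with hY₁
  set Y₂ : ℝ × ℝ → ℂ := fun p => schrodingerBackward g₂ p - q * Q₀ p with hY₂
  have hmY₁ : AEStronglyMeasurable Y₁ volume :=
    (memLp_schrodinger g₁).1.sub (aestronglyMeasurable_const.mul hmP₀)
  have hmY₂ : AEStronglyMeasurable Y₂ volume :=
    (memLp_schrodingerBackward g₂).1.sub (aestronglyMeasurable_const.mul hmQ₀)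
  -- Three errors: replacing the datum of the extension (`X`), replacing the rescaled phases by
  -- their limits (`P N - P₀`, `Q N - Q₀`), and replacing the Schrödinger data (`Y₁`, `Y₂`).
  have hdec : (fun p => ((Real.sqrt N)⁻¹ : ℂ) * u (boostMap N p)
        - wavePair N (schrodinger g₁) (schrodingerBackward g₂) p)
      = (fun p => ((Real.sqrt N)⁻¹ : ℂ) * X (boostMap N p)) +
        (q • wavePair N (P N - P₀) (Q N - Q₀) - wavePair N Y₁ Y₂) := by
    ext p
    have h1 := hoscboost p
    simp only [hX, Pi.add_apply, Pi.sub_apply, Pi.smul_apply, smul_eq_mul, mul_sub, h1]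
    simp only [wavePair, Pi.sub_apply, hY₁, hY₂]
    ring
  have hboost : AEStronglyMeasurable (fun p => ((Real.sqrt N)⁻¹ : ℂ) * X (boostMap N p)) volume :=
    aestronglyMeasurable_const.mul
      (hXm.comp_quasiMeasurePreserving (quasiMeasurePreserving_boostMap hN))
  have hw1 : AEStronglyMeasurable (q • wavePair N (P N - P₀) (Q N - Q₀)) volume :=
    (aestronglyMeasurable_wavePair N (hmP.sub hmP₀) (hmQ.sub hmQ₀)).const_smul q
  have hw2 := aestronglyMeasurable_wavePair N hmY₁ hmY₂
  rw [hdec]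
  calc _ ≤ eLpNorm (fun p => ((Real.sqrt N)⁻¹ : ℂ) * X (boostMap N p)) 6 volume
        + (eLpNorm (q • wavePair N (P N - P₀) (Q N - Q₀)) 6 volume
          + eLpNorm (wavePair N Y₁ Y₂) 6 volume) := by
        refine (eLpNorm_add_le hboost (hw1.sub hw2) (by norm_num)).trans ?_
        gcongr
        exact eLpNorm_sub_le hw1 hw2 (by norm_num)
    _ ≤ T * (C' * ((ENNReal.ofReal ε + r₁ N) + (ENNReal.ofReal ε + r₂ N)))
        + ((eLpNorm (fun p => P N p - P₀ p) 6 volume + eLpNorm (fun p => Q N p - Q₀ p) 6 volume)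
          + (C * ENNReal.ofReal ε + C * ENNReal.ofReal ε)) := by
        gcongr
        · rw [eLpNorm_rescale hN hXm]
          gcongr
        · rw [eLpNorm_const_smul]
          calc _ ≤ 1 * eLpNorm (wavePair N (P N - P₀) (Q N - Q₀)) 6 volume := by
                gcongr
                exact enorm_one_div_two_pi_le
            _ ≤ _ := by
                rw [one_mul]
                exact eLpNorm_wavePair_le N (hmP.sub hmP₀) (hmQ.sub hmQ₀)
        · exact (eLpNorm_wavePair_le N hmY₁ hmY₂).trans (add_le_add hv₁ hv₂)
    _ = _ := by ring

/-! ### Averaging over the carrier. -/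

/-- The carrier phase as a linear functional. -/
def carrierFunctional (N : ℝ) : StrongDual ℝ (ℝ × ℝ) :=
  N • ContinuousLinearMap.snd ℝ ℝ ℝ + ((1 + 2 * N ^ 2) / 5) • ContinuousLinearMap.fst ℝ ℝ ℝ

theorem carrierFunctional_apply (N : ℝ) (p : ℝ × ℝ) :
    carrierFunctional N p = carrierPhase N p := by
  simp [carrierFunctional, carrierPhase]

/-- The Riemann–Lebesgue lemma along the carrier phases. -/
theorem tendsto_integral_exp_carrierPhase_mul (G : ℝ × ℝ → ℂ) {k : ℝ} (hk : 0 < k) :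
    Tendsto (fun N => ∫ p, Complex.exp (Complex.I * ((k * carrierPhase N p : ℝ) : ℂ)) * G p)
      atTop (𝓝 0) := by
  have : (volume : Measure (ℝ × ℝ)).IsAddHaarMeasure :=
    Measure.prod.instIsAddHaarMeasure (volume : Measure ℝ) (volume : Measure ℝ)
  have : ProperSpace (StrongDual ℝ (ℝ × ℝ)) := FiniteDimensional.proper ℝ _
  have hpi := Real.pi_pos
  -- The factor `-k/(2π)` matches the convention `e^{-2πi w(v)}` of the Fourier character. The value
  -- at `(0, 1)` already shows that the norm grows at least like `N`.
  have hlim : Tendsto (fun N => (-(k / (2 * Real.pi))) • carrierFunctional N) atTop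
      (cocompact (StrongDual ℝ (ℝ × ℝ))) := by
    rw [← Metric.cobounded_eq_cocompact, ← tendsto_norm_atTop_iff_cobounded]
    refine tendsto_atTop_mono (f := fun N => k / (2 * Real.pi) * N) (fun N => ?_)
      (tendsto_id.const_mul_atTop (by positivity))
    have h1 := ContinuousLinearMap.le_opNorm ((-(k / (2 * Real.pi))) • carrierFunctional N)
      ((0, 1) : ℝ × ℝ)
    have h2 : ‖((0, 1) : ℝ × ℝ)‖ = 1 := by simp [Prod.norm_def]
    rw [h2, mul_one] at h1
    refine le_trans ?_ h1
    rw [smul_apply, carrierFunctional_apply, smul_eq_mul, neg_mul, norm_neg]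
    have h3 : carrierPhase N (0, 1) = N := by simp [carrierPhase]
    rw [h3]
    exact le_abs_self _
  refine ((tendsto_integral_exp_smul_cocompact G volume).comp hlim).congr fun N => ?_
  simp only [Function.comp_apply]
  congr 1
  ext p
  rw [Circle.smul_def, Real.fourierChar_apply, smul_eq_mul, smul_apply,
    carrierFunctional_apply, smul_eq_mul]
  congr 2
  have : (Real.pi : ℂ) ≠ 0 := by exact_mod_cast hpi.ne'
  push_cast
  field_simp

/-- The mean of `|A + e^{iα} B|⁶` over `α`, in terms of `a = |A|` and `b = |B|`. -/
def meanSix (a b : ℝ) : ℝ := a ^ 6 + 9 * (a ^ 4 * b ^ 2) + 9 * (b ^ 4 * a ^ 2) + b ^ 6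

theorem norm_wavePair_pow_six (N : ℝ) (A B : ℝ × ℝ → ℂ) (p : ℝ × ℝ) :
    ‖wavePair N A B p‖ ^ 6 = meanSix ‖A p‖ ‖B p‖ +
      (Complex.exp (Complex.I * ((2 * carrierPhase N p : ℝ) : ℂ)) *
          ((6 * (‖A p‖ ^ 2 + ‖B p‖ ^ 2) ^ 2 + 6 * (‖A p‖ ^ 2 * ‖B p‖ ^ 2) : ℝ) *
            (A p * starRingEnd ℂ (B p))) +
        Complex.exp (Complex.I * ((4 * carrierPhase N p : ℝ) : ℂ)) *
          ((6 * (‖A p‖ ^ 2 + ‖B p‖ ^ 2) : ℝ) * (A p * starRingEnd ℂ (B p)) ^ 2) +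
        Complex.exp (Complex.I * ((6 * carrierPhase N p : ℝ) : ℂ)) *
          (2 * (A p * starRingEnd ℂ (B p)) ^ 3)).re := by
  set θ := carrierPhase N p
  set a := A p
  set b := B p
  set e := Complex.exp (Complex.I * (θ : ℂ)) with he
  have hpow : ∀ n : ℕ, Complex.exp (Complex.I * (((2 * n : ℕ) * θ : ℝ) : ℂ)) = (e ^ 2) ^ n :=
    fun n => by
      rw [he, ← pow_mul, ← Complex.exp_nat_mul]
      congr 1
      push_cast
      ring
  have h2 := hpow 1
  have h4 := hpow 2
  have h6 := hpow 3
  norm_num at h2 h4 h6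
  have hneg : Complex.exp (Complex.I * ((-θ : ℝ) : ℂ)) = starRingEnd ℂ e := by
    rw [he, ← Complex.exp_conj]
    simp
  have hee : e * starRingEnd ℂ e = 1 := by
    rw [Complex.mul_conj, Complex.normSq_eq_norm_sq, he, norm_exp_I_mul_ofReal]
    norm_num
  -- The square of the modulus is `|a|² + |b|² + 2 Re w`; in its cube, powers of `Re w` are
  -- rewritten through `Re w²` and `Re w³` using `|w|² = |a|²|b|²`.
  set w := e ^ 2 * (a * starRingEnd ℂ b) with hw
  have hnw : ‖w‖ ^ 2 = ‖a‖ ^ 2 * ‖b‖ ^ 2 := by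
    rw [hw, norm_mul, norm_pow, norm_mul, he, norm_exp_I_mul_ofReal, RCLike.norm_conj]
    ring
  have hZ : ‖e * a + starRingEnd ℂ e * b‖ ^ 2 = ‖a‖ ^ 2 + ‖b‖ ^ 2 + 2 * w.re := by
    have hc : ((‖e * a + starRingEnd ℂ e * b‖ ^ 2 : ℝ) : ℂ)
        = ((‖a‖ ^ 2 + ‖b‖ ^ 2 + 2 * w.re : ℝ) : ℂ) := by
      have hre : ((2 * w.re : ℝ) : ℂ) = w + starRingEnd ℂ w := by
        rw [Complex.add_conj]
      rw [Complex.ofReal_add, hre]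
      push_cast
      rw [← Complex.mul_conj', ← Complex.mul_conj', ← Complex.mul_conj', hw]
      simp only [map_add, map_mul, map_pow, Complex.conj_conj]
      linear_combination (a * starRingEnd ℂ a + b * starRingEnd ℂ b) * hee
    exact_mod_cast hc
  have hsix : ‖wavePair N A B p‖ ^ 6 = (‖a‖ ^ 2 + ‖b‖ ^ 2 + 2 * w.re) ^ 3 := by
    have : wavePair N A B p = e * a + starRingEnd ℂ e * b := by
      rw [wavePair, ← hneg]
    rw [this, ← hZ]
    ring
  rw [hsix]
  push_cast
  rw [h2, h4, h6]
  have hfac : e ^ 2 * ((6 * ((‖a‖ : ℂ) ^ 2 + (‖b‖ : ℂ) ^ 2) ^ 2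
        + 6 * ((‖a‖ : ℂ) ^ 2 * (‖b‖ : ℂ) ^ 2)) * (a * starRingEnd ℂ b))
      + (e ^ 2) ^ 2 * ((6 * ((‖a‖ : ℂ) ^ 2 + (‖b‖ : ℂ) ^ 2)) * (a * starRingEnd ℂ b) ^ 2)
      + (e ^ 2) ^ 3 * (2 * (a * starRingEnd ℂ b) ^ 3)
      = ((6 * (‖a‖ ^ 2 + ‖b‖ ^ 2) ^ 2 + 6 * (‖a‖ ^ 2 * ‖b‖ ^ 2) : ℝ) : ℂ) * w
        + ((6 * (‖a‖ ^ 2 + ‖b‖ ^ 2) : ℝ) : ℂ) * w ^ 2 + ((2 : ℝ) : ℂ) * w ^ 3 := by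
    rw [hw]
    push_cast
    ring
  rw [hfac]
  have hn : w.re ^ 2 + w.im ^ 2 = ‖a‖ ^ 2 * ‖b‖ ^ 2 := by
    rw [← hnw, ← Complex.normSq_eq_norm_sq, Complex.normSq_apply]
    ring
  rw [Complex.add_re, Complex.add_re, Complex.re_ofReal_mul, Complex.re_ofReal_mul,
    Complex.re_ofReal_mul]
  have hw2 : (w ^ 2).re = w.re ^ 2 - w.im ^ 2 := by
    simp [pow_two]
  have hw3 : (w ^ 3).re = w.re ^ 3 - 3 * w.re * w.im ^ 2 := by
    simp [pow_succ]
    ring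
  rw [hw2, hw3, meanSix]
  linear_combination (6 * w.re + 6 * (‖a‖ ^ 2 + ‖b‖ ^ 2)) * hn

theorem pow_six_le_add {a b M : ℝ} (hM : M = max a b) (ha : 0 ≤ a) (hb : 0 ≤ b) :
    M ^ 6 ≤ a ^ 6 + b ^ 6 := by
  have := pow_nonneg ha 6
  have := pow_nonneg hb 6
  rcases max_choice a b with h | h <;> rw [hM, h] <;> linarith

section

variable {A B : ℝ × ℝ → ℂ}

/-- Every term of the expansion is homogeneous of degree six in `(|A|, |B|)`, so this one majorant
serves them all. -/
theorem integrable_of_norm_le_pow_six {E : Type*} [NormedAddCommGroup E] (hA : MemLp A 6 volume)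
    (hB : MemLp B 6 volume) {G : ℝ × ℝ → E} (hG : AEStronglyMeasurable G volume) (c : ℝ)
    (h : ∀ p, ‖G p‖ ≤ c * (max ‖A p‖ ‖B p‖) ^ 6) (hc : 0 ≤ c) : Integrable G := by
  have hA6 : Integrable fun p => ‖A p‖ ^ 6 := hA.integrable_norm_pow (p := 6) (by norm_num)
  have hB6 : Integrable fun p => ‖B p‖ ^ 6 := hB.integrable_norm_pow (p := 6) (by norm_num)
  refine ((hA6.add hB6).const_mul c).mono' hG (Eventually.of_forall fun p => (h p).trans ?_)
  exact mul_le_mul_of_nonneg_left (pow_six_le_add rfl (norm_nonneg _) (norm_nonneg _)) hc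

theorem integrable_pow_four_mul_sq (hA : MemLp A 6 volume) (hB : MemLp B 6 volume) :
    Integrable fun p => ‖A p‖ ^ 4 * ‖B p‖ ^ 2 := by
  refine integrable_of_norm_le_pow_six hA hB ((hA.1.norm.pow 4).mul (hB.1.norm.pow 2)) 1
    (fun p => ?_) zero_le_one
  rw [Real.norm_of_nonneg (by positivity), one_mul,
    show max ‖A p‖ ‖B p‖ ^ 6 = max ‖A p‖ ‖B p‖ ^ 4 * max ‖A p‖ ‖B p‖ ^ 2 by ring]
  gcongr
  · exact le_max_left _ _
  · exact le_max_right _ _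

theorem integrable_norm_pow_six (hA : MemLp A 6 volume) : Integrable fun p => ‖A p‖ ^ 6 :=
  hA.integrable_norm_pow (p := 6) (by norm_num)

theorem integrable_meanSix (hA : MemLp A 6 volume) (hB : MemLp B 6 volume) :
    Integrable fun p => meanSix ‖A p‖ ‖B p‖ :=
  (((integrable_norm_pow_six hA).add ((integrable_pow_four_mul_sq hA hB).const_mul 9)).add
    ((integrable_pow_four_mul_sq hB hA).const_mul 9)).add (integrable_norm_pow_six hB)

theorem integral_meanSix (hA : MemLp A 6 volume) (hB : MemLp B 6 volume) :
    ∫ p, meanSix ‖A p‖ ‖B p‖ = (∫ p, ‖A p‖ ^ 6) + 9 * (∫ p, ‖A p‖ ^ 4 * ‖B p‖ ^ 2)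
      + 9 * (∫ p, ‖B p‖ ^ 4 * ‖A p‖ ^ 2) + ∫ p, ‖B p‖ ^ 6 := by
  have i1 := integrable_norm_pow_six hA
  have i2 := (integrable_pow_four_mul_sq hA hB).const_mul 9
  have i3 := (integrable_pow_four_mul_sq hB hA).const_mul 9
  have i4 := integrable_norm_pow_six hB
  have i12 : Integrable fun p => ‖A p‖ ^ 6 + 9 * (‖A p‖ ^ 4 * ‖B p‖ ^ 2) := i1.add i2
  have i123 : Integrable fun p => ‖A p‖ ^ 6 + 9 * (‖A p‖ ^ 4 * ‖B p‖ ^ 2)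
      + 9 * (‖B p‖ ^ 4 * ‖A p‖ ^ 2) := i12.add i3
  simp only [meanSix]
  rw [integral_add i123 i4, integral_add i12 i3, integral_add i1 i2,
    integral_const_mul, integral_const_mul]

theorem tendsto_integral_norm_wavePair_pow_six (hA : MemLp A 6 volume) (hB : MemLp B 6 volume) :
    Tendsto (fun N => ∫ p, ‖wavePair N A B p‖ ^ 6) atTop
      (𝓝 (∫ p, meanSix ‖A p‖ ‖B p‖)) := by
  set c₀ : ℝ × ℝ → ℂ := fun p => A p * starRingEnd ℂ (B p) with hc₀
  set G₁ : ℝ × ℝ → ℂ := fun p =>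
    (6 * (‖A p‖ ^ 2 + ‖B p‖ ^ 2) ^ 2 + 6 * (‖A p‖ ^ 2 * ‖B p‖ ^ 2) : ℝ) * c₀ p with hG₁
  set G₂ : ℝ × ℝ → ℂ := fun p => (6 * (‖A p‖ ^ 2 + ‖B p‖ ^ 2) : ℝ) * c₀ p ^ 2 with hG₂
  set G₃ : ℝ × ℝ → ℂ := fun p => 2 * c₀ p ^ 3 with hG₃
  have hc₀m : AEStronglyMeasurable c₀ volume :=
    hA.1.mul (Complex.continuous_conj.comp_aestronglyMeasurable hB.1)
  have hAn := hA.1.norm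
  have hBn := hB.1.norm
  have hc₀n : ∀ p, ‖c₀ p‖ ≤ max ‖A p‖ ‖B p‖ ^ 2 := fun p => by
    rw [hc₀, norm_mul, RCLike.norm_conj, pow_two]
    gcongr
    · exact le_max_left _ _
    · exact le_max_right _ _
  have ha : ∀ p, ‖A p‖ ≤ max ‖A p‖ ‖B p‖ := fun p => le_max_left _ _
  have hb : ∀ p, ‖B p‖ ≤ max ‖A p‖ ‖B p‖ := fun p => le_max_right _ _
  have i₁ : Integrable G₁ := by
    refine integrable_of_norm_le_pow_six hA hB ?_ 30 (fun p => ?_) (by norm_num)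
    · refine (Complex.continuous_ofReal.comp_aestronglyMeasurable ?_).mul hc₀m
      exact ((((hAn.pow 2).add (hBn.pow 2)).pow 2).const_mul 6).add
        (((hAn.pow 2).mul (hBn.pow 2)).const_mul 6)
    · rw [hG₁, norm_mul, Complex.norm_real, Real.norm_of_nonneg (by positivity)]
      set M := max ‖A p‖ ‖B p‖ with hM
      calc _ ≤ (6 * (M ^ 2 + M ^ 2) ^ 2 + 6 * (M ^ 2 * M ^ 2)) * M ^ 2 := by
            gcongr
            exacts [ha p, hb p, ha p, hb p, hc₀n p]
        _ = 30 * M ^ 6 := by ring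
  have i₂ : Integrable G₂ := by
    refine integrable_of_norm_le_pow_six hA hB ?_ 12 (fun p => ?_) (by norm_num)
    · refine (Complex.continuous_ofReal.comp_aestronglyMeasurable ?_).mul (hc₀m.pow 2)
      exact ((hAn.pow 2).add (hBn.pow 2)).const_mul 6
    · rw [hG₂, norm_mul, Complex.norm_real, Real.norm_of_nonneg (by positivity), norm_pow]
      set M := max ‖A p‖ ‖B p‖ with hM
      calc _ ≤ (6 * (M ^ 2 + M ^ 2)) * (M ^ 2) ^ 2 := by
            gcongr
            exacts [ha p, hb p, hc₀n p]
        _ = 12 * M ^ 6 := by ring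
  have i₃ : Integrable G₃ := by
    refine integrable_of_norm_le_pow_six hA hB ((hc₀m.pow 3).const_mul 2) 2 (fun p => ?_)
      (by norm_num)
    rw [hG₃, norm_mul, norm_pow, Complex.norm_ofNat]
    calc _ ≤ 2 * (max ‖A p‖ ‖B p‖ ^ 2) ^ 3 := by
          gcongr
          exact hc₀n p
      _ = _ := by ring
  have hosc : ∀ (k N : ℝ) {G : ℝ × ℝ → ℂ}, Integrable G → Integrable fun p =>
      Complex.exp (Complex.I * ((k * carrierPhase N p : ℝ) : ℂ)) * G p := fun k N G hG => by
    have := hG.mul_exp_I (θ := fun p => k * carrierPhase N p)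
      ((continuous_carrierPhase N).measurable.const_mul k)
    simpa only [mul_comm] using this
  have key : ∀ N, ∫ p, ‖wavePair N A B p‖ ^ 6 = (∫ p, meanSix ‖A p‖ ‖B p‖) +
      ((∫ p, Complex.exp (Complex.I * ((2 * carrierPhase N p : ℝ) : ℂ)) * G₁ p) +
        (∫ p, Complex.exp (Complex.I * ((4 * carrierPhase N p : ℝ) : ℂ)) * G₂ p) +
        ∫ p, Complex.exp (Complex.I * ((6 * carrierPhase N p : ℝ) : ℂ)) * G₃ p).re := fun N => by
    have j₁ := hosc 2 N i₁
    have j₂ := hosc 4 N i₂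
    have j₃ := hosc 6 N i₃
    have j₁₂ : Integrable fun p =>
        Complex.exp (Complex.I * ((2 * carrierPhase N p : ℝ) : ℂ)) * G₁ p +
        Complex.exp (Complex.I * ((4 * carrierPhase N p : ℝ) : ℂ)) * G₂ p := j₁.add j₂
    have j : Integrable fun p =>
        Complex.exp (Complex.I * ((2 * carrierPhase N p : ℝ) : ℂ)) * G₁ p +
        Complex.exp (Complex.I * ((4 * carrierPhase N p : ℝ) : ℂ)) * G₂ p +
        Complex.exp (Complex.I * ((6 * carrierPhase N p : ℝ) : ℂ)) * G₃ p := j₁₂.add j₃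
    rw [← integral_add j₁ j₂, ← integral_add j₁₂ j₃]
    have hre := integral_re j
    simp only [RCLike.re_to_complex] at hre
    refine Eq.trans ?_ (congrArg ((∫ p, meanSix ‖A p‖ ‖B p‖) + ·) hre)
    have hjre : Integrable fun p =>
        (Complex.exp (Complex.I * ((2 * carrierPhase N p : ℝ) : ℂ)) * G₁ p +
        Complex.exp (Complex.I * ((4 * carrierPhase N p : ℝ) : ℂ)) * G₂ p +
        Complex.exp (Complex.I * ((6 * carrierPhase N p : ℝ) : ℂ)) * G₃ p).re := j.re
    rw [← integral_add (integrable_meanSix hA hB) hjre]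
    exact integral_congr_ae (Eventually.of_forall fun p => norm_wavePair_pow_six N A B p)
  simp_rw [key]
  have hRL := ((tendsto_integral_exp_carrierPhase_mul G₁ (k := 2) (by norm_num)).add
    (tendsto_integral_exp_carrierPhase_mul G₂ (k := 4) (by norm_num))).add
    (tendsto_integral_exp_carrierPhase_mul G₃ (k := 6) (by norm_num))
  have hre := (Complex.continuous_re.tendsto _).comp hRL
  simpa using (tendsto_const_nhds (x := ∫ p, meanSix ‖A p‖ ‖B p‖)).add hre

/-! ### Hölder's inequality and the case of equality. -/

theorem normL6_nonneg (u : ℝ × ℝ → ℂ) : 0 ≤ normL6 u := ENNReal.toReal_nonneg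

theorem normL6_pow_six (hA : AEStronglyMeasurable A volume) :
    normL6 A ^ 6 = ∫ p, ‖A p‖ ^ 6 := by
  have h := integral_norm_eq_lintegral_enorm (hA.pow 6)
  simp only [Pi.pow_apply, norm_pow, enorm_pow] at h
  rw [h, normL6, ← ENNReal.toReal_pow, eLpNorm_six_pow]

/-- Hölder's inequality for the exponents `3/2` and `3`. -/
theorem integral_sq_mul_le {p q : ℝ × ℝ → ℝ} (hp : ∀ z, 0 ≤ p z) (hq : ∀ z, 0 ≤ q z)
    (hp3 : Integrable fun z => p z ^ 3) (hq3 : Integrable fun z => q z ^ 3)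
    (hpq : Integrable fun z => p z ^ 2 * q z) {X Y : ℝ} (hX : 0 ≤ X) (hY : 0 ≤ Y)
    (hpX : ∫ z, p z ^ 3 = X ^ 3) (hqY : ∫ z, q z ^ 3 = Y ^ 3) :
    ∫ z, p z ^ 2 * q z ≤ X ^ 2 * Y := by
  have hzero : ∀ f : ℝ × ℝ → ℝ, (∀ z, 0 ≤ f z) → (Integrable fun z => f z ^ 3) →
      ∫ z, f z ^ 3 = 0 → ∀ᵐ z, f z = 0 := fun f hf hfi h0 => by
    have := (integral_eq_zero_iff_of_nonneg (fun z => pow_nonneg (hf z) 3) hfi).1 h0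
    filter_upwards [this] with z hz
    simpa using hz
  rcases hX.eq_or_lt with rfl | hX'
  · have h0 := hzero p hp hp3 (by rw [hpX]; norm_num)
    rw [integral_eq_zero_of_ae (h0.mono fun z hz => by simp [hz])]
    simp
  rcases hY.eq_or_lt with rfl | hY'
  · have h0 := hzero q hq hq3 (by rw [hqY]; norm_num)
    rw [integral_eq_zero_of_ae (h0.mono fun z hz => by simp [hz])]
    simp
  have hpt : ∀ z, p z ^ 2 * q z ≤ X ^ 2 * Y * (2 / 3 * (X ^ 3)⁻¹) * p z ^ 3
      + X ^ 2 * Y * (1 / 3 * (Y ^ 3)⁻¹) * q z ^ 3 := fun z => by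
    set x := p z / X with hx
    set y := q z / Y with hy
    have hx0 : 0 ≤ x := div_nonneg (hp z) hX
    have hy0 : 0 ≤ y := div_nonneg (hq z) hY
    have ex : p z = X * x := by rw [hx]; field_simp
    have ey : q z = Y * y := by rw [hy]; field_simp
    rw [ex, ey]
    -- The difference of the two sides is `(x - y)² (2x + y)`.
    have hyoung : 3 * (x ^ 2 * y) ≤ 2 * x ^ 3 + y ^ 3 := by
      nlinarith [mul_nonneg (sq_nonneg (x - y)) (by positivity : 0 ≤ 2 * x + y)]
    have hXY : 0 < X ^ 2 * Y := by positivity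
    have e1 : X ^ 2 * Y * (2 / 3 * (X ^ 3)⁻¹) * (X * x) ^ 3
        + X ^ 2 * Y * (1 / 3 * (Y ^ 3)⁻¹) * (Y * y) ^ 3
        = X ^ 2 * Y * ((2 * x ^ 3 + y ^ 3) / 3) := by
      field_simp
    rw [e1]
    calc (X * x) ^ 2 * (Y * y) = X ^ 2 * Y * (x ^ 2 * y) := by ring
      _ ≤ _ := by gcongr; linarith
  calc ∫ z, p z ^ 2 * q z ≤ ∫ z, (X ^ 2 * Y * (2 / 3 * (X ^ 3)⁻¹) * p z ^ 3
      + X ^ 2 * Y * (1 / 3 * (Y ^ 3)⁻¹) * q z ^ 3) :=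
        integral_mono hpq ((hp3.const_mul _).add (hq3.const_mul _)) hpt
    _ = X ^ 2 * Y := by
        rw [integral_add (hp3.const_mul _) (hq3.const_mul _), integral_const_mul,
          integral_const_mul, hpX, hqY]
        field_simp
        norm_num

theorem integral_pow_four_mul_sq_le (hA : MemLp A 6 volume) (hB : MemLp B 6 volume) :
    ∫ p, ‖A p‖ ^ 4 * ‖B p‖ ^ 2 ≤ (normL6 A ^ 2) ^ 2 * normL6 B ^ 2 := by
  have e : ∀ x y : ℝ, x ^ 4 * y ^ 2 = (x ^ 2) ^ 2 * y ^ 2 := fun x y => by ring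
  have e6 : ∀ x : ℝ, (x ^ 2) ^ 3 = x ^ 6 := fun x => by ring
  have hAB := integrable_pow_four_mul_sq hA hB
  simp_rw [e] at hAB ⊢
  refine integral_sq_mul_le (p := fun z => ‖A z‖ ^ 2) (q := fun z => ‖B z‖ ^ 2)
    (fun z => by positivity) (fun z => by positivity) ?_ ?_ hAB (by positivity) (by positivity)
    ?_ ?_
  · simpa only [e6] using integrable_norm_pow_six hA
  · simpa only [e6] using integrable_norm_pow_six hB
  · simp only [e6, normL6_pow_six hA.1]
  · simp only [e6, normL6_pow_six hB.1]

theorem integral_meanSix_le (hA : MemLp A 6 volume) (hB : MemLp B 6 volume) :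
    ∫ p, meanSix ‖A p‖ ‖B p‖ ≤ normL6 A ^ 6 + 9 * ((normL6 A ^ 2) ^ 2 * normL6 B ^ 2)
      + 9 * ((normL6 B ^ 2) ^ 2 * normL6 A ^ 2) + normL6 B ^ 6 := by
  rw [integral_meanSix hA hB, normL6_pow_six hA.1, normL6_pow_six hB.1]
  have := integral_pow_four_mul_sq_le hA hB
  have := integral_pow_four_mul_sq_le hB hA
  linarith

/-- With `X`, `Y` the squared norms, `(5/2)(X+Y)³` exceeds the Hölder bound by `(3/2)(X+Y)(X-Y)²`.
-/
theorem integral_meanSix_div_ten_le (hA : MemLp A 6 volume) (hB : MemLp B 6 volume) :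
    (∫ p, meanSix ‖A p‖ ‖B p‖) / 10 ≤ (normL6 A ^ 2 + normL6 B ^ 2) ^ 3 / 4 := by
  have h := integral_meanSix_le hA hB
  have hX := sq_nonneg (normL6 A)
  have hY := sq_nonneg (normL6 B)
  have e1 : normL6 A ^ 6 = (normL6 A ^ 2) ^ 3 := by ring
  have e2 : normL6 B ^ 6 = (normL6 B ^ 2) ^ 3 := by ring
  rw [e1, e2] at h
  set X := normL6 A ^ 2
  set Y := normL6 B ^ 2
  nlinarith [mul_nonneg (add_nonneg hX hY) (sq_nonneg (X - Y))]

theorem integral_meanSix_div_ten_eq_iff (hA : MemLp A 6 volume) (hB : MemLp B 6 volume) :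
    (∫ p, meanSix ‖A p‖ ‖B p‖) / 10 = (normL6 A ^ 2 + normL6 B ^ 2) ^ 3 / 4 ↔
      ∀ᵐ p, ‖A p‖ = ‖B p‖ := by
  have hX := sq_nonneg (normL6 A)
  have hY := sq_nonneg (normL6 B)
  have e1 : normL6 A ^ 6 = (normL6 A ^ 2) ^ 3 := by ring
  have e2 : normL6 B ^ 6 = (normL6 B ^ 2) ^ 3 := by ring
  have hA6 := integrable_norm_pow_six hA
  have hB6 := integrable_norm_pow_six hB
  have hAB := integrable_meanSix hA hB
  constructor
  · intro h
    have hle := integral_meanSix_le hA hB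
    -- Equality leaves no room for the defect `(X+Y)(X-Y)²`.
    have hXY : normL6 A ^ 2 = normL6 B ^ 2 := by
      rw [e1, e2] at hle
      set X := normL6 A ^ 2
      set Y := normL6 B ^ 2
      have h1 : (X + Y) * (X - Y) ^ 2 ≤ 0 := by nlinarith
      have h2 : (X + Y) * (X - Y) ^ 2 = 0 :=
        le_antisymm h1 (mul_nonneg (add_nonneg hX hY) (sq_nonneg _))
      rcases mul_eq_zero.1 h2 with h3 | h3
      · linarith
      · have := pow_eq_zero_iff (two_ne_zero) |>.1 h3
        linarith
    have hs : Integrable fun p => 10 * (‖A p‖ ^ 6 + ‖B p‖ ^ 6) := (hA6.add hB6).const_mul 10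
    have hsub : Integrable fun p => 10 * (‖A p‖ ^ 6 + ‖B p‖ ^ 6) - meanSix ‖A p‖ ‖B p‖ :=
      hs.sub hAB
    have hintg : ∫ p, (10 * (‖A p‖ ^ 6 + ‖B p‖ ^ 6) - meanSix ‖A p‖ ‖B p‖) = 0 := by
      rw [integral_sub hs hAB, integral_const_mul, integral_add hA6 hB6, ← normL6_pow_six hA.1,
        ← normL6_pow_six hB.1, e1, e2]
      rw [← hXY] at h ⊢
      linarith
    -- With equal norms, the nonnegative function given by this factorization has integral zero, so
    -- it vanishes almost everywhere.
    have e : ∀ a b : ℝ, 10 * (a ^ 6 + b ^ 6) - meanSix a b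
        = 9 * ((a ^ 2 + b ^ 2) * (a ^ 2 - b ^ 2) ^ 2) := fun a b => by
      rw [meanSix]; ring
    have hae := (integral_eq_zero_iff_of_nonneg (fun p => by
      simp only [Pi.zero_apply, e]
      positivity) hsub).1 hintg
    filter_upwards [hae] with p hp
    simp only [Pi.zero_apply, e] at hp
    have h9 : (‖A p‖ ^ 2 + ‖B p‖ ^ 2) * (‖A p‖ ^ 2 - ‖B p‖ ^ 2) ^ 2 = 0 := by linarith
    have hsq : ‖A p‖ ^ 2 = ‖B p‖ ^ 2 := by
      rcases mul_eq_zero.1 h9 with h3 | h3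
      · have := sq_nonneg ‖A p‖
        have := sq_nonneg ‖B p‖
        linarith
      · have := pow_eq_zero_iff (two_ne_zero) |>.1 h3
        linarith
    exact (sq_eq_sq₀ (norm_nonneg _) (norm_nonneg _)).1 hsq
  · intro h
    have hN : normL6 A = normL6 B := by
      rw [normL6, normL6, eLpNorm_congr_norm_ae h]
    have hI : ∫ p, meanSix ‖A p‖ ‖B p‖ = 20 * normL6 B ^ 6 := by
      rw [normL6_pow_six hB.1, ← integral_const_mul]
      refine integral_congr_ae (h.mono fun p hp => ?_)
      simp only [hp, meanSix]
      ring
    rw [hI, hN]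
    ring

end

/-! ### The limit and the conclusion. -/

theorem normL6_rescale {N : ℝ} (hN : 0 < N) {u : ℝ × ℝ → ℂ}
    (hu : AEStronglyMeasurable u volume) :
    normL6 (fun p => ((Real.sqrt N)⁻¹ : ℂ) * u (boostMap N p))
      = (10 : ℝ) ^ (1 / 6 : ℝ) * normL6 u := by
  rw [normL6, eLpNorm_rescale hN hu, ENNReal.toReal_mul, ENNReal.toReal_ofReal (by positivity),
    normL6]

theorem abs_normL6_sub_le {u v : ℝ × ℝ → ℂ} (hu : MemLp u 6 volume) (hv : MemLp v 6 volume) :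
    |normL6 u - normL6 v| ≤ (eLpNorm (fun p => u p - v p) 6 volume).toReal := by
  have hle : ∀ {f g : ℝ × ℝ → ℂ}, MemLp f 6 volume → MemLp g 6 volume →
      normL6 f ≤ (eLpNorm (f - g) 6 volume).toReal + normL6 g := fun {f g} hf hg => by
    rw [normL6, normL6, ← ENNReal.toReal_add (hf.sub hg).2.ne hg.2.ne]
    refine ENNReal.toReal_mono (ENNReal.add_ne_top.2 ⟨(hf.sub hg).2.ne, hg.2.ne⟩) ?_
    have := eLpNorm_add_le (p := 6) (hf.sub hg).1 hg.1 (by norm_num)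
    rwa [sub_add_cancel] at this
  have h1 := hle hu hv
  have h2 := hle hv hu
  rw [eLpNorm_sub_comm] at h2
  change _ ≤ (eLpNorm (u - v) 6 volume).toReal
  rw [abs_le]
  constructor <;> linarith

theorem memLp_wavePair (N : ℝ) {A B : ℝ × ℝ → ℂ} (hA : MemLp A 6 volume) (hB : MemLp B 6 volume) :
    MemLp (wavePair N A B) 6 volume :=
  ⟨aestronglyMeasurable_wavePair N hA.1 hB.1, (eLpNorm_wavePair_le N hA.1 hB.1).trans_lt
    (ENNReal.add_lt_top.2 ⟨hA.2, hB.2⟩)⟩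

theorem normL6_eq_rpow {A : ℝ × ℝ → ℂ} (hA : AEStronglyMeasurable A volume) :
    normL6 A = (∫ p, ‖A p‖ ^ 6) ^ (1 / 6 : ℝ) := by
  rw [← normL6_pow_six hA, ← Real.rpow_natCast, ← Real.rpow_mul (normL6_nonneg A)]
  norm_num

/-- The reverse triangle inequality compares `10^{1/6}` times the norm of the extension with the
norm of the wave pair; the denominator `10` is this Jacobian constant to the sixth power. -/
theorem tendsto_normL6_extension35_twoProfile (g₁ g₂ : L2R) :
    Tendsto (fun N : ℝ => normL6 (extension35 (twoProfile g₁ g₂ N))) atTop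
      (𝓝 (((∫ p, meanSix ‖schrodinger g₁ p‖ ‖schrodingerBackward g₂ p‖) / 10) ^ (1 / 6 : ℝ))) := by
  have hA := memLp_schrodinger g₁
  have hB := memLp_schrodingerBackward g₂
  set J := ∫ p, meanSix ‖schrodinger g₁ p‖ ‖schrodingerBackward g₂ p‖
  have hJ : 0 ≤ J := integral_nonneg fun p => by
    simp only [Pi.zero_apply, meanSix]; positivity
  set T := (10 : ℝ) ^ (1 / 6 : ℝ) with hT
  have hT0 : 0 < T := by positivity
  set w : ℝ → ℝ := fun N => normL6 (wavePair N (schrodinger g₁) (schrodingerBackward g₂))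
  have hw : Tendsto w atTop (𝓝 (J ^ (1 / 6 : ℝ))) := by
    have h := (tendsto_integral_norm_wavePair_pow_six hA hB).rpow_const (p := 1 / 6)
      (Or.inr (by norm_num))
    exact h.congr fun N => (normL6_eq_rpow (memLp_wavePair N hA hB).1).symm
  have hD := (ENNReal.tendsto_toReal ENNReal.zero_ne_top).comp
    (tendsto_eLpNorm_rescale_sub_wavePair g₁ g₂)
  have hdiff : Tendsto (fun N => T * normL6 (extension35 (twoProfile g₁ g₂ N)) - w N) atTop
      (𝓝 0) := by
    refine squeeze_zero_norm' ?_ hD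
    filter_upwards [eventually_gt_atTop 0] with N hN
    have hu := (isExtension_extension35 (twoProfile g₁ g₂ N)).1
    have hres : MemLp (fun p => ((Real.sqrt N)⁻¹ : ℂ) *
        extension35 (twoProfile g₁ g₂ N) (boostMap N p)) 6 volume :=
      ⟨aestronglyMeasurable_const.mul
        (hu.1.comp_quasiMeasurePreserving (quasiMeasurePreserving_boostMap hN)), by
        rw [eLpNorm_rescale hN hu.1]
        exact ENNReal.mul_lt_top ENNReal.ofReal_lt_top hu.2⟩
    rw [← normL6_rescale hN hu.1]
    exact abs_normL6_sub_le hres (memLp_wavePair N hA hB)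
  have hsum := ((hdiff.add hw).const_mul T⁻¹)
  have hlim : T⁻¹ * (0 + J ^ (1 / 6 : ℝ)) = (J / 10) ^ (1 / 6 : ℝ) := by
    rw [zero_add, Real.div_rpow hJ (by norm_num), inv_mul_eq_div]
  rw [hlim] at hsum
  refine hsum.congr fun N => ?_
  rw [sub_add_cancel, inv_mul_cancel_left₀ hT0.ne']

theorem four_rpow_mul_sqrt_eq {Z : ℝ} (hZ : 0 ≤ Z) :
    (4 : ℝ) ^ (-(1 / 6) : ℝ) * Z ^ (1 / 2 : ℝ) = (Z ^ 3 / 4) ^ (1 / 6 : ℝ) := by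
  rw [Real.div_rpow (pow_nonneg hZ 3) (by norm_num), Real.rpow_neg (by norm_num),
    ← Real.rpow_natCast, ← Real.rpow_mul hZ, inv_mul_eq_div]
  norm_num

end

theorem propositionP (g₁ g₂ : L2R) :
    -- all the functions below are well defined and lie in `L⁶(ℝ²)`
    IsExtension schrodingerWeight schrodingerPhase g₁ (schrodinger g₁) ∧
    IsExtension schrodingerWeight schrodingerPhase g₂ (schrodinger g₂) ∧
    (∀ N : ℝ, IsExtension weight35 phase35 (twoProfile g₁ g₂ N)
      (extension35 (twoProfile g₁ g₂ N))) ∧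
    -- the limit exists, satisfies the bound, and equality is characterized
    ∃ L : ℝ,
      Tendsto (fun N : ℝ => normL6 (extension35 (twoProfile g₁ g₂ N))) atTop (𝓝 L) ∧
      L ≤ (4 : ℝ) ^ (-(1 / 6) : ℝ) *
        (normL6 (schrodinger g₁) ^ 2 + normL6 (schrodinger g₂) ^ 2) ^ (1 / 2 : ℝ) ∧
      (L = (4 : ℝ) ^ (-(1 / 6) : ℝ) *
          (normL6 (schrodinger g₁) ^ 2 + normL6 (schrodinger g₂) ^ 2) ^ (1 / 2 : ℝ) ↔
        ∀ᵐ p : ℝ × ℝ, ‖schrodinger g₁ p‖ = ‖schrodinger g₂ (-p.1, p.2)‖) := by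
  refine ⟨isExtension_schrodinger g₁, isExtension_schrodinger g₂,
    fun N => isExtension_extension35 _, _, tendsto_normL6_extension35_twoProfile g₁ g₂, ?_⟩
  have hA := memLp_schrodinger g₁
  have hB := memLp_schrodingerBackward g₂
  -- Time reversal preserves the `L⁶` norm, so the backward wave may replace the forward one in the
  -- bound.
  have hBn : normL6 (schrodinger g₂) = normL6 (schrodingerBackward g₂) := by
    rw [normL6, normL6, ← eLpNorm_timeReflect (memLp_schrodinger g₂).1]
    rfl
  rw [hBn]
  have hZ0 : 0 ≤ normL6 (schrodinger g₁) ^ 2 + normL6 (schrodingerBackward g₂) ^ 2 :=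
    add_nonneg (sq_nonneg _) (sq_nonneg _)
  have hJ : 0 ≤ (∫ p, meanSix ‖schrodinger g₁ p‖ ‖schrodingerBackward g₂ p‖) / 10 :=
    div_nonneg (integral_nonneg fun p => by
    simp only [Pi.zero_apply, meanSix]; positivity) (by norm_num)
  rw [four_rpow_mul_sqrt_eq hZ0]
  refine ⟨Real.rpow_le_rpow hJ (integral_meanSix_div_ten_le hA hB) (by norm_num), ?_⟩
  rw [Real.rpow_left_inj hJ (div_nonneg (pow_nonneg hZ0 3) (by norm_num)) (by norm_num)]
  exact integral_meanSix_div_ten_eq_iff hA hB
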